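/- Let $G$ be a finite connected graph with at least one edge (loops and multiple edges allowed), with edge set $E$, each edge being identified with $[0,1]$. Let $\mathcal A_+$ be the set of pairs $(g,\rho)$, where $g=(g_e)_{e\in E}$ with $g_e>0$ is a metric on $G$ (the edge $e$ carries $g_e\,dx^2$, so it has length $\ell_e=\sqrt{g_e}$), and $\rho=(\rho_e)_{e\in E}$ is a density whose components $\rho_e:[0,1]\to(0,\infty)$ are smooth up to the end points (no continuity of $\rho$ across vertices is required). For $(g,\rho)\in\mathcal A_+$ let $0=\lambda_0(g,\rho)<\lambda_1(g,\rho)\le\lambda_2(g,\rho)\le\cdots$ be the eigenvalues, repeated according to multiplicity, of the problem $-\frac{1}{g_e}f_e''=\lambda\rho_e f_e$ on every edge $e$, where $f$ is continuous on $G$ and at every vertex the sum of the arclength derivatives of $f$ along all edge ends at that vertex, directed away from the vertex, is zero. For $\alpha\in\mathbb R$ and an integer $k\ge 0$ put $$\overline{\lambda_k}^{(\alpha)}(g,\rho)=\lambda_k(g,\rho)\Big(\sum_{e\in E}g_e^{1-\alpha}\Big)\Big(\sum_{e\in E}g_e^{\alpha}\int_0^1\rho_e\,dx\Big).$$ Let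 $\alpha\notin\{1/2,1\}$. Then: (i) if $k\ge 1$, every maximiser and every minimiser $(g,\rho)$ of $\overline{\lambda_k}^{(\alpha)}$ over $\mathcal A_+$ consists of a regular metric $g$ (all edge lengths are equal) and a density $\rho$ that is constant on $G$; (ii) if $\overline{\lambda_k}^{(\alpha)}$ has both a maximiser and a minimiser in $\mathcal A_+$, then $\overline{\lambda_k}^{(\alpha)}$ is constant on $\mathcal A_+$. -/

import Mathlib

/-- A multigraph with vertex set `V` and edge set `E`; loops and multiple edges are allowed.
Each edge is parametrised by `[0, 1]`, running from its end `src e` (parameter `0`) to its end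
`tgt e` (parameter `1`); this orientation is an arbitrary choice of parametrisation. -/
structure Multigraph (V E : Type*) where
  src : E → V
  tgt : E → V

namespace Multigraph

/-- The graph is connected: it has a vertex, and any two vertices are joined by a path. -/
def Connected {V E : Type*} (G : Multigraph V E) : Prop :=
  (SimpleGraph.fromRel fun u v => ∃ e, G.src e = u ∧ G.tgt e = v).Connected

end Multigraph

/-- A pair of a metric and a density function on a graph with edge set `E`. In the coordinate
`x ∈ [0, 1]` of the edge `e` the metric is `g e * dx ^ 2`, and the density is `ρ e x`. The density
is positive and smooth on every closed edge; edges meeting at a vertex may carry different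
densities there. Values of `ρ e` outside `[0, 1]` have no meaning and are never used. -/
structure MetricDensity (E : Type*) where
  g : E → ℝ
  ρ : E → ℝ → ℝ
  g_pos : ∀ e, 0 < g e
  ρ_smooth : ∀ e, ContDiffOn ℝ (⊤ : ℕ∞) (ρ e) (Set.Icc 0 1)
  ρ_pos : ∀ e, ∀ x ∈ Set.Icc (0 : ℝ) 1, 0 < ρ e x

namespace MetricDensity

/-- The length of an edge. -/
noncomputable def length {E : Type*} (p : MetricDensity E) (e : E) : ℝ := Real.sqrt (p.g e)

/-- The metric is regular: all edges have the same length. -/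
def IsRegular {E : Type*} (p : MetricDensity E) : Prop :=
  ∀ e e', p.length e = p.length e'

/-- The density is a constant function on the graph. -/
def HasConstantDensity {E : Type*} (p : MetricDensity E) : Prop :=
  ∃ c : ℝ, ∀ e, ∀ x ∈ Set.Icc (0 : ℝ) 1, p.ρ e x = c

end MetricDensity

namespace Multigraph

open Classical in
/-- `f` solves `Δ_g f = μ ρ f` on the edges, where `Δ_g f = - f'' / g` in the coordinate `x`, is
continuous on the graph, and at every vertex the derivatives of `f` with respect to arclength,
taken along all edge ends at that vertex and pointing into the edge, add up to zero (a loop has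
two ends at its vertex). Only the values of `f e` on `[0, 1]` matter. -/
structure IsSolution {V E : Type*} [Fintype E] (G : Multigraph V E) (p : MetricDensity E)
    (μ : ℝ) (f : E → ℝ → ℝ) : Prop where
  contDiffOn : ∀ e, ContDiffOn ℝ 2 (f e) (Set.Icc 0 1)
  equation : ∀ e, ∀ x ∈ Set.Icc (0 : ℝ) 1,
    -(derivWithin (derivWithin (f e) (Set.Icc 0 1)) (Set.Icc 0 1) x) / p.g e
      = μ * p.ρ e x * f e x
  continuous : ∃ u : V → ℝ, ∀ e, f e 0 = u (G.src e) ∧ f e 1 = u (G.tgt e)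
  kirchhoff : ∀ v : V,
    (∑ e : E, if G.src e = v then derivWithin (f e) (Set.Icc 0 1) 0 / p.length e else 0)
      + (∑ e : E, if G.tgt e = v then -(derivWithin (f e) (Set.Icc 0 1) 1) / p.length e else 0)
      = 0

/-- The eigenvalue `λ_k(g, ρ)`, where `λ_0 ≤ λ_1 ≤ ⋯` are the eigenvalues repeated according to
multiplicity: the least `Λ` for which there are `k + 1` eigenfunctions with eigenvalues at most
`Λ` that are linearly independent as functions on the graph. -/
noncomputable def eigenvalue {V E : Type*} [Fintype E] (G : Multigraph V E) (k : ℕ)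
    (p : MetricDensity E) : ℝ :=
  sInf {Λ : ℝ | ∃ (μ : Fin (k + 1) → ℝ) (f : Fin (k + 1) → E → ℝ → ℝ),
    (∀ i, μ i ≤ Λ ∧ G.IsSolution p (μ i) (f i)) ∧
    LinearIndependent ℝ (fun i => fun x : E × Set.Icc (0 : ℝ) 1 => f i x.1 x.2)}

/-- The `α`-normalised eigenvalue functional
`λ_k(g, ρ) (∑ e, g_e ^ (1 - α)) (∑ e, g_e ^ α ∫₀¹ ρ_e dx)`. -/
noncomputable def normalisedEigenvalue {V E : Type*} [Fintype E] (G : Multigraph V E) (k : ℕ)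
    (α : ℝ) (p : MetricDensity E) : ℝ :=
  G.eigenvalue k p * (∑ e : E, p.g e ^ (1 - α)) *
    (∑ e : E, p.g e ^ α * ∫ x in (0 : ℝ)..1, p.ρ e x)

end Multigraph

/-! In the unknowns `s e = 1 / ℓ_e` and `w e = ℓ_e * ρ_e` the weak eigenvalue problem on `H¹` of the
graph is `A u v = Λ * B u v` with `A = ∑ s e ∫ u' v'` and `B = ∑ ∫ w e u v`. Both forms are linear
in `(s, w)`, and with `M e = ∫ w e` the normalising factor is `(∑ s e ^ (2α - 2)) * (∑ s e ^ (1 -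
2α) * M e)`.

At an extremum the eigenvalue may be multiple and so need not be differentiable. It still moves
strictly in a given direction as soon as the first variation, a quadratic form on the eigenspace, is
definite (`eventually_lt`, `eventually_gt`). Hence at an extremum no direction has a definite
variation, and a Hahn-Banach separation among symmetric matrices
(`exists_sum_eq_zero_of_forall_not_pos`) yields eigenvectors `u i`, not all zero, whose summed first
variations vanish in every direction.

Density variations say that `∑ u i ^ 2` is a constant multiple of `s e ^ (1 - 2α)` on each edge.
Continuity and connectedness make these powers agree, and `α ≠ 1/2` makes all lengths equal.
Differentiating the constant function `∑ u i ^ 2` and using the equation shows that `∑ (u i')²` is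
proportional to `w e`; its derivative is a multiple of `∑ u i * u i' = 0`, so `w e` is constant on
each edge. Length variations give a second formula for `∑ ∫ (u i')²` on an edge. Comparing the two
leaves `(α - 1) * (|E| * w e - ∑ M) = 0`, and `α ≠ 1` makes the density the same on all edges.

For the second claim, scaling shows that all regular pairs with constant density have the same
normalised eigenvalue, so the maximum equals the minimum when `k ≥ 1`; for `k = 0` the functional is
zero. -/

open Filter Topology

/-! ### Compact pencils and the existence of Rayleigh minimisers. -/

/-- A pair of bounded symmetric bilinear forms, `A` nonnegative and `B` positive definite, such that
`A + B` is coercive and `B` is compact: up to an arbitrarily small multiple of the squared norm it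
is controlled by finitely many bounded functionals. -/
structure IsCompactPencil {X : Type*} [NormedAddCommGroup X] [NormedSpace ℝ X]
    (A B : X →L[ℝ] X →L[ℝ] ℝ) : Prop where
  symm_left : ∀ u v, A u v = A v u
  symm_right : ∀ u v, B u v = B v u
  nonneg : ∀ u, 0 ≤ A u u
  pos : ∀ u, u ≠ 0 → 0 < B u u
  coercive : ∃ κ > 0, ∀ u, κ * ‖u‖ ^ 2 ≤ A u u + B u u
  compact : ∀ ε > 0, ∃ (n : ℕ) (L : Fin n → X →L[ℝ] ℝ), ∀ u,
    B u u ≤ ε * ‖u‖ ^ 2 + ∑ i, L i u ^ 2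

/-- `u` is a (possibly zero) eigenvector of the pencil `(A, B)` with eigenvalue `μ`. -/
def IsPencilEigenvector {X : Type*} [NormedAddCommGroup X] [NormedSpace ℝ X]
    (A B : X →L[ℝ] X →L[ℝ] ℝ) (μ : ℝ) (u : X) : Prop :=
  ∀ v, A u v = μ * B u v

/-- A sequence of `B`-orthonormal eigenvectors of a pencil with increasing and unbounded
eigenvalues, satisfying the variational principle. -/
structure IsSpectralSequence {X : Type*} [NormedAddCommGroup X] [NormedSpace ℝ X]
    (A B : X →L[ℝ] X →L[ℝ] ℝ) (e : ℕ → X) (ν : ℕ → ℝ) : Prop where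
  eigen : ∀ n, IsPencilEigenvector A B (ν n) (e n)
  ortho : ∀ m n, B (e m) (e n) = if m = n then 1 else 0
  mono : Monotone ν
  unbounded : ∀ C, ∃ n, C < ν n
  min : ∀ n z, (∀ i < n, B (e i) z = 0) → ν n * B z z ≤ A z z

theorem exists_ne_zero_sum_eq_zero {n m : ℕ} (h : n < m) (M : Fin n → Fin m → ℝ) :
    ∃ c : Fin m → ℝ, c ≠ 0 ∧ ∀ i, ∑ j, c j * M i j = 0 := by
  let f : (Fin m → ℝ) →ₗ[ℝ] (Fin n → ℝ) := LinearMap.pi fun i => 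
    ∑ j, (M i j) • LinearMap.proj j
  have hf : LinearMap.ker f ≠ ⊥ := LinearMap.ker_ne_bot_of_finrank_lt (by simpa using h)
  obtain ⟨c, hc, hc0⟩ := (Submodule.ne_bot_iff _).mp hf
  refine ⟨c, hc0, fun i => ?_⟩
  have := congrFun (LinearMap.mem_ker.mp hc) i
  simpa [f, mul_comm] using this

section

variable {X : Type*} [NormedAddCommGroup X] [NormedSpace ℝ X] {A B : X →L[ℝ] X →L[ℝ] ℝ}

namespace IsCompactPencil

/-- A bounded family is Cauchy for `B` along every ultrafilter: finitely many functionals control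
`B` up to a small error, and they send the family into a compact ball of a finite-dimensional space,
where the ultrafilter converges. Ultrafilters replace the extraction of subsequences. -/
theorem exists_mem_ultrafilter_le (hP : IsCompactPencil A B) {ι : Type*} (l : Ultrafilter ι) {z : ι → X}
    {C : ℝ} (hz : ∀ n, ‖z n‖ ≤ C) {ε : ℝ} (hε : 0 < ε) :
    ∃ s ∈ l, ∀ n ∈ s, ∀ m ∈ s, B (z n - z m) (z n - z m) ≤ ε := by
  obtain ⟨N, L, hL⟩ := hP.compact (ε / (2 * (4 * C ^ 2 + 1))) (by positivity)
  let T : X →L[ℝ] (Fin N → ℝ) := ContinuousLinearMap.pi L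
  obtain ⟨δ, hδ, hδN⟩ : ∃ δ > 0, N * (2 * δ) ^ 2 ≤ ε / 2 := by
    -- `N + 1` instead of `N` covers the case of no functionals.
    refine ⟨Real.sqrt (ε / (8 * (N + 1))), by positivity, ?_⟩
    rw [mul_pow, Real.sq_sqrt (by positivity)]
    have : (N : ℝ) / (N + 1) ≤ 1 := by rw [div_le_one (by positivity)]; linarith
    calc (N : ℝ) * (2 ^ 2 * (ε / (8 * (N + 1)))) = (N / (N + 1)) * (ε / 2) := by
          field_simp; norm_num
      _ ≤ 1 * (ε / 2) := by gcongr
      _ = ε / 2 := one_mul _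
  have hmem : ↑(l.map fun n => T (z n)) ≤ 𝓟 (Metric.closedBall (0 : Fin N → ℝ) (‖T‖ * C)) := by
    rw [le_principal_iff, Ultrafilter.coe_map, Filter.mem_map]
    refine Filter.univ_mem' fun n => ?_
    exact mem_closedBall_zero_iff.mpr
      ((T.le_opNorm _).trans (mul_le_mul_of_nonneg_left (hz n) (norm_nonneg T)))
  obtain ⟨x, -, hx⟩ := (isCompact_closedBall (0 : Fin N → ℝ) (‖T‖ * C)).ultrafilter_le_nhds _ hmem
  refine ⟨{n | T (z n) ∈ Metric.ball x δ}, hx (Metric.ball_mem_nhds x hδ), fun n hn m hm => ?_⟩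
  have hn' : dist (T (z n)) x < δ := hn
  have hm' : dist (T (z m)) x < δ := hm
  have hd : ∀ i, L i (z n - z m) ^ 2 ≤ (2 * δ) ^ 2 := fun i => by
    have h1 := (dist_le_pi_dist (T (z n)) (T (z m)) i).trans (dist_triangle_right _ _ x)
    rw [Real.dist_eq] at h1
    have h2 : L i (z n - z m) = T (z n) i - T (z m) i := by simp [T]
    rw [h2, sq_le_sq, abs_of_pos (by positivity : 0 < 2 * δ)]
    linarith
  have h3 : ‖z n - z m‖ ≤ 2 * C := (norm_sub_le _ _).trans (by linarith [hz n, hz m])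
  have h4 : ‖z n - z m‖ ^ 2 ≤ 4 * C ^ 2 := by
    nlinarith [norm_nonneg (z n - z m)]
  calc B (z n - z m) (z n - z m)
      ≤ ε / (2 * (4 * C ^ 2 + 1)) * ‖z n - z m‖ ^ 2 + ∑ i, L i (z n - z m) ^ 2 := hL _
    _ ≤ ε / (2 * (4 * C ^ 2 + 1)) * (4 * C ^ 2 + 1) + ∑ _i : Fin N, (2 * δ) ^ 2 := by
        refine add_le_add ?_ (Finset.sum_le_sum fun i _ => hd i)
        gcongr
        linarith
    _ ≤ ε / 2 + ε / 2 := by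
        gcongr
        · apply le_of_eq; field_simp
        · simpa using hδN
    _ = ε := by ring

/-- A minimising sequence is Cauchy for `B` by compactness. The parallelogram law together with the
lower bound `ν * B ≤ A` on `Z` makes it Cauchy for `A` as well, hence in norm by coercivity; no weak
convergence is needed. -/
theorem exists_isMin [CompleteSpace X] (hP : IsCompactPencil A B) (Z : Submodule ℝ X)
    (hZ : IsClosed (Z : Set X)) (hne : ∃ z ∈ Z, z ≠ 0) :
    ∃ w ∈ Z, B w w = 1 ∧ ∀ z ∈ Z, A w w * B z z ≤ A z z := by
  obtain ⟨κ, hκ, hco⟩ := hP.coercive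
  set S : Set ℝ := (fun z => A z z) '' {z | z ∈ Z ∧ B z z = 1} with hS
  have hnorm : ∀ z ∈ Z, z ≠ 0 → ∃ c : ℝ, c ^ 2 * B z z = 1 ∧ c • z ∈ Z := fun z hz h0 => by
    have hb := hP.pos z h0
    refine ⟨(Real.sqrt (B z z))⁻¹, ?_, Z.smul_mem _ hz⟩
    rw [inv_pow, Real.sq_sqrt hb.le, inv_mul_cancel₀ hb.ne']
  have hSne : S.Nonempty := by
    obtain ⟨z, hz, h0⟩ := hne
    obtain ⟨c, hc, hcz⟩ := hnorm z hz h0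
    exact ⟨_, c • z, ⟨hcz, by simp; linarith⟩, rfl⟩
  have hbdd : BddBelow S := ⟨0, by rintro _ ⟨z, -, rfl⟩; exact hP.nonneg z⟩
  set ν := sInf S with hν
  have hν0 : 0 ≤ ν := le_csInf hSne (by rintro _ ⟨z, -, rfl⟩; exact hP.nonneg z)
  have hlow : ∀ z ∈ Z, ν * B z z ≤ A z z := fun z hz => by
    by_cases h0 : z = 0
    · simp [h0]
    obtain ⟨c, hc, hcz⟩ := hnorm z hz h0
    have h1 : ν ≤ A (c • z) (c • z) := csInf_le hbdd ⟨c • z, ⟨hcz, by simp; linarith⟩, rfl⟩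
    have h2 : A (c • z) (c • z) = c ^ 2 * A z z := by simp; ring
    have hb := hP.pos z h0
    have hc0 : 0 < c ^ 2 := by
      by_contra h
      nlinarith
    rw [h2] at h1
    have : c ^ 2 * (ν * B z z) ≤ c ^ 2 * A z z := by
      calc c ^ 2 * (ν * B z z) = ν * (c ^ 2 * B z z) := by ring
        _ = ν := by rw [hc, mul_one]
        _ ≤ _ := h1
    exact le_of_mul_le_mul_left this hc0
  have hex : ∀ n : ℕ, ∃ z ∈ Z, B z z = 1 ∧ A z z < ν + 1 / (n + 1) := fun n => by
    obtain ⟨_, ⟨z, ⟨hz, hb⟩, rfl⟩, hlt⟩ := exists_lt_of_csInf_lt hSne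
      (show sInf S < ν + 1 / (n + 1) by rw [← hν]; linarith [show (0 : ℝ) < 1 / (n + 1) by positivity])
    exact ⟨z, hz, hb, hlt⟩
  choose z hzZ hzB hzA using hex
  have hzC : ∀ n, ‖z n‖ ≤ Real.sqrt ((ν + 2) / κ) := fun n => by
    apply Real.le_sqrt_of_sq_le
    rw [le_div_iff₀ hκ]
    have h1 := hco (z n)
    have h2 : (1 : ℝ) / (n + 1) ≤ 1 := by
      rw [div_le_one (by positivity)]; linarith [(Nat.cast_nonneg n : (0 : ℝ) ≤ n)]
    rw [hzB n] at h1
    linarith [hzA n]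
  have hAlim : Tendsto (fun n => A (z n) (z n)) (hyperfilter ℕ) (𝓝 ν) := by
    have h : Tendsto (fun n => A (z n) (z n)) atTop (𝓝 ν) := by
      refine tendsto_of_tendsto_of_tendsto_of_le_of_le tendsto_const_nhds
        (h := fun n : ℕ => ν + 1 / ((n : ℝ) + 1)) ?_ (fun n => ?_) (fun n => (hzA n).le)
      · simpa using tendsto_one_div_add_atTop_nhds_zero_nat.const_add ν
      · have := hlow _ (hzZ n)
        rwa [hzB n, mul_one] at this
    exact h.mono_left (Nat.hyperfilter_le_atTop)
  have hcauchy : Cauchy (Filter.map z (hyperfilter ℕ)) := by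
    rw [Metric.cauchy_iff]
    refine ⟨inferInstance, fun ε hε => ?_⟩
    -- Below, the `A`-form of a difference is at most `(4 + ν) * η` and its `B`-form at most `η`, so
    -- their sum is at most `(5 + ν) * η`, which is half of `κ * ε ^ 2`.
    set η : ℝ := κ * ε ^ 2 / (2 * (5 + ν)) with hη
    have hη0 : 0 < η := by positivity
    obtain ⟨s, hs, hsB⟩ := hP.exists_mem_ultrafilter_le (hyperfilter ℕ) hzC hη0
    have ht : ∀ᶠ n in (hyperfilter ℕ : Filter ℕ), A (z n) (z n) < ν + η :=
      hAlim.eventually_lt_const (by linarith)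
    refine ⟨z '' (s ∩ {n | A (z n) (z n) < ν + η}), image_mem_map (inter_mem hs ht), ?_⟩
    rintro _ ⟨n, ⟨hn, hn'⟩, rfl⟩ _ ⟨m, ⟨hm, hm'⟩, rfl⟩
    simp only [Set.mem_ofPred_eq] at hn' hm'
    have hb := hsB n hn m hm
    have hplus := hlow (z n + z m) (Z.add_mem (hzZ n) (hzZ m))
    have hp : ∀ F : X →L[ℝ] X →L[ℝ] ℝ, F (z n - z m) (z n - z m) =
        2 * F (z n) (z n) + 2 * F (z m) (z m) - F (z n + z m) (z n + z m) := fun F => by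
      simp; ring
    have hA' := hp A
    have hB' := hp B
    rw [hzB, hzB] at hB'
    have hc := hco (z n - z m)
    have h1 : B (z n + z m) (z n + z m) = 4 - B (z n - z m) (z n - z m) := by linarith
    rw [h1] at hplus
    have h2 : A (z n - z m) (z n - z m) ≤ 4 * η + ν * η := by
      have : ν * B (z n - z m) (z n - z m) ≤ ν * η := by gcongr
      linarith
    have h3 : κ * ‖z n - z m‖ ^ 2 < κ * ε ^ 2 := by
      have : η * (2 * (5 + ν)) = κ * ε ^ 2 := by rw [hη]; field_simp
      nlinarith
    rw [dist_eq_norm]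
    exact lt_of_pow_lt_pow_left₀ 2 hε.le (lt_of_mul_lt_mul_left h3 hκ.le)
  obtain ⟨w, hw⟩ := CompleteSpace.complete hcauchy
  have hw' : Tendsto z (hyperfilter ℕ) (𝓝 w) := hw
  have hform : ∀ F : X →L[ℝ] X →L[ℝ] ℝ, Tendsto (fun n => F (z n) (z n)) (hyperfilter ℕ) (𝓝 (F w w)) :=
    fun F => by
      have hc : Continuous fun u : X => F u u := by fun_prop
      exact (hc.tendsto w).comp hw'
  have hAw : A w w = ν := tendsto_nhds_unique (hform A) hAlim
  have hBw : B w w = 1 := by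
    refine tendsto_nhds_unique (hform B) ?_
    simp only [hzB]
    exact tendsto_const_nhds
  refine ⟨w, hZ.mem_of_tendsto hw' (Eventually.of_forall hzZ), hBw, fun z hz => ?_⟩
  rw [hAw]
  exact hlow z hz

end IsCompactPencil

end

/-! ### Eigenvectors by successive minimisation. -/

section

variable {X : Type*} [NormedAddCommGroup X] [NormedSpace ℝ X] {A B : X →L[ℝ] X →L[ℝ] ℝ}

theorem LinearIndependent.exists_ne_zero_forall_eq_zero {n m : ℕ} {f : Fin m → X}
    (hf : LinearIndependent ℝ f) (h : n < m) (L : Fin n → X →L[ℝ] ℝ) :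
    ∃ c : Fin m → ℝ, c ≠ 0 ∧ ∑ j, c j • f j ≠ 0 ∧ ∀ i, L i (∑ j, c j • f j) = 0 := by
  obtain ⟨c, hc, hL⟩ := exists_ne_zero_sum_eq_zero h fun i j => L i (f j)
  refine ⟨c, hc, fun h0 => hc ?_, fun i => by simpa using hL i⟩
  exact funext fun j => Fintype.linearIndependent_iff.mp hf c h0 j

/-- No finite family of bounded functionals separates the points of an infinite-dimensional
space. -/
theorem exists_ne_zero_forall_eq_zero (hX : ¬ FiniteDimensional ℝ X) {n : ℕ} (L : Fin n → X →L[ℝ] ℝ) :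
    ∃ u : X, u ≠ 0 ∧ ∀ i, L i u = 0 := by
  by_contra! hcon
  refine hX (FiniteDimensional.of_injective (LinearMap.pi fun i => (L i : X →ₗ[ℝ] ℝ)) ?_)
  rw [← LinearMap.ker_eq_bot, Submodule.eq_bot_iff]
  intro u hu
  by_contra h0
  obtain ⟨i, hi⟩ := hcon u h0
  exact hi (congrFun (LinearMap.mem_ker.mp hu) i)

/-- The discriminant of a nonnegative quadratic is nonpositive, and here it is `a ^ 2`. This
extracts the first-order condition at a minimiser. -/
theorem eq_zero_of_forall_nonneg {a b : ℝ} (h : ∀ t : ℝ, 0 ≤ a * t + b * t ^ 2) : a = 0 := by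
  have hd := discrim_le_zero (a := b) (b := a) (c := 0) fun t => by linarith [h t]
  simpa [discrim] using le_antisymm (by simpa [discrim] using hd) (sq_nonneg a)

theorem linearIndependent_of_bilin_ortho {e : ℕ → X} (he : ∀ m n, B (e m) (e n) = if m = n then 1 else 0) :
    LinearIndependent ℝ e := by
  rw [linearIndependent_iff']
  intro s g hg i hi
  have := congrArg (B (e i)) hg
  simpa [he, hi] using this

namespace IsCompactPencil

variable [CompleteSpace X]

/-- Infinite dimension ensures that the `B`-orthogonal complement of finitely many vectors is not
zero, so that there is something to minimise over. -/
theorem exists_next (hP : IsCompactPencil A B) (hX : ¬ FiniteDimensional ℝ X) (n : ℕ)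
    (s : Fin n → X) : ∃ w, (∀ i, B (s i) w = 0) ∧ B w w = 1 ∧
      ∀ z, (∀ i, B (s i) z = 0) → A w w * B z z ≤ A z z := by
  let Z : Submodule ℝ X := ⨅ i, LinearMap.ker (B (s i) : X →ₗ[ℝ] ℝ)
  have hmem : ∀ z, z ∈ Z ↔ ∀ i, B (s i) z = 0 := fun z => by simp [Z]
  have hcl : IsClosed (Z : Set X) := by
    have : (Z : Set X) = ⋂ i, {z | B (s i) z = 0} := by ext z; simp [hmem]
    rw [this]
    exact isClosed_iInter fun i => isClosed_eq (by fun_prop) continuous_const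
  obtain ⟨u, hu, hLu⟩ := exists_ne_zero_forall_eq_zero hX fun i => B (s i)
  obtain ⟨w, hwZ, hw1, hw⟩ := hP.exists_isMin Z hcl ⟨u, (hmem u).mpr hLu, hu⟩
  exact ⟨w, (hmem w).mp hwZ, hw1, fun z hz => hw z ((hmem z).mpr hz)⟩

/-- Successive minimisers of the Rayleigh quotient. -/
noncomputable def minimiser (hP : IsCompactPencil A B) (hX : ¬ FiniteDimensional ℝ X) (n : ℕ) : X :=
  (hP.exists_next hX n fun i : Fin n => minimiser hP hX i).choose
termination_by n
decreasing_by all_goals exact i.2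

variable (hP : IsCompactPencil A B) (hX : ¬ FiniteDimensional ℝ X)

theorem minimiser_spec (n : ℕ) : (∀ i < n, B (hP.minimiser hX i) (hP.minimiser hX n) = 0) ∧
    B (hP.minimiser hX n) (hP.minimiser hX n) = 1 ∧
    ∀ z, (∀ i < n, B (hP.minimiser hX i) z = 0) →
      A (hP.minimiser hX n) (hP.minimiser hX n) * B z z ≤ A z z := by
  have h := (hP.exists_next hX n fun i : Fin n => hP.minimiser hX i).choose_spec
  have h0 : (hP.exists_next hX n fun i : Fin n => hP.minimiser hX i).choose = hP.minimiser hX n := by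
    rw [minimiser]
  rw [h0] at h
  exact ⟨fun i hi => h.1 ⟨i, hi⟩, h.2.1, fun z hz => h.2.2 z fun i => hz i i.2⟩

theorem minimiser_ortho (m n : ℕ) :
    B (hP.minimiser hX m) (hP.minimiser hX n) = if m = n then 1 else 0 := by
  split_ifs with h
  · rw [h]; exact (hP.minimiser_spec hX n).2.1
  · rcases Nat.lt_or_gt_of_ne h with h | h
    · exact (hP.minimiser_spec hX n).1 m h
    · rw [hP.symm_right]; exact (hP.minimiser_spec hX m).1 n h

/-- Stationarity gives the eigenvalue equation only against directions `B`-orthogonal to the earlier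
minimisers. Against the earlier minimisers both sides vanish, by symmetry and the inductive
hypothesis, and the two kinds of direction span everything. -/
theorem minimiser_eigen (n : ℕ) :
    IsPencilEigenvector A B (A (hP.minimiser hX n) (hP.minimiser hX n)) (hP.minimiser hX n) := by
  induction n using Nat.strong_induction_on with
  | _ n ih =>
    set e := hP.minimiser hX with he
    have hZ : ∀ z, (∀ i < n, B (e i) z = 0) → A (e n) z = A (e n) (e n) * B (e n) z := by
      intro z hz
      obtain ⟨h1, h2, h3⟩ := hP.minimiser_spec hX n
      have hq : ∀ t : ℝ, 0 ≤ (2 * (A (e n) z - A (e n) (e n) * B (e n) z)) * t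
          + (A z z - A (e n) (e n) * B z z) * t ^ 2 := fun t => by
        have h4 := h3 (e n + t • z) fun i hi => by
          rw [map_add, map_smul, hz i hi, h1 i hi]; simp
        simp only [map_add, map_smul, add_apply, smul_apply,
          smul_eq_mul, hP.symm_left z (e n), hP.symm_right z (e n)] at h4
        rw [← he] at h4 h2
        rw [h2] at h4
        linarith
      linarith [eq_zero_of_forall_nonneg hq]
    intro v
    set z := v - ∑ i ∈ Finset.range n, B (e i) v • e i with hz
    have hzZ : ∀ j < n, B (e j) z = 0 := fun j hj => by
      simp only [hz, map_sub, map_sum, map_smul, smul_eq_mul, he, hP.minimiser_ortho hX j]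
      simp [hj]
    have hv : v = z + ∑ i ∈ Finset.range n, B (e i) v • e i := by simp [hz]
    have hA : ∀ i ∈ Finset.range n, A (e n) (e i) = 0 ∧ B (e n) (e i) = 0 := fun i hi => by
      have hi' := Finset.mem_range.mp hi
      have h0 : B (e i) (e n) = 0 := (hP.minimiser_spec hX n).1 i hi'
      exact ⟨by rw [hP.symm_left, ih i hi' (e n), h0, mul_zero], by rw [hP.symm_right, h0]⟩
    have hsum : ∀ F : X →L[ℝ] X →L[ℝ] ℝ, (∀ i ∈ Finset.range n, F (e n) (e i) = 0) →
        F (e n) v = F (e n) z := fun F hF => by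
      conv_lhs => rw [hv]
      rw [map_add, map_sum, Finset.sum_eq_zero, add_zero]
      intro i hi
      rw [map_smul, hF i hi, smul_zero]
    rw [hsum A fun i hi => (hA i hi).1, hsum B fun i hi => (hA i hi).2]
    exact hZ z hzZ

theorem exists_isSpectralSequence (hP : IsCompactPencil A B) (hX : ¬ FiniteDimensional ℝ X) :
    ∃ e ν, IsSpectralSequence A B e ν := by
  refine ⟨hP.minimiser hX, fun n => A (hP.minimiser hX n) (hP.minimiser hX n),
    hP.minimiser_eigen hX, hP.minimiser_ortho hX, ?_, ?_, fun n => (hP.minimiser_spec hX n).2.2⟩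
  · refine monotone_nat_of_le_succ fun n => ?_
    have h := (hP.minimiser_spec hX n).2.2 (hP.minimiser hX (n + 1)) fun i hi =>
      (hP.minimiser_spec hX (n + 1)).1 i (hi.trans (Nat.lt_succ_self n))
    rwa [(hP.minimiser_spec hX (n + 1)).2.1, mul_one] at h
  · intro C
    by_contra! hC
    set e := hP.minimiser hX with he
    obtain ⟨κ, hκ, hco⟩ := hP.coercive
    have hC0 : 0 ≤ C := (hP.nonneg _).trans (hC 0)
    have hbd : ∀ n, ‖e n‖ ≤ Real.sqrt ((C + 1) / κ) := fun n => by
      apply Real.le_sqrt_of_sq_le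
      rw [le_div_iff₀ hκ]
      have h1 := hco (e n)
      have h2 : B (e n) (e n) = 1 := (hP.minimiser_spec hX n).2.1
      linarith [hC n]
    -- Bounded eigenvalues would bound the `e n` in norm. But distinct `B`-orthonormal vectors have
    -- squared `B`-distance `2`, which contradicts closeness within `1`; the hyperfilter supplies
    -- two distinct indices because singletons are negligible.
    obtain ⟨s, hs, hsB⟩ := hP.exists_mem_ultrafilter_le (hyperfilter ℕ) hbd one_pos
    obtain ⟨n, hn⟩ := nonempty_of_mem hs
    obtain ⟨m, hm, hmn⟩ := nonempty_of_mem
      (inter_mem hs (compl_mem_hyperfilter_of_finite (Set.finite_singleton n)))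
    have hmn' : m ≠ n := hmn
    have h := hsB m hm n hn
    simp only [map_sub, sub_apply, he, hP.minimiser_ortho hX] at h
    simp [hmn', hmn'.symm] at h
    linarith

end IsCompactPencil

end

/-! ### One-sided perturbation of eigenvalues. -/

section

variable {X : Type*} [NormedAddCommGroup X] [NormedSpace ℝ X]

/-- The form attains a positive minimum on the compact unit sphere of `W`. The sphere is empty
exactly when `W` is trivial, hence the two cases. -/
theorem exists_coercive_of_pos (D : X →L[ℝ] X →L[ℝ] ℝ) (W : Submodule ℝ X)
    [FiniteDimensional ℝ W] (hD : ∀ w ∈ W, w ≠ 0 → 0 < D w w) :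
    ∃ ε > 0, ∀ w ∈ W, ε * ‖w‖ ^ 2 ≤ D w w := by
  have : ProperSpace W := FiniteDimensional.proper ℝ W
  rcases (Metric.sphere (0 : W) 1).eq_empty_or_nonempty with h | h
  · refine ⟨1, one_pos, fun w hw => ?_⟩
    have hw0 : w = 0 := by
      by_contra h0
      have h0' : ‖(⟨w, hw⟩ : W)‖ ≠ 0 := by simpa using h0
      have : ‖(⟨w, hw⟩ : W)‖⁻¹ • (⟨w, hw⟩ : W) ∈ Metric.sphere (0 : W) 1 := by
        rw [mem_sphere_zero_iff_norm, norm_smul, norm_inv, norm_norm, inv_mul_cancel₀ h0']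
      rw [h] at this
      exact this
    simp [hw0]
  · have hc : Continuous fun w : W => D w w := by fun_prop
    obtain ⟨w₀, hw₀, hmin⟩ := (isCompact_sphere (0 : W) 1).exists_isMinOn h hc.continuousOn
    have hw₀' : ‖w₀‖ = 1 := mem_sphere_zero_iff_norm.mp hw₀
    refine ⟨D w₀ w₀, hD w₀ w₀.2 fun h0 => ?_, fun w hw => ?_⟩
    · rw [show w₀ = 0 from Subtype.ext h0, norm_zero] at hw₀'
      exact zero_ne_one hw₀'
    · by_cases h0 : w = 0
      · simp [h0]
      have h0' : ‖w‖ ≠ 0 := by simpa using h0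
      have hm : ‖w‖⁻¹ • (⟨w, hw⟩ : W) ∈ Metric.sphere (0 : W) 1 := by
        rw [mem_sphere_zero_iff_norm, norm_smul, norm_inv, norm_norm, Submodule.coe_norm,
          inv_mul_cancel₀ h0']
      have h1 : D w₀ w₀ ≤ ‖w‖⁻¹ * (‖w‖⁻¹ * D w w) := by simpa using hmin hm
      calc D w₀ w₀ * ‖w‖ ^ 2 ≤ ‖w‖⁻¹ * (‖w‖⁻¹ * D w w) * ‖w‖ ^ 2 := by gcongr
        _ = D w w := by field_simp

/-- A form that is coercive on `Y` and degenerate on the finite-dimensional space `W` becomes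
positive on `Y + W` under small perturbations which are positive on `W`. -/
theorem eventually_pos_of_perturbation {N D : X →L[ℝ] X →L[ℝ] ℝ} {F : ℝ → X →L[ℝ] X →L[ℝ] ℝ}
    {r : ℝ → ℝ}
    (hr : Tendsto r (𝓝[>] 0) (𝓝 0)) (hF : ∀ t u v, |F t u v - D u v| ≤ r t * ‖u‖ * ‖v‖) (Y W : Submodule ℝ X) [FiniteDimensional ℝ W]
    {γ : ℝ} (hγ : 0 < γ) (hY : ∀ y ∈ Y, γ * ‖y‖ ^ 2 ≤ N y y)
    (hW : ∀ w ∈ W, ∀ v, N w v = 0 ∧ N v w = 0) (hD : ∀ w ∈ W, w ≠ 0 → 0 < D w w) :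
    ∀ᶠ t in 𝓝[>] (0 : ℝ), ∀ y ∈ Y, ∀ w ∈ W, y + w ≠ 0 →
      0 < N (y + w) (y + w) + t * F t (y + w) (y + w) := by
  obtain ⟨ε, hε, hDε⟩ := exists_coercive_of_pos D W hD
  set C := ‖D‖ + ε / 2 with hC
  have hC0 : 0 < C := by positivity
  have h1 : ∀ᶠ t in 𝓝[>] (0 : ℝ), r t < ε / 2 := hr.eventually_lt_const (by positivity)
  -- The mixed terms are split by `2 C ‖y‖ ‖w‖ ≤ (ε / 4) ‖w‖² + (4 C² / ε) ‖y‖²`. Half of the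
  -- positivity on `W` survives, and the total loss on `Y` is `K ‖y‖²`, which the coercivity of `N`
  -- absorbs once `t * K < γ`.
  set K := 4 * C ^ 2 / ε + C with hK
  have hK0 : 0 < K := by positivity
  have h2 : ∀ᶠ t in 𝓝[>] (0 : ℝ), t < γ / K :=
    (tendsto_id.mono_left nhdsWithin_le_nhds).eventually_lt_const (by positivity)
  filter_upwards [h1, h2, self_mem_nhdsWithin] with t ht1 ht2 ht0 y hy w hw hne
  have ht0 : 0 < t := ht0
  have hFD : ∀ u v, |F t u v - D u v| ≤ ε / 2 * ‖u‖ * ‖v‖ := fun u v =>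
    (hF t u v).trans (by gcongr)
  have hb : ∀ u v, |F t u v| ≤ C * ‖u‖ * ‖v‖ := fun u v => by
    have h3 := D.le_opNorm₂ u v
    rw [Real.norm_eq_abs] at h3
    have h4 := abs_sub_abs_le_abs_sub (F t u v) (D u v)
    rw [hC, add_mul, add_mul]
    linarith [hFD u v]
  have hw1 : ε / 2 * ‖w‖ ^ 2 ≤ F t w w := by
    nlinarith [(abs_le.mp (hFD w w)).1, hDε w hw]
  have hN : N (y + w) (y + w) = N y y := by
    simp only [map_add, add_apply, (hW w hw _).1, (hW w hw _).2, add_zero]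
  have hexp : F t (y + w) (y + w) = F t y y + F t y w + F t w y + F t w w := by
    simp only [map_add, add_apply]; ring
  have hyy := (abs_le.mp (hb y y)).1
  have hyw := (abs_le.mp (hb y w)).1
  have hwy := (abs_le.mp (hb w y)).1
  have hmix : 2 * C * ‖y‖ * ‖w‖ ≤ ε / 4 * ‖w‖ ^ 2 + 4 * C ^ 2 / ε * ‖y‖ ^ 2 := by
    have h5 := sq_nonneg (ε / 4 * ‖w‖ - C * ‖y‖)
    have h6 : ε / 4 * ‖w‖ ^ 2 + 4 * C ^ 2 / ε * ‖y‖ ^ 2 - 2 * C * ‖y‖ * ‖w‖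
        = 4 / ε * (ε / 4 * ‖w‖ - C * ‖y‖) ^ 2 := by field_simp; ring
    have h7 : 0 ≤ 4 / ε * (ε / 4 * ‖w‖ - C * ‖y‖) ^ 2 := by positivity
    linarith
  have hlow : ε / 4 * ‖w‖ ^ 2 - K * ‖y‖ ^ 2 ≤ F t (y + w) (y + w) := by
    rw [hexp, hK]; nlinarith
  have htK : 0 < γ - t * K := by
    have := (lt_div_iff₀ hK0).mp ht2
    linarith
  rw [hN]
  have hfin : t * (ε / 4) * ‖w‖ ^ 2 + (γ - t * K) * ‖y‖ ^ 2 ≤ N y y + t * F t (y + w) (y + w) := by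
    have := mul_le_mul_of_nonneg_left hlow ht0.le
    linarith [hY y hy]
  refine lt_of_lt_of_le ?_ hfin
  by_cases hw0 : w = 0
  · have hy0 : 0 < ‖y‖ := norm_pos_iff.mpr fun h => hne (by rw [h, hw0, add_zero])
    rw [hw0, norm_zero]
    positivity
  · have : 0 < ‖w‖ := norm_pos_iff.mpr hw0
    positivity

variable {A B : X →L[ℝ] X →L[ℝ] ℝ} {e : ℕ → X} {ν : ℕ → ℝ}

namespace IsSpectralSequence

theorem right_apply_sum (h : IsSpectralSequence A B e ν) (s : Finset ℕ) (c : ℕ → ℝ) (j : ℕ) :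
    B (e j) (∑ i ∈ s, c i • e i) = if j ∈ s then c j else 0 := by
  simp [h.ortho]

theorem right_sum (h : IsSpectralSequence A B e ν) (s : Finset ℕ) (c : ℕ → ℝ) :
    B (∑ i ∈ s, c i • e i) (∑ i ∈ s, c i • e i) = ∑ i ∈ s, c i ^ 2 := by
  conv_lhs => rw [map_sum B]
  rw [sum_apply]
  refine Finset.sum_congr rfl fun i hi => ?_
  rw [map_smul, smul_apply, h.right_apply_sum, if_pos hi, smul_eq_mul, sq]

theorem left_sum (h : IsSpectralSequence A B e ν) (s : Finset ℕ) (c : ℕ → ℝ) :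
    A (∑ i ∈ s, c i • e i) (∑ i ∈ s, c i • e i) = ∑ i ∈ s, ν i * c i ^ 2 := by
  conv_lhs => rw [map_sum A]
  rw [sum_apply]
  refine Finset.sum_congr rfl fun i hi => ?_
  rw [map_smul, smul_apply, h.eigen i, h.right_apply_sum, if_pos hi, smul_eq_mul]
  ring

theorem linearIndependent (h : IsSpectralSequence A B e ν) : LinearIndependent ℝ e :=
  linearIndependent_of_bilin_ortho h.ortho

theorem right_sub_sum (h : IsSpectralSequence A B e ν) (u : X) {n j : ℕ} (hj : j < n) :
    B (e j) (u - ∑ i ∈ Finset.range n, B (e i) u • e i) = 0 := by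
  rw [map_sub, h.right_apply_sum, if_pos (Finset.mem_range.mpr hj), sub_self]

/-- The numbers `ν k` are the eigenvalues counted with multiplicity. -/
theorem isLeast (h : IsSpectralSequence A B e ν) (hP : IsCompactPencil A B) (k : ℕ) :
    IsLeast {Λ : ℝ | ∃ (μ : Fin (k + 1) → ℝ) (f : Fin (k + 1) → X),
      (∀ i, μ i ≤ Λ ∧ IsPencilEigenvector A B (μ i) (f i)) ∧ LinearIndependent ℝ f} (ν k) := by
  refine ⟨⟨fun i => ν i, fun i => e i, fun i => ⟨h.mono (Nat.lt_succ_iff.mp i.2), h.eigen i⟩,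
    h.linearIndependent.comp _ Fin.val_injective⟩, ?_⟩
  rintro Λ ⟨μ, f, hf, hli⟩
  by_contra! hlt
  -- The residual `z` of an eigenvector after projection on the first `k` vectors satisfies `A z z =
  -- μ j * B z z` with `μ j < ν k`, while the variational principle gives `ν k * B z z ≤ A z z`; so
  -- `z = 0`. All `k + 1` independent vectors would then lie in a `k`-dimensional span.
  have hspan : ∀ j, f j = ∑ i ∈ Finset.range k, B (e i) (f j) • e i := fun j => by
    set z := f j - ∑ i ∈ Finset.range k, B (e i) (f j) • e i with hz
    have hzB : ∀ i < k, B (e i) z = 0 := fun i hi => h.right_sub_sum (f j) hi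
    have hsum : ∀ F : X →L[ℝ] X →L[ℝ] ℝ, (∀ i < k, F (e i) z = 0) → F z z = F (f j) z :=
      fun F hF => by
        have h0 : F z z = F (f j - ∑ i ∈ Finset.range k, B (e i) (f j) • e i) z := by rw [← hz]
        rw [h0, map_sub F, map_sum F, sub_apply, sum_apply, Finset.sum_eq_zero, sub_zero]
        intro i hi
        rw [map_smul, smul_apply, hF i (Finset.mem_range.mp hi), smul_zero]
    have hA := hsum A fun i hi => by rw [h.eigen i, hzB i hi, mul_zero]
    have hB := hsum B hzB
    rw [(hf j).2 z, ← hB] at hA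
    have hmin := h.min k z hzB
    by_contra hne
    have hpos := hP.pos z (sub_ne_zero.mpr hne)
    have : μ j < ν k := (hf j).1.trans_lt hlt
    nlinarith
  obtain ⟨c, -, hne, hc⟩ :=
    hli.exists_ne_zero_forall_eq_zero (Nat.lt_succ_self k) fun i : Fin k => B (e i)
  refine hne ?_
  set u := ∑ j, c j • f j with hu
  have : u = ∑ i ∈ Finset.range k, B (e i) u • e i := by
    conv_lhs => rw [hu]
    simp only [hu, map_sum, map_smul, Finset.sum_smul]
    rw [Finset.sum_comm]
    refine Finset.sum_congr rfl fun j _ => ?_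
    conv_lhs => rw [hspan j]
    rw [Finset.smul_sum]
    exact Finset.sum_congr rfl fun i _ => by rw [smul_assoc]
  rw [this]
  refine Finset.sum_eq_zero fun i hi => ?_
  rw [hc ⟨i, Finset.mem_range.mp hi⟩, zero_smul]

theorem nonneg (h : IsSpectralSequence A B e ν) (hP : IsCompactPencil A B) (k : ℕ) : 0 ≤ ν k := by
  have h1 := hP.nonneg (e k)
  rwa [h.eigen k, h.ortho, if_pos rfl, mul_one] at h1

/-- The span of the members of a spectral sequence with eigenvalue `Λ`. -/
def eigenspan (e : ℕ → X) (ν : ℕ → ℝ) (Λ : ℝ) : Submodule ℝ X :=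
  Submodule.span ℝ (e '' {i | ν i = Λ})

theorem finite_setOf_le (h : IsSpectralSequence A B e ν) (Λ : ℝ) : {i | ν i ≤ Λ}.Finite := by
  obtain ⟨n, hn⟩ := h.unbounded Λ
  refine (Set.finite_lt_nat n).subset fun i hi => ?_
  by_contra hni
  have h1 : ν n ≤ ν i := h.mono (not_lt.mp hni)
  have h2 : ν i ≤ Λ := hi
  linarith

theorem finiteDimensional_eigenspan (h : IsSpectralSequence A B e ν) (Λ : ℝ) :
    FiniteDimensional ℝ (eigenspan e ν Λ) :=
  FiniteDimensional.span_of_finite ℝ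
    (((h.finite_setOf_le Λ).subset fun _ hi => le_of_eq hi).image e)

theorem isPencilEigenvector_of_mem (h : IsSpectralSequence A B e ν) {Λ : ℝ} {w : X}
    (hw : w ∈ eigenspan e ν Λ) : IsPencilEigenvector A B Λ w := by
  induction hw using Submodule.span_induction with
  | mem x hx =>
    obtain ⟨i, rfl, rfl⟩ := hx
    exact h.eigen i
  | zero => intro v; simp
  | add x y _ _ hx hy => intro v; rw [map_add, map_add, add_apply, add_apply, hx v, hy v]; ring
  | smul a x _ hx => 
    intro v; rw [map_smul, map_smul, smul_apply, smul_apply, hx v, smul_eq_mul, smul_eq_mul]; ring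

end IsSpectralSequence

end

section

variable {X : Type*} [NormedAddCommGroup X] [NormedSpace ℝ X]
  {A B : X →L[ℝ] X →L[ℝ] ℝ} {e : ℕ → X} {ν : ℕ → ℝ}

theorem tendsto_perturbation_bound (B B' : X →L[ℝ] X →L[ℝ] ℝ) {κ₀ : ℝ} {κ : ℝ → ℝ}
    (hκ : Tendsto κ (𝓝[>] 0) (𝓝 κ₀)) :
    Tendsto (fun t => |κ₀ - κ t| * ‖B‖ + |t * κ t| * ‖B'‖) (𝓝[>] 0) (𝓝 0) := by
  have h3 : Tendsto (fun t : ℝ => t) (𝓝[>] 0) (𝓝 0) := tendsto_id.mono_left nhdsWithin_le_nhds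
  have h4 := ((hκ.const_sub κ₀).abs.mul_const ‖B‖).add ((h3.mul hκ).abs.mul_const ‖B'‖)
  simpa using h4

/-- The form on the left is the exact coefficient of `t` in `(A + t A') - (Λ + t κ) (B + t B') = (A
- Λ B) + t (A' - κ B - (Λ + t κ) B')`. Allowing `κ` to depend on `t` lets the comparison value be an
arbitrary function with a right derivative. -/
theorem abs_perturbation_sub_le (A' B B' : X →L[ℝ] X →L[ℝ] ℝ) (Λ κ₀ κ t : ℝ) (u v : X) :
    |(A' - κ • B - (Λ + t * κ) • B') u v - (A' - κ₀ • B - Λ • B') u v| ≤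
      (|κ₀ - κ| * ‖B‖ + |t * κ| * ‖B'‖) * ‖u‖ * ‖v‖ := by
  have h1 : (A' - κ • B - (Λ + t * κ) • B') u v - (A' - κ₀ • B - Λ • B') u v
      = (κ₀ - κ) * B u v - t * κ * B' u v := by
    change (A' u v - κ * B u v - (Λ + t * κ) * B' u v) - (A' u v - κ₀ * B u v - Λ * B' u v) = _
    ring
  have h2 := B.le_opNorm₂ u v
  have h3 := B'.le_opNorm₂ u v
  rw [Real.norm_eq_abs] at h2 h3
  rw [h1]
  calc |(κ₀ - κ) * B u v - t * κ * B' u v| ≤ |κ₀ - κ| * |B u v| + |t * κ| * |B' u v| := by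
        rw [← abs_mul, ← abs_mul]; exact abs_sub _ _
    _ ≤ |κ₀ - κ| * (‖B‖ * ‖u‖ * ‖v‖) + |t * κ| * (‖B'‖ * ‖u‖ * ‖v‖) := by gcongr
    _ = _ := by ring

namespace IsSpectralSequence

/-- If the derivative of the pencil is positive on the eigenspace of `ν k`, then the `k`-th
eigenvalue grows. -/
theorem eventually_lt (h : IsSpectralSequence A B e ν) (hP : IsCompactPencil A B) (k : ℕ)
    (A' B' : X →L[ℝ] X →L[ℝ] ℝ) {κ : ℝ → ℝ} {κ₀ : ℝ} (hκ : Tendsto κ (𝓝[>] 0) (𝓝 κ₀))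
    (hD : ∀ w ∈ eigenspan e ν (ν k), w ≠ 0 → 0 < A' w w - κ₀ * B w w - ν k * B' w w) :
    ∀ᶠ t in 𝓝[>] (0 : ℝ), ∀ e' ν', IsSpectralSequence (A + t • A') (B + t • B') e' ν' →
      ν k + t * κ t < ν' k := by
  set Λ := ν k with hΛ
  have := h.finiteDimensional_eigenspan Λ
  -- The eigenvalue `Λ` occupies exactly the indices from `j` up to, but excluding, `l`.
  obtain ⟨l, hl, hll⟩ : ∃ l, Λ < ν l ∧ ∀ i < l, ν i ≤ Λ := by
    classical
    exact ⟨Nat.find (h.unbounded Λ), Nat.find_spec (h.unbounded Λ),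
      fun i hi => not_lt.mp (Nat.find_min (h.unbounded Λ) hi)⟩
  obtain ⟨j, hjk, hj, hjl⟩ : ∃ j ≤ k, Λ ≤ ν j ∧ ∀ i < j, ν i < Λ := by
    classical
    have hex : ∃ j, Λ ≤ ν j := ⟨k, le_rfl⟩
    exact ⟨Nat.find hex, Nat.find_min' hex le_rfl, Nat.find_spec hex,
      fun i hi => not_le.mp (Nat.find_min hex hi)⟩
  obtain ⟨c, hc, hco⟩ := hP.coercive
  let Y : Submodule ℝ X := ⨅ i : Fin l, LinearMap.ker (B (e i) : X →ₗ[ℝ] ℝ)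
  have hYmem : ∀ z, z ∈ Y ↔ ∀ i < l, B (e i) z = 0 := fun z => by
    simp only [Y, Submodule.mem_iInf, LinearMap.mem_ker, ContinuousLinearMap.coe_coe]
    exact ⟨fun hz i hi => hz ⟨i, hi⟩, fun hz i => hz i i.2⟩
  have hΛ0 : 0 ≤ Λ := h.nonneg hP k
  have hl1 : 0 < 1 + ν l := by linarith
  -- `(ν l - Λ) / (1 + ν l)` is the largest `θ` for which `ν l * B ≤ A` implies `θ * (A + B) ≤ A - Λ
  -- * B`.
  have hNY : ∀ y ∈ Y, (ν l - Λ) / (1 + ν l) * c * ‖y‖ ^ 2 ≤ (A - Λ • B) y y := fun y hy => by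
    have h1 := h.min l y ((hYmem y).mp hy)
    have h2 := hco y
    calc (ν l - Λ) / (1 + ν l) * c * ‖y‖ ^ 2 = (ν l - Λ) / (1 + ν l) * (c * ‖y‖ ^ 2) := by ring
      _ ≤ (ν l - Λ) / (1 + ν l) * (A y y + B y y) := by
          gcongr
      _ ≤ A y y - Λ * B y y := by
          rw [div_mul_eq_mul_div, div_le_iff₀ hl1]
          have h3 := mul_le_mul_of_nonneg_left h1 (show 0 ≤ 1 + Λ by linarith)
          linarith
  have hNW : ∀ w ∈ eigenspan e ν Λ, ∀ v, (A - Λ • B) w v = 0 ∧ (A - Λ • B) v w = 0 :=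
    fun w hw v => by
      have h1 : A w v = Λ * B w v := h.isPencilEigenvector_of_mem hw v
      have h2 : (A - Λ • B) w v = 0 := by
        change A w v - Λ * B w v = 0
        rw [h1, sub_self]
      refine ⟨h2, ?_⟩
      change A v w - Λ * B v w = 0
      rw [hP.symm_left, hP.symm_right, h1, sub_self]
  have hev := eventually_pos_of_perturbation (tendsto_perturbation_bound B B' hκ)
    (fun t u v => abs_perturbation_sub_le A' B B' Λ κ₀ (κ t) t u v) Y
    (eigenspan e ν Λ) (mul_pos (div_pos (sub_pos.mpr hl) hl1) hc) hNY hNW hD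
  filter_upwards [hev] with t ht e' ν' h'
  by_contra! hle
  -- The first `k + 1 > j` perturbed eigenvectors have a nonzero combination `u` that is
  -- `B`-orthogonal to the `j` unperturbed ones below `Λ`. Then `u` is an element of the eigenspace
  -- plus an element of `Y`, where the perturbed form is positive, whereas `hle` makes it
  -- nonpositive on `u`.
  obtain ⟨a, -, hne, ha⟩ := (h'.linearIndependent.comp (fun i : Fin (k + 1) => (i : ℕ))
    Fin.val_injective).exists_ne_zero_forall_eq_zero (Nat.lt_succ_of_le hjk)
    fun i : Fin j => B (e i)
  let a' : ℕ → ℝ := fun i => if hi : i < k + 1 then a ⟨i, hi⟩ else 0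
  have hsum : ∑ i, a i • (e' ∘ fun i : Fin (k + 1) => (i : ℕ)) i
      = ∑ i ∈ Finset.range (k + 1), a' i • e' i := by
    rw [Finset.sum_range]
    exact Finset.sum_congr rfl fun i _ => by simp only [a', i.2, dif_pos, Function.comp_apply]
  rw [hsum] at hne ha
  set u := ∑ i ∈ Finset.range (k + 1), a' i • e' i with hu
  have hAB : (A + t • A') u u ≤ (ν k + t * κ t) * (B + t • B') u u := by
    rw [hu, h'.left_sum, h'.right_sum, Finset.mul_sum]
    refine Finset.sum_le_sum fun i hi => mul_le_mul_of_nonneg_right ?_ (sq_nonneg _)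
    exact (h'.mono (Nat.lt_succ_iff.mp (Finset.mem_range.mp hi))).trans hle
  set w := ∑ i ∈ Finset.range l, B (e i) u • e i with hw
  have hwmem : w ∈ eigenspan e ν Λ := by
    refine Submodule.sum_mem _ fun i hi => ?_
    by_cases hij : i < j
    · rw [ha ⟨i, hij⟩, zero_smul]; exact Submodule.zero_mem _
    · refine Submodule.smul_mem _ _ (Submodule.subset_span ⟨i, ?_, rfl⟩)
      exact le_antisymm (hll i (Finset.mem_range.mp hi)) (hj.trans (h.mono (not_lt.mp hij)))
  have hymem : u - w ∈ Y := (hYmem _).mpr fun i hi => h.right_sub_sum u hi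
  have hpos := ht (u - w) hymem w hwmem (by rwa [sub_add_cancel])
  rw [sub_add_cancel] at hpos
  have h1 : (A - Λ • B) u u + t * (A' - κ t • B - (Λ + t * κ t) • B') u u
      = (A + t • A') u u - (Λ + t * κ t) * (B + t • B') u u := by
    change (A u u - Λ * B u u) + t * (A' u u - κ t * B u u - (Λ + t * κ t) * B' u u)
      = (A u u + t * A' u u) - (Λ + t * κ t) * (B u u + t * B' u u)
    ring
  linarith

/-- If the derivative of the pencil is negative on the eigenspace of `ν k`, then the `k`-th
eigenvalue decreases. -/
theorem eventually_gt (h : IsSpectralSequence A B e ν) (hP : IsCompactPencil A B) (k : ℕ)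
    (A' B' : X →L[ℝ] X →L[ℝ] ℝ) {κ : ℝ → ℝ} {κ₀ : ℝ} (hκ : Tendsto κ (𝓝[>] 0) (𝓝 κ₀))
    (hD : ∀ w ∈ eigenspan e ν (ν k), w ≠ 0 → A' w w - κ₀ * B w w - ν k * B' w w < 0) :
    ∀ᶠ t in 𝓝[>] (0 : ℝ), ∀ e' ν', IsSpectralSequence (A + t • A') (B + t • B') e' ν' →
      IsCompactPencil (A + t • A') (B + t • B') → ν' k < ν k + t * κ t := by
  set Λ := ν k with hΛ
  have := h.finiteDimensional_eigenspan Λ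
  let Y : Submodule ℝ X := Submodule.span ℝ (e '' {i | ν i < Λ})
  have hfin : {i | ν i < Λ}.Finite := (h.finite_setOf_le Λ).subset fun i (hi : ν i < Λ) => hi.le
  have : FiniteDimensional ℝ Y := FiniteDimensional.span_of_finite ℝ (hfin.image e)
  have hNpos : ∀ y ∈ Y, y ≠ 0 → 0 < (Λ • B - A) y y := fun y hy hy0 => by
    obtain ⟨a, ha⟩ : ∃ a : ℕ → ℝ, y = ∑ i ∈ hfin.toFinset, a i • e i := by
      have hy' : y ∈ Submodule.span ℝ (e '' (hfin.toFinset : Set ℕ)) := by simpa [Y] using hy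
      obtain ⟨a, ha⟩ := (Submodule.mem_span_image_finset_iff_exists_fun' ℝ).mp hy'
      exact ⟨a, ha.symm⟩
    change 0 < Λ * B y y - A y y
    have hB := hP.pos y hy0
    rw [ha, h.left_sum, h.right_sum, Finset.mul_sum, ← Finset.sum_sub_distrib]
    rw [ha, h.right_sum] at hB
    obtain ⟨i, hi, hai⟩ := Finset.exists_lt_of_sum_lt (f := fun _ => (0 : ℝ)) (by simpa using hB)
    refine Finset.sum_pos' (fun i hi => ?_) ⟨i, hi, ?_⟩
    · have : ν i < Λ := by simpa using hi
      have := mul_le_mul_of_nonneg_right this.le (sq_nonneg (a i))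
      linarith
    · have : ν i < Λ := by simpa using hi
      have := mul_lt_mul_of_pos_right this hai
      linarith
  obtain ⟨γ, hγ, hNY⟩ := exists_coercive_of_pos (Λ • B - A) Y hNpos
  have hNW : ∀ w ∈ eigenspan e ν Λ, ∀ v, (Λ • B - A) w v = 0 ∧ (Λ • B - A) v w = 0 :=
    fun w hw v => by
      have h1 : A w v = Λ * B w v := h.isPencilEigenvector_of_mem hw v
      have h2 : (Λ • B - A) w v = 0 := by
        change Λ * B w v - A w v = 0
        rw [h1, sub_self]
      refine ⟨h2, ?_⟩
      change Λ * B v w - A v w = 0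
      rw [hP.symm_left, hP.symm_right, h1, sub_self]
  have hev := eventually_pos_of_perturbation (F := fun t => -(A' - κ t • B - (Λ + t * κ t) • B'))
    (D := -(A' - κ₀ • B - Λ • B')) (tendsto_perturbation_bound B B' hκ) (fun t u v => by
      rw [neg_apply, neg_apply, neg_apply, neg_apply, neg_sub_neg, abs_sub_comm]
      exact abs_perturbation_sub_le A' B B' Λ κ₀ (κ t) t u v)
    Y (eigenspan e ν Λ) hγ hNY hNW fun w hw hw0 => neg_pos.mpr (hD w hw hw0)
  filter_upwards [hev] with t ht e' ν' h' hP'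
  by_contra! hle
  -- The roles are exchanged: a combination `u` of the first `k + 1` unperturbed eigenvectors is
  -- made orthogonal, for the perturbed right-hand form, to the first `k` perturbed ones and tested
  -- in their variational principle. Positivity of that form is why the perturbed pair must be a
  -- compact pencil.
  obtain ⟨a, -, hne, ha⟩ := (h.linearIndependent.comp (fun i : Fin (k + 1) => (i : ℕ))
    Fin.val_injective).exists_ne_zero_forall_eq_zero (Nat.lt_succ_self k)
    fun i : Fin k => (B + t • B') (e' i)
  set u := ∑ i, a i • (e ∘ fun i : Fin (k + 1) => (i : ℕ)) i with hu
  have hAB : (ν k + t * κ t) * (B + t • B') u u ≤ (A + t • A') u u :=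
    (mul_le_mul_of_nonneg_right hle (hP'.pos u hne).le).trans
      (h'.min k u fun i hi => ha ⟨i, hi⟩)
  have humem : u ∈ Y ⊔ eigenspan e ν Λ := by
    refine Submodule.sum_mem _ fun i _ => Submodule.smul_mem _ _ ?_
    rcases (h.mono (Nat.lt_succ_iff.mp i.2) : ν i ≤ Λ).lt_or_eq with hi | hi
    · exact Submodule.mem_sup_left (Submodule.subset_span ⟨i, hi, rfl⟩)
    · exact Submodule.mem_sup_right (Submodule.subset_span ⟨i, hi, rfl⟩)
  obtain ⟨y, hy, w, hw, hyw⟩ := Submodule.mem_sup.mp humem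
  have hpos := ht y hy w hw (by rwa [hyw])
  rw [hyw] at hpos
  have h1 : (Λ • B - A) u u + t * (-(A' - κ t • B - (Λ + t * κ t) • B')) u u
      = (Λ + t * κ t) * (B + t • B') u u - (A + t • A') u u := by
    change (Λ * B u u - A u u) + t * -(A' u u - κ t * B u u - (Λ + t * κ t) * B' u u)
      = (Λ + t * κ t) * (B u u + t * B' u u) - (A u u + t * A' u u)
    ring
  linarith

end IsSpectralSequence

end

/-! ### Separation: from no definite variation to a vanishing sum of variations. -/

section

variable {X : Type*} [NormedAddCommGroup X] [NormedSpace ℝ X]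

/-- If no member of a linear family of bilinear forms is positive on the finite-dimensional space
`W`, then some nontrivial sum of squares of elements of `W` annihilates the whole family. -/
theorem exists_sum_eq_zero_of_forall_not_pos {Δ : Type*} [AddCommGroup Δ] [Module ℝ Δ]
    (F : Δ →ₗ[ℝ] X →L[ℝ] X →L[ℝ] ℝ) (W : Submodule ℝ X) [FiniteDimensional ℝ W]
    (hF : ∀ d, ¬ ∀ w ∈ W, w ≠ 0 → 0 < F d w w) :
    ∃ (ι : Type) (_ : Fintype ι) (u : ι → X), (∀ i, u i ∈ W) ∧ (∃ i, u i ≠ 0) ∧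
      ∀ d, ∑ i, F d (u i) (u i) = 0 := by
  set n := Module.finrank ℝ W with hn
  let b := Module.finBasis ℝ W
  let vec : (Fin n → ℝ) → X := fun ξ => ∑ i, ξ i • (b i : X)
  have hvecW : ∀ ξ, vec ξ ∈ W := fun ξ =>
    Submodule.sum_mem _ fun i _ => Submodule.smul_mem _ _ (b i).2
  have hvec_surj : ∀ w ∈ W, ∃ ξ, vec ξ = w := fun w hw => by
    refine ⟨fun i => b.repr ⟨w, hw⟩ i, ?_⟩
    have := congrArg (Subtype.val) (b.sum_repr ⟨w, hw⟩)
    rwa [Submodule.coe_sum] at this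
  have hvec_ne : ∀ ξ, ξ ≠ 0 → vec ξ ≠ 0 := fun ξ hξ h0 => by
    refine hξ (funext fun i => ?_)
    refine Fintype.linearIndependent_iff.mp b.linearIndependent ξ (Subtype.ext ?_) i
    simpa [vec] using h0
  -- In a basis of `W` each form becomes a linear functional on matrices, whose value at the
  -- rank-one matrix `ξ ξᵀ` is the quadratic form at `vec ξ`.
  let ev : Δ →ₗ[ℝ] Module.Dual ℝ (Fin n → Fin n → ℝ) :=
    { toFun := fun d => ∑ i, ∑ j, F d (b i) (b j) • ((LinearMap.proj j : (Fin n → ℝ) →ₗ[ℝ] ℝ) ∘ₗ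
        (LinearMap.proj i : (Fin n → Fin n → ℝ) →ₗ[ℝ] (Fin n → ℝ)))
      map_add' := fun d d' => by
        simp only [map_add, add_apply, add_smul, Finset.sum_add_distrib]
      map_smul' := fun c d => by
        simp only [map_smul, smul_apply, smul_assoc, Finset.smul_sum, RingHom.id_apply] }
  have hev : ∀ d T, ev d T = ∑ i, ∑ j, F d (b i) (b j) * T i j := fun d T => by simp [ev]
  have hevsq : ∀ d (ξ : Fin n → ℝ), ev d (fun i j => ξ i * ξ j) = F d (vec ξ) (vec ξ) :=
    fun d ξ => by
      rw [hev]
      simp only [vec, map_sum, map_smul, sum_apply, smul_apply, smul_eq_mul, Finset.mul_sum]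
      rw [Finset.sum_comm]
      exact Finset.sum_congr rfl fun i _ => Finset.sum_congr rfl fun j _ => by ring
  let sq : (Fin n → ℝ) → (Fin n → Fin n → ℝ) := fun ξ i j => ξ i * ξ j
  have hsq : Continuous sq := by fun_prop
  set C := closure (convexHull ℝ (sq '' Metric.sphere 0 1)) with hC
  have hCc : IsCompact C := Metric.isCompact_of_isClosed_isBounded isClosed_closure
    (isBounded_convexHull.mpr ((isCompact_sphere 0 1).image hsq).isBounded).closure
  -- A matrix in both `C` and `M` is a limit of averages of squares annihilated by the whole family,
  -- which is the object sought.
  let M : Submodule ℝ (Fin n → Fin n → ℝ) := (LinearMap.range ev).dualCoannihilator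
  by_cases hdisj : Disjoint C (M : Set (Fin n → Fin n → ℝ))
  · exfalso
    obtain ⟨f, p, q, hfC, hpq, hfM⟩ := geometric_hahn_banach_compact_closed (convex_convexHull ℝ _).closure
      hCc M.convex M.closed_of_finiteDimensional hdisj
    have hq : q < 0 := by simpa using hfM 0 M.zero_mem
    -- A functional bounded below on a subspace vanishes on it. By duality in finite dimension the
    -- separating functional is then `ev d` for some `d`; it is negative on all `ξ ξᵀ`, so `-d` is a
    -- forbidden positive direction.
    have hf0 : ∀ T ∈ M, f T = 0 := fun T hT => by
      by_contra hne
      have h1 := hfM ((q / f T) • T) (M.smul_mem _ hT)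
      rw [map_smul, smul_eq_mul, div_mul_cancel₀ _ hne] at h1
      exact lt_irrefl _ h1
    have hfr : (f : Module.Dual ℝ (Fin n → Fin n → ℝ)) ∈ LinearMap.range ev := by
      rw [← Subspace.dualCoannihilator_dualAnnihilator_eq (W := LinearMap.range ev),
        Submodule.mem_dualAnnihilator]
      exact hf0
    obtain ⟨d, hd⟩ := hfr
    refine hF (-d) fun w hw hw0 => ?_
    obtain ⟨ξ, rfl⟩ := hvec_surj w hw
    have hξ : ξ ≠ 0 := fun h => hw0 (by simp [vec, h])
    have hξn : 0 < ‖ξ‖ := norm_pos_iff.mpr hξ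
    have hmem : ‖ξ‖⁻¹ • ξ ∈ Metric.sphere (0 : Fin n → ℝ) 1 := by
      rw [mem_sphere_zero_iff_norm, norm_smul, norm_inv, norm_norm, inv_mul_cancel₀ hξn.ne']
    have h1 := hfC (sq (‖ξ‖⁻¹ • ξ)) (subset_closure (subset_convexHull ℝ _ ⟨_, hmem, rfl⟩))
    have h2 : sq (‖ξ‖⁻¹ • ξ) = (‖ξ‖⁻¹ ^ 2) • sq ξ := by
      ext i j; simp only [sq, Pi.smul_apply, smul_eq_mul]; ring
    have h3 : f (sq ξ) = F d (vec ξ) (vec ξ) := by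
      rw [← hevsq, hd]; rfl
    rw [h2, map_smul, h3, smul_eq_mul] at h1
    have h4 : 0 < ‖ξ‖⁻¹ ^ 2 := by positivity
    rw [map_neg]
    change 0 < -(F d (vec ξ) (vec ξ))
    by_contra hcon
    nlinarith
  · obtain ⟨T, hTC, hTM⟩ := Set.not_disjoint_iff.mp hdisj
    -- A closed convex set containing `C`. The trace bound, which keeps the limit away from zero,
    -- holds on the generators because the norm is the sup norm, so that a unit vector has a
    -- coordinate of absolute value one.
    let K : Set (Fin n → Fin n → ℝ) := {T | (∀ i j, T i j = T j i) ∧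
      (∀ x : Fin n → ℝ, 0 ≤ ∑ i, ∑ j, x i * x j * T i j) ∧ 1 ≤ ∑ i, T i i}
    have hKcl : IsClosed K := by
      have h1 : IsClosed {T : Fin n → Fin n → ℝ | ∀ i j, T i j = T j i} := by
        rw [Set.ofPred_forall]
        refine isClosed_iInter fun i => ?_
        rw [Set.ofPred_forall]
        exact isClosed_iInter fun j => isClosed_eq (by fun_prop) (by fun_prop)
      have h2 : IsClosed {T : Fin n → Fin n → ℝ |
          ∀ x : Fin n → ℝ, 0 ≤ ∑ i, ∑ j, x i * x j * T i j} := by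
        rw [Set.ofPred_forall]
        exact isClosed_iInter fun x => isClosed_le continuous_const (by fun_prop)
      have h3 : IsClosed {T : Fin n → Fin n → ℝ | 1 ≤ ∑ i, T i i} :=
        isClosed_le continuous_const (by fun_prop)
      exact h1.inter (h2.inter h3)
    have hKconv : Convex ℝ K := by
      rintro S ⟨hS1, hS2, hS3⟩ S' ⟨hS1', hS2', hS3'⟩ a a' ha ha' haa
      refine ⟨fun i j => ?_, fun x => ?_, ?_⟩
      · simp [hS1 i j, hS1' i j]
      · have h1 : ∑ i, ∑ j, x i * x j * (a • S + a' • S') i j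
            = a * ∑ i, ∑ j, x i * x j * S i j + a' * ∑ i, ∑ j, x i * x j * S' i j := by
          simp only [Finset.mul_sum, ← Finset.sum_add_distrib, Pi.add_apply, Pi.smul_apply,
            smul_eq_mul]
          exact Finset.sum_congr rfl fun i _ => Finset.sum_congr rfl fun j _ => by ring
        rw [h1]
        exact add_nonneg (mul_nonneg ha (hS2 x)) (mul_nonneg ha' (hS2' x))
      · have h1 : ∑ i, (a • S + a' • S') i i = a * ∑ i, S i i + a' * ∑ i, S' i i := by
          simp only [Finset.mul_sum, ← Finset.sum_add_distrib, Pi.add_apply, Pi.smul_apply,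
            smul_eq_mul]
        rw [h1]
        nlinarith
    have hCK : C ⊆ K := by
      refine closure_minimal (convexHull_min ?_ hKconv) hKcl
      rintro _ ⟨ξ, hξ, rfl⟩
      refine ⟨fun i j => mul_comm _ _, fun x => ?_, ?_⟩
      · have h1 : ∑ i, ∑ j, x i * x j * sq ξ i j = (∑ i, x i * ξ i) ^ 2 := by
          rw [pow_two, Finset.sum_mul_sum]
          exact Finset.sum_congr rfl fun i _ => Finset.sum_congr rfl fun j _ => by ring
        rw [h1]
        positivity
      · rw [mem_sphere_zero_iff_norm] at hξ
        have hne : Nonempty (Fin n) := by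
          by_contra hemp
          rw [not_nonempty_iff] at hemp
          rw [Subsingleton.elim ξ 0, norm_zero] at hξ
          exact zero_ne_one hξ
        obtain ⟨i, hi⟩ := (Finite.exists_max fun i => ‖ξ i‖)
        have h2 : 1 ≤ ‖ξ i‖ := by
          rw [← hξ]
          exact (pi_norm_le_iff_of_nonneg (norm_nonneg _)).mpr hi
        have h3 : 1 ≤ ξ i * ξ i := by
          rw [Real.norm_eq_abs] at h2
          nlinarith [abs_mul_abs_self (ξ i)]
        exact h3.trans (Finset.single_le_sum (f := fun i => ξ i * ξ i)
          (fun j _ => mul_self_nonneg _) (Finset.mem_univ i))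
    obtain ⟨hT1, hT2, hT3⟩ := hCK hTC
    have hpsd : (Matrix.of T).PosSemidef := by
      refine Matrix.PosSemidef.of_dotProduct_mulVec_nonneg ?_ fun x => ?_
      · ext i j
        simp [hT1 i j]
      · refine (hT2 x).trans (le_of_eq ?_)
        simp only [dotProduct, Matrix.mulVec, star_trivial, Finset.mul_sum, Matrix.of_apply]
        exact Finset.sum_congr rfl fun i _ => Finset.sum_congr rfl fun j _ => by ring
    -- The rank-one summands of the positive semidefinite matrix provide the finite family of
    -- vectors.
    obtain ⟨m, R, hR⟩ := Matrix.posSemidef_iff_eq_sum_vecMulVec.mp hpsd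
    have hTR : ∀ i j, T i j = ∑ l, R l i * R l j := fun i j => by
      have := congrFun (congrFun hR i) j
      simpa [Matrix.sum_apply, Matrix.vecMulVec_apply] using this
    refine ⟨Fin m, inferInstance, fun l => vec (R l), fun l => hvecW _, ?_, fun d => ?_⟩
    · by_contra! h0
      have hR0 : ∀ l, R l = 0 := fun l => by
        by_contra hne
        exact hvec_ne _ hne (h0 l)
      have : ∑ i, T i i = 0 := by simp [hTR, hR0]
      linarith
    · have h1 : ev d T = 0 := (Submodule.mem_dualCoannihilator _).mp hTM _ ⟨d, rfl⟩
      rw [← h1]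
      simp only [← hevsq, hev, hTR, Finset.mul_sum]
      rw [Finset.sum_comm]
      refine Finset.sum_congr rfl fun i _ => ?_
      rw [Finset.sum_comm]

end

/-! ### Square integrable functions on the unit interval and their primitives. -/

open Filter Topology MeasureTheory

/-- Square integrable functions on the unit interval. -/
abbrev UnitL2 : Type := Lp ℝ 2 (volume.restrict (Set.Ioc (0 : ℝ) 1))

namespace UnitL2

/-- The primitive vanishing at `0`, evaluated at `x`, as a functional. -/
noncomputable def prim (x : ℝ) : UnitL2 →L[ℝ] ℝ :=
  innerSL ℝ (indicatorConstLp 2 (measurableSet_Ioc : MeasurableSet (Set.Ioc 0 x))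
    (measure_ne_top _ _) (1 : ℝ))

theorem integrable (h : UnitL2) : Integrable h (volume.restrict (Set.Ioc (0 : ℝ) 1)) :=
  (Lp.memLp h).integrable (by norm_num)

theorem intervalIntegrable (h : UnitL2) : IntervalIntegrable h volume 0 1 :=
  (intervalIntegrable_iff_integrableOn_Ioc_of_le zero_le_one).mpr h.integrable

theorem prim_apply (x : ℝ) (h : UnitL2) :
    prim x h = ∫ y in Set.Ioc 0 x, h y ∂(volume.restrict (Set.Ioc (0 : ℝ) 1)) := by
  rw [prim, innerSL_apply_apply, L2.inner_indicatorConstLp_one]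

theorem prim_eq_integral {x : ℝ} (hx : x ∈ Set.Icc (0 : ℝ) 1) (h : UnitL2) :
    prim x h = ∫ y in (0 : ℝ)..x, h y := by
  rw [prim_apply, intervalIntegral.integral_of_le hx.1, Measure.restrict_restrict measurableSet_Ioc,
    Set.inter_eq_left.mpr (Set.Ioc_subset_Ioc_right hx.2)]

theorem prim_zero (h : UnitL2) : prim 0 h = 0 := by
  rw [prim_eq_integral ⟨le_rfl, zero_le_one⟩, intervalIntegral.integral_same]

/-- Cauchy-Schwarz against the indicator of `(x, y]`. -/
theorem abs_prim_sub_le {x y : ℝ} (hxy : x ≤ y) (h : UnitL2) :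
    |prim y h - prim x h| ≤ Real.sqrt (y - x) * ‖h‖ := by
  have hm : MeasurableSet (Set.Ioc 0 y \ Set.Ioc 0 x) := measurableSet_Ioc.diff measurableSet_Ioc
  have h1 : prim y h - prim x h = inner ℝ (indicatorConstLp 2 hm
      (measure_ne_top (volume.restrict (Set.Ioc (0 : ℝ) 1)) _) (1 : ℝ)) h := by
    rw [prim_apply, prim_apply, L2.inner_indicatorConstLp_one,
      setIntegral_sdiff measurableSet_Ioc h.integrable.integrableOn (Set.Ioc_subset_Ioc_right hxy)]
  rw [h1, ← Real.norm_eq_abs]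
  refine (norm_inner_le_norm _ _).trans ?_
  gcongr
  refine (norm_indicatorConstLp_le).trans ?_
  rw [norm_one, one_mul, Real.sqrt_eq_rpow]
  have h2 : (volume.restrict (Set.Ioc (0 : ℝ) 1)).real (Set.Ioc 0 y \ Set.Ioc 0 x) ≤ y - x := by
    have h3 : (volume.restrict (Set.Ioc (0 : ℝ) 1)) (Set.Ioc 0 y \ Set.Ioc 0 x)
        ≤ ENNReal.ofReal (y - x) := by
      refine (Measure.restrict_apply_le _ _).trans ?_
      rw [← Real.volume_Ioc]
      refine measure_mono fun z hz => ⟨?_, hz.1.2⟩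
      by_contra hzx
      exact hz.2 ⟨hz.1.1, not_lt.mp hzx⟩
    exact ENNReal.toReal_le_of_le_ofReal (by linarith) h3
  rw [ENNReal.toReal_ofNat]
  exact Real.rpow_le_rpow measureReal_nonneg h2 (by norm_num)

theorem continuous_prim (h : UnitL2) : Continuous fun x => prim x h := by
  have hb : ∀ x y, |prim y h - prim x h| ≤ Real.sqrt |y - x| * ‖h‖ := fun x y => by
    rcases le_total x y with hxy | hxy
    · rw [abs_of_nonneg (sub_nonneg.mpr hxy)]; exact abs_prim_sub_le hxy h
    · rw [abs_sub_comm, abs_sub_comm y, abs_of_nonneg (sub_nonneg.mpr hxy)]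
      exact abs_prim_sub_le hxy h
  rw [continuous_iff_continuousAt]
  intro x
  rw [ContinuousAt, tendsto_iff_norm_sub_tendsto_zero]
  refine squeeze_zero (fun y => norm_nonneg _) (fun y => hb x y) ?_
  have hc : Continuous fun y : ℝ => Real.sqrt |y - x| * ‖h‖ := by fun_prop
  simpa using hc.tendsto x

theorem abs_prim_sub_le_norm {x y : ℝ} (hx : x ∈ Set.Icc (0 : ℝ) 1) (hy : y ∈ Set.Icc (0 : ℝ) 1)
    (h : UnitL2) : |prim y h - prim x h| ≤ ‖h‖ := by
  have key : ∀ {x y : ℝ}, x ∈ Set.Icc (0 : ℝ) 1 → y ∈ Set.Icc (0 : ℝ) 1 → x ≤ y →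
      |prim y h - prim x h| ≤ ‖h‖ := fun {x y} hx hy hxy => by
    refine (abs_prim_sub_le hxy h).trans (mul_le_of_le_one_left (norm_nonneg _) ?_)
    rw [Real.sqrt_le_iff]
    constructor <;> linarith [hx.1, hy.2]
  rcases le_total x y with hxy | hxy
  · exact key hx hy hxy
  · rw [abs_sub_comm]; exact key hy hx hxy

theorem abs_prim_le {x : ℝ} (hx : x ∈ Set.Icc (0 : ℝ) 1) (h : UnitL2) : |prim x h| ≤ ‖h‖ := by
  have := abs_prim_sub_le_norm ⟨le_rfl, zero_le_one⟩ hx h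
  rwa [prim_zero, sub_zero] at this

theorem ae_hasDerivAt_prim (h : UnitL2) :
    ∀ᵐ x, x ∈ Set.Ioo (0 : ℝ) 1 → HasDerivAt (fun y => prim y h) (h x) x := by
  filter_upwards [h.intervalIntegrable.ae_hasDerivAt_integral] with x hx hx01
  rw [Set.uIcc_of_le zero_le_one] at hx
  have h1 := hx (Set.Ioo_subset_Icc_self hx01) 0 ⟨le_rfl, zero_le_one⟩
  refine h1.congr_of_eventuallyEq ?_
  filter_upwards [Ioo_mem_nhds hx01.1 hx01.2] with y hy
  exact prim_eq_integral (Set.Ioo_subset_Icc_self hy) h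

theorem ae_restrict_iff_Ioo {p : ℝ → Prop} :
    (∀ᵐ x ∂(volume.restrict (Set.Ioc (0 : ℝ) 1)), p x) ↔ ∀ᵐ x, x ∈ Set.Ioo (0 : ℝ) 1 → p x := by
  rw [← ae_restrict_iff' measurableSet_Ioo, restrict_Ioo_eq_restrict_Ioc]

theorem eq_zero_of_prim_eq_zero {h : UnitL2} (hh : ∀ x ∈ Set.Icc (0 : ℝ) 1, prim x h = 0) :
    h = 0 := by
  rw [Lp.eq_zero_iff_ae_eq_zero]
  refine ae_restrict_iff_Ioo.mpr ?_
  filter_upwards [ae_hasDerivAt_prim h] with x hx hx01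
  refine (hx hx01).unique ((hasDerivAt_const x (0 : ℝ)).congr_of_eventuallyEq ?_)
  filter_upwards [Ioo_mem_nhds hx01.1 hx01.2] with y hy
  exact hh y (Set.Ioo_subset_Icc_self hy)

end UnitL2

/-! ### The Sobolev space of the graph and the energy and mass forms. -/

namespace Multigraph

/-- Pairs of vertex values and edge derivatives that define a continuous function on the graph. -/
def compatible {V E : Type*} (G : Multigraph V E) : Submodule ℝ ((V → ℝ) × (E → UnitL2)) where
  carrier := {u | ∀ e, u.1 (G.tgt e) = u.1 (G.src e) + UnitL2.prim 1 (u.2 e)}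
  zero_mem' := fun e => by simp
  add_mem' := fun {u v} hu hv e => by
    simp only [Prod.fst_add, Prod.snd_add, Pi.add_apply, map_add, hu e, hv e]; ring
  smul_mem' := fun c u hu e => by
    simp only [Prod.smul_fst, Prod.smul_snd, Pi.smul_apply, map_smul, hu e, smul_eq_mul]; ring

theorem isClosed_compatible {V E : Type*} (G : Multigraph V E) :
    IsClosed (G.compatible : Set ((V → ℝ) × (E → UnitL2))) := by
  have : (G.compatible : Set ((V → ℝ) × (E → UnitL2))) =
      ⋂ e, {u | u.1 (G.tgt e) = u.1 (G.src e) + UnitL2.prim 1 (u.2 e)} := by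
    ext u; simp only [Set.mem_iInter]; rfl
  rw [this]
  exact isClosed_iInter fun e => isClosed_eq (by fun_prop) (by fun_prop)

/-- Every vertex of a connected graph with an edge is an end of an edge. -/
theorem Connected.exists_edge {V E : Type*} {G : Multigraph V E} [Nonempty E] (hG : G.Connected) (v : V) :
    ∃ e, G.src e = v ∨ G.tgt e = v := by
  obtain ⟨e₀⟩ := ‹Nonempty E›
  by_cases h : G.src e₀ = v
  · exact ⟨e₀, Or.inl h⟩
  obtain ⟨w⟩ := hG.preconnected v (G.src e₀)
  cases w with
  | nil => exact absurd rfl h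
  | cons hadj _ =>
    rw [SimpleGraph.fromRel_adj] at hadj
    rcases hadj.2 with ⟨e, he, -⟩ | ⟨e, -, he⟩
    · exact ⟨e, Or.inl he⟩
    · exact ⟨e, Or.inr he⟩

/-- A function on the vertices that agrees at the two ends of every edge is constant. -/
theorem Connected.eq_of_forall_edge {V E : Type*} {G : Multigraph V E} (hG : G.Connected) {α : Type*} {c : V → α}
    (hc : ∀ e, c (G.tgt e) = c (G.src e)) (v w : V) : c v = c w := by
  obtain ⟨p⟩ := hG.preconnected v w
  induction p with
  | nil => rfl
  | cons hadj _ ih =>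
    rw [← ih]
    rw [SimpleGraph.fromRel_adj] at hadj
    rcases hadj.2 with ⟨e, rfl, rfl⟩ | ⟨e, rfl, rfl⟩
    · exact (hc e).symm
    · exact hc e

variable {V E : Type*} [Fintype V] [Fintype E] {G : Multigraph V E}

/-- Functions of class `H¹` on the graph, given by their values at the vertices and their
derivatives on the edges. -/
def H1 {V E : Type*} (G : Multigraph V E) : Type _ := G.compatible

noncomputable instance : NormedAddCommGroup G.H1 := inferInstanceAs (NormedAddCommGroup G.compatible)

noncomputable instance : NormedSpace ℝ G.H1 := inferInstanceAs (NormedSpace ℝ G.compatible)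

instance : CompleteSpace G.H1 := G.isClosed_compatible.completeSpace_coe

namespace H1

/-- The underlying pair of vertex values and edge derivatives. -/
noncomputable def toPair : G.H1 →L[ℝ] (V → ℝ) × (E → UnitL2) := G.compatible.subtypeL

/-- The value at a vertex. -/
noncomputable def vertex (v : V) : G.H1 →L[ℝ] ℝ :=
  (ContinuousLinearMap.proj v).comp ((ContinuousLinearMap.fst ℝ _ _).comp
    (toPair (G := G)))

/-- The weak derivative on an edge. -/
noncomputable def grad (e : E) : G.H1 →L[ℝ] UnitL2 :=
  (ContinuousLinearMap.proj e).comp ((ContinuousLinearMap.snd ℝ _ _).comp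
    (toPair (G := G)))

/-- The value at a point of an edge. -/
noncomputable def eval (e : E) (x : ℝ) : G.H1 →L[ℝ] ℝ :=
  vertex (G.src e) + (UnitL2.prim x).comp (grad (G := G) e)

theorem eval_apply (e : E) (x : ℝ) (u : G.H1) :
    eval e x u = vertex (G.src e) u + UnitL2.prim x (grad e u) := rfl

theorem eval_zero (e : E) (u : G.H1) : eval e 0 u = vertex (G.src e) u := by
  rw [eval_apply, UnitL2.prim_zero, add_zero]

theorem eval_one (e : E) (u : G.H1) : eval e 1 u = vertex (G.tgt e) u :=
  (Subtype.property (p := (· ∈ G.compatible)) u e).symm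

theorem continuous_eval (e : E) (u : G.H1) : Continuous fun x => eval e x u :=
  continuous_const.add (UnitL2.continuous_prim _)

theorem abs_vertex_le (v : V) (u : G.H1) : |vertex v u| ≤ ‖u‖ :=
  (norm_le_pi_norm (toPair u).1 v).trans (norm_fst_le _)

theorem norm_grad_le (e : E) (u : G.H1) : ‖grad e u‖ ≤ ‖u‖ :=
  (norm_le_pi_norm (toPair u).2 e).trans (norm_snd_le _)

theorem norm_le {u : G.H1} {C : ℝ} (hC : 0 ≤ C) (h1 : ∀ v, |vertex v u| ≤ C)
    (h2 : ∀ e, ‖grad e u‖ ≤ C) : ‖u‖ ≤ C :=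
  max_le ((pi_norm_le_iff_of_nonneg hC).mpr h1) ((pi_norm_le_iff_of_nonneg hC).mpr h2)

theorem abs_eval_le {x : ℝ} (hx : x ∈ Set.Icc (0 : ℝ) 1) (e : E) (u : G.H1) :
    |eval e x u| ≤ 2 * ‖u‖ := by
  rw [eval_apply]
  refine (abs_add_le _ _).trans ?_
  linarith [abs_vertex_le (G.src e) u, UnitL2.abs_prim_le hx (grad e u), norm_grad_le e u]

/-- The factor `y - x` is what later lets values at a fine grid control the mass form. -/
theorem sq_eval_le {x y : ℝ} (hxy : x ≤ y) (e : E) (u : G.H1) :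
    eval e y u ^ 2 ≤ 2 * eval e x u ^ 2 + 2 * ((y - x) * ‖grad e u‖ ^ 2) := by
  have h1 : eval e y u - eval e x u = UnitL2.prim y (grad e u) - UnitL2.prim x (grad e u) := by
    rw [eval_apply, eval_apply]; ring
  have h2 := UnitL2.abs_prim_sub_le hxy (grad e u)
  rw [← h1] at h2
  have h3 : (eval e y u - eval e x u) ^ 2 ≤ (y - x) * ‖grad e u‖ ^ 2 := by
    rw [← sq_abs]
    calc |eval e y u - eval e x u| ^ 2 ≤ (Real.sqrt (y - x) * ‖grad e u‖) ^ 2 := by gcongr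
      _ = _ := by rw [mul_pow, Real.sq_sqrt (by linarith)]
  nlinarith [sq_nonneg (eval e y u - 2 * eval e x u)]

theorem sq_eval_le_of_mem {x y : ℝ} (hx : x ∈ Set.Icc (0 : ℝ) 1) (hy : y ∈ Set.Icc (0 : ℝ) 1)
    (e : E) (u : G.H1) : eval e y u ^ 2 ≤ 2 * eval e x u ^ 2 + 2 * ‖grad e u‖ ^ 2 := by
  have h1 : eval e y u - eval e x u = UnitL2.prim y (grad e u) - UnitL2.prim x (grad e u) := by
    rw [eval_apply, eval_apply]; ring
  have h2 := UnitL2.abs_prim_sub_le_norm hx hy (grad e u)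
  rw [← h1] at h2
  have h3 : (eval e y u - eval e x u) ^ 2 ≤ ‖grad e u‖ ^ 2 := by
    rw [← sq_abs]; gcongr
  nlinarith [sq_nonneg (eval e y u - 2 * eval e x u)]

/-- The form `∑ e, s e * ∫₀¹ u' v'`. -/
noncomputable def stiffnessForm (G : Multigraph V E) (s : E → ℝ) : G.H1 →L[ℝ] G.H1 →L[ℝ] ℝ :=
  ∑ e, s e • (innerSL ℝ).bilinearComp (grad e) (grad e)

theorem stiffnessForm_apply (s : E → ℝ) (u v : G.H1) :
    stiffnessForm G s u v = ∑ e, s e * inner ℝ (grad e u) (grad e v) := by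
  simp [stiffnessForm, sum_apply]

theorem intervalIntegrable_weight (w : C(ℝ, ℝ)) (e : E) (u v : G.H1) :
    IntervalIntegrable (fun x => w x * eval e x u * eval e x v) volume 0 1 :=
  ((w.continuous.mul (continuous_eval e u)).mul (continuous_eval e v)).intervalIntegrable _ _

/-- The form `∫₀¹ w u v` on an edge. -/
noncomputable def edgeMassForm (G : Multigraph V E) (w : C(ℝ, ℝ)) (e : E) :
    G.H1 →L[ℝ] G.H1 →L[ℝ] ℝ :=
  LinearMap.mkContinuous₂ (LinearMap.mk₂ ℝ
    (fun u v : G.H1 => ∫ x in (0 : ℝ)..1, w x * eval e x u * eval e x v)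
    (fun u u' v => by
      rw [← intervalIntegral.integral_add (intervalIntegrable_weight w e u v)
        (intervalIntegrable_weight w e u' v)]
      simp only [map_add, mul_add, add_mul])
    (fun c u v => by
      rw [smul_eq_mul, ← intervalIntegral.integral_const_mul]
      simp only [map_smul, smul_eq_mul, mul_left_comm, mul_assoc])
    (fun u v v' => by
      rw [← intervalIntegral.integral_add (intervalIntegrable_weight w e u v)
        (intervalIntegrable_weight w e u v')]
      simp only [map_add, mul_add])
    (fun c u v => by
      rw [smul_eq_mul, ← intervalIntegral.integral_const_mul]
      simp only [map_smul, smul_eq_mul, mul_left_comm])) (4 * ∫ x in (0 : ℝ)..1, |w x|)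
    (fun u v => by
      simp only [LinearMap.mk₂_apply]
      rw [mul_assoc, mul_assoc, mul_comm (∫ x in (0 : ℝ)..1, |w x|), ← mul_assoc,
        ← intervalIntegral.integral_const_mul]
      refine intervalIntegral.norm_integral_le_of_norm_le zero_le_one
        (Eventually.of_forall fun x hx => ?_)
        ((continuous_const.mul w.continuous.abs).intervalIntegrable _ _)
      have hx' := Set.Ioc_subset_Icc_self hx
      rw [Real.norm_eq_abs, abs_mul, abs_mul]
      calc |w x| * |eval e x u| * |eval e x v| ≤ |w x| * (2 * ‖u‖) * (2 * ‖v‖) := by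
            gcongr
            · exact abs_eval_le hx' e u
            · exact abs_eval_le hx' e v
        _ = _ := by ring)

theorem edgeMassForm_apply (w : C(ℝ, ℝ)) (e : E) (u v : G.H1) :
    edgeMassForm G w e u v = ∫ x in (0 : ℝ)..1, w x * eval e x u * eval e x v := rfl

/-- The form `∑ e, ∫₀¹ w u v`. -/
noncomputable def massForm (G : Multigraph V E) (w : E → C(ℝ, ℝ)) : G.H1 →L[ℝ] G.H1 →L[ℝ] ℝ :=
  ∑ e, edgeMassForm G (w e) e

theorem massForm_apply (w : E → C(ℝ, ℝ)) (u v : G.H1) :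
    massForm G w u v = ∑ e, ∫ x in (0 : ℝ)..1, w e x * eval e x u * eval e x v := by
  simp [massForm, sum_apply, edgeMassForm_apply]

end H1

end Multigraph

/-! ### Continuous representatives and integration by parts. -/

namespace UnitL2

theorem memLp_of_continuous (φ : C(ℝ, ℝ)) :
    MemLp φ 2 (volume.restrict (Set.Ioc (0 : ℝ) 1)) := by
  obtain ⟨C, hC⟩ := (isCompact_Icc (a := (0 : ℝ)) (b := 1)).exists_bound_of_continuousOn
    φ.continuous.continuousOn
  refine MemLp.of_bound φ.continuous.aestronglyMeasurable C ?_
  exact (ae_restrict_iff' measurableSet_Ioc).mpr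
    (Eventually.of_forall fun x hx => hC x (Set.Ioc_subset_Icc_self hx))

/-- The class of a continuous function. -/
noncomputable def ofContinuous : C(ℝ, ℝ) →ₗ[ℝ] UnitL2 where
  toFun φ := (memLp_of_continuous φ).toLp
  map_add' φ ψ := MemLp.toLp_add (memLp_of_continuous φ) (memLp_of_continuous ψ)
  map_smul' c φ := MemLp.toLp_const_smul c (memLp_of_continuous φ)

theorem coe_ofContinuous (φ : C(ℝ, ℝ)) :
    ofContinuous φ =ᵐ[volume.restrict (Set.Ioc (0 : ℝ) 1)] φ :=
  (memLp_of_continuous φ).coeFn_toLp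

theorem inner_ofContinuous (φ : C(ℝ, ℝ)) (h : UnitL2) :
    inner ℝ (ofContinuous φ) h = ∫ x in (0 : ℝ)..1, φ x * h x := by
  rw [L2.inner_def, intervalIntegral.integral_of_le zero_le_one]
  refine integral_congr_ae ?_
  filter_upwards [coe_ofContinuous φ] with x hx
  rw [hx]
  simp [mul_comm]

theorem inner_ofContinuous_ofContinuous (φ ψ : C(ℝ, ℝ)) :
    inner ℝ (ofContinuous φ) (ofContinuous ψ) = ∫ x in (0 : ℝ)..1, φ x * ψ x := by
  rw [inner_ofContinuous, intervalIntegral.integral_of_le zero_le_one,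
    intervalIntegral.integral_of_le zero_le_one]
  refine integral_congr_ae ?_
  filter_upwards [coe_ofContinuous ψ] with x hx
  rw [hx]

theorem prim_ofContinuous {x : ℝ} (hx : x ∈ Set.Icc (0 : ℝ) 1) (φ : C(ℝ, ℝ)) :
    prim x (ofContinuous φ) = ∫ y in (0 : ℝ)..x, φ y := by
  rw [prim_eq_integral hx, intervalIntegral.integral_of_le hx.1,
    intervalIntegral.integral_of_le hx.1]
  refine integral_congr_ae ?_
  exact ae_mono (Measure.restrict_mono (Set.Ioc_subset_Ioc_right hx.2) le_rfl) (coe_ofContinuous φ)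

theorem prim_one_eq_inner (h : UnitL2) : prim 1 h = inner ℝ (ofContinuous 1) h := by
  rw [inner_ofContinuous, prim_eq_integral ⟨zero_le_one, le_rfl⟩]
  simp

/-- Integration by parts against the primitive of a square integrable function. -/
theorem integral_mul_prim {P ω : C(ℝ, ℝ)} (hP : ∀ x ∈ Set.Ioo (0 : ℝ) 1, HasDerivAt P (-ω x) x)
    (h : UnitL2) :
    ∫ x in (0 : ℝ)..1, ω x * prim x h = inner ℝ (ofContinuous P) h - P 1 * prim 1 h := by
  set f : ℝ → ℝ := fun x => ∫ y in (0 : ℝ)..x, ω y with hf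
  set g : ℝ → ℝ := fun x => ∫ y in (0 : ℝ)..x, h y with hg
  have hω : ∀ a b, IntervalIntegrable ω volume a b := fun a b => ω.continuous.intervalIntegrable a b
  have hfd : ∀ x, HasDerivAt f (ω x) x := fun x =>
    intervalIntegral.integral_hasDerivAt_right (hω 0 x)
      (ω.continuous.stronglyMeasurableAtFilter _ _) ω.continuous.continuousAt
  -- The primitive of `h` is only absolutely continuous, so integration by parts is used in that
  -- class, with `f = P 0 - P` on the unit interval.
  have hfac : AbsolutelyContinuousOnInterval f 0 1 :=
    (hω 0 1).absolutelyContinuousOnInterval_intervalIntegral Set.left_mem_uIcc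
  have hgac : AbsolutelyContinuousOnInterval g 0 1 :=
    h.intervalIntegrable.absolutelyContinuousOnInterval_intervalIntegral Set.left_mem_uIcc
  have hPf : ∀ x ∈ Set.Icc (0 : ℝ) 1, P x = P 0 - f x := fun x hx => by
    have h1 := intervalIntegral.integral_eq_sub_of_hasDerivAt_of_le (f := P) (f' := fun y => -ω y)
      hx.1 P.continuous.continuousOn (fun y hy => hP y ⟨hy.1, hy.2.trans_le hx.2⟩) (hω 0 x).neg
    rw [intervalIntegral.integral_neg] at h1
    linarith
  have hparts := hfac.integral_mul_deriv_eq_deriv_mul hgac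
  have h1 : ∫ x in (0 : ℝ)..1, f x * deriv g x = ∫ x in (0 : ℝ)..1, f x * h x := by
    refine intervalIntegral.integral_congr_ae ?_
    filter_upwards [h.intervalIntegrable.ae_hasDerivAt_integral] with x hx hx01
    rw [(hx (Set.uIoc_subset_uIcc hx01) 0 Set.left_mem_uIcc).deriv]
  have h2 : ∫ x in (0 : ℝ)..1, deriv f x * g x = ∫ x in (0 : ℝ)..1, ω x * prim x h := by
    refine intervalIntegral.integral_congr fun x hx => ?_
    rw [Set.uIcc_of_le zero_le_one] at hx
    simp only [(hfd x).deriv, prim_eq_integral hx, hg]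
  have h3 : inner ℝ (ofContinuous P) h = P 0 * g 1 - ∫ x in (0 : ℝ)..1, f x * h x := by
    have hi : IntervalIntegrable (fun x => f x * h x) volume 0 1 :=
      h.intervalIntegrable.continuousOn_mul hfac.continuousOn
    rw [inner_ofContinuous, hg]
    simp only
    rw [← intervalIntegral.integral_const_mul, ← intervalIntegral.integral_sub
      (h.intervalIntegrable.const_mul _) hi]
    refine intervalIntegral.integral_congr fun x hx => ?_
    rw [Set.uIcc_of_le zero_le_one] at hx
    simp only [hPf x hx]
    ring
  have hf0 : f 0 = 0 := intervalIntegral.integral_same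
  have hP1 := hPf 1 ⟨zero_le_one, le_rfl⟩
  have hg1 : prim 1 h = g 1 := prim_eq_integral ⟨zero_le_one, le_rfl⟩ h
  rw [h1, h2, hf0] at hparts
  rw [h3, hg1, hP1]
  linarith

end UnitL2

/-! ### The energy and mass forms constitute a compact pencil. -/

namespace Multigraph

namespace H1

variable {V E : Type*} [Fintype V] [Fintype E] {G : Multigraph V E}

/-- Point values on edges determine a vertex value only if the vertex is an end of some edge, which
connectedness provides. -/
theorem ext_of_eval_eq_zero [Nonempty E] (hG : G.Connected) {u : G.H1}
    (hu : ∀ e, ∀ x ∈ Set.Icc (0 : ℝ) 1, eval e x u = 0) : u = 0 := by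
  have hv : ∀ v, vertex v u = 0 := fun v => by
    obtain ⟨e, rfl | rfl⟩ := hG.exists_edge v
    · rw [← eval_zero]; exact hu e 0 ⟨le_rfl, zero_le_one⟩
    · rw [← eval_one]; exact hu e 1 ⟨zero_le_one, le_rfl⟩
  have hg : ∀ e, grad e u = 0 := fun e => UnitL2.eq_zero_of_prim_eq_zero fun x hx => by
    have := hu e x hx
    rwa [eval_apply, hv, zero_add] at this
  have h0 : ‖u‖ ≤ 0 := norm_le le_rfl (fun v => by simp [hv v]) fun e => by simp [hg e]
  exact norm_le_zero_iff.mp h0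

theorem intervalIntegrable_sq (w : C(ℝ, ℝ)) (e : E) (u : G.H1) :
    IntervalIntegrable (fun x => w x * eval e x u ^ 2) volume 0 1 :=
  (w.continuous.mul ((continuous_eval e u).pow 2)).intervalIntegrable _ _

theorem massForm_self (w : E → C(ℝ, ℝ)) (u : G.H1) :
    massForm G w u u = ∑ e, ∫ x in (0 : ℝ)..1, w e x * eval e x u ^ 2 := by
  rw [massForm_apply]
  simp only [sq, mul_assoc]

theorem stiffnessForm_self (s : E → ℝ) (u : G.H1) :
    stiffnessForm G s u u = ∑ e, s e * ‖grad e u‖ ^ 2 := by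
  rw [stiffnessForm_apply]
  simp only [real_inner_self_eq_norm_sq]

variable {s : E → ℝ} {w : E → C(ℝ, ℝ)}

theorem integral_sq_nonneg (hw : ∀ e, ∀ x ∈ Set.Icc (0 : ℝ) 1, 0 < w e x) (u : G.H1) (e : E) :
    0 ≤ ∫ x in (0 : ℝ)..1, w e x * eval e x u ^ 2 :=
  intervalIntegral.integral_nonneg zero_le_one fun x hx => mul_nonneg (hw e x hx).le (sq_nonneg _)

theorem massForm_pos [Nonempty E] (hG : G.Connected)
    (hw : ∀ e, ∀ x ∈ Set.Icc (0 : ℝ) 1, 0 < w e x) {u : G.H1} (hu : u ≠ 0) :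
    0 < massForm G w u u := by
  rw [massForm_self]
  obtain ⟨e, x, hx, hne⟩ : ∃ e, ∃ x ∈ Set.Icc (0 : ℝ) 1, eval e x u ≠ 0 := by
    by_contra! h
    exact hu (ext_of_eval_eq_zero hG h)
  refine Finset.sum_pos' (fun e _ => integral_sq_nonneg hw u e) ⟨e, Finset.mem_univ e, ?_⟩
  refine intervalIntegral.integral_pos zero_lt_one
    (by have := continuous_eval e u; fun_prop)
    (fun y hy => mul_nonneg (hw e y (Set.Ioc_subset_Icc_self hy)).le (sq_nonneg _)) ⟨x, hx, ?_⟩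
  have := hw e x hx
  positivity

theorem exists_lower_bound [Nonempty E] (hw : ∀ e, ∀ x ∈ Set.Icc (0 : ℝ) 1, 0 < w e x) :
    ∃ c > 0, ∀ e, ∀ x ∈ Set.Icc (0 : ℝ) 1, c ≤ w e x := by
  have h1 : ∀ e, ∃ c > 0, ∀ x ∈ Set.Icc (0 : ℝ) 1, c ≤ w e x := fun e => by
    obtain ⟨x, hx, hmin⟩ := isCompact_Icc.exists_isMinOn (Set.nonempty_Icc.mpr zero_le_one)
      (w e).continuous.continuousOn
    exact ⟨w e x, hw e x hx, fun y hy => hmin hy⟩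
  choose c hc hcw using h1
  obtain ⟨e₀, he₀⟩ := Finite.exists_min c
  exact ⟨c e₀, hc e₀, fun e x hx => (he₀ e).trans (hcw e x hx)⟩

theorem exists_upper_bound [Nonempty E] (w : E → C(ℝ, ℝ)) :
    ∃ c > 0, ∀ e, ∀ x ∈ Set.Icc (0 : ℝ) 1, w e x ≤ c := by
  have h1 : ∀ e, ∃ c, ∀ x ∈ Set.Icc (0 : ℝ) 1, w e x ≤ c := fun e => by
    obtain ⟨x, hx, hmax⟩ := isCompact_Icc.exists_isMaxOn (Set.nonempty_Icc.mpr zero_le_one)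
      (w e).continuous.continuousOn
    exact ⟨w e x, fun y hy => hmax hy⟩
  choose c hcw using h1
  obtain ⟨e₀, he₀⟩ := Finite.exists_max c
  exact ⟨max (c e₀) 1, by positivity,
    fun e x hx => (hcw e x hx).trans ((he₀ e).trans (le_max_left _ _))⟩

/-- Averaging `sq_eval_le_of_mem` over `x` bounds every point value by the integral of the square
and the norm of the derivative. Every vertex is an end of an edge, so vertex values are bounded too.
-/
theorem coercive [Nonempty E] (hG : G.Connected) (hs : ∀ e, 0 < s e)
    (hw : ∀ e, ∀ x ∈ Set.Icc (0 : ℝ) 1, 0 < w e x) :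
    ∃ κ > 0, ∀ u, κ * ‖u‖ ^ 2 ≤ stiffnessForm G s u u + massForm G w u u := by
  obtain ⟨e₀, he₀⟩ := Finite.exists_min s
  set σ := s e₀ with hσ
  have hσ0 : 0 < σ := hs e₀
  obtain ⟨ω, hω0, hω⟩ := exists_lower_bound hw
  set K := 2 / ω + 2 / σ with hK
  have hK0 : 0 < K := by positivity
  refine ⟨K⁻¹, by positivity, fun u => ?_⟩
  set A := stiffnessForm G s u u with hA
  set B := massForm G w u u with hB
  have hA0 : 0 ≤ A := by
    rw [hA, stiffnessForm_self]
    exact Finset.sum_nonneg fun e _ => mul_nonneg (hs e).le (sq_nonneg _)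
  have hB0 : 0 ≤ B := by
    rw [hB, massForm_self]
    exact Finset.sum_nonneg fun e _ => integral_sq_nonneg hw u e
  have hgrad : ∀ e, ‖grad e u‖ ^ 2 ≤ A / σ := fun e => by
    rw [le_div_iff₀ hσ0, mul_comm]
    have h1 : s e * ‖grad e u‖ ^ 2 ≤ A := by
      rw [hA, stiffnessForm_self]
      exact Finset.single_le_sum (f := fun e => s e * ‖grad e u‖ ^ 2)
        (fun e _ => mul_nonneg (hs e).le (sq_nonneg _)) (Finset.mem_univ e)
    exact (mul_le_mul_of_nonneg_right (he₀ e) (sq_nonneg _)).trans h1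
  have hint : ∀ e, ∫ x in (0 : ℝ)..1, eval e x u ^ 2 ≤ B / ω := fun e => by
    rw [le_div_iff₀ hω0, mul_comm, ← intervalIntegral.integral_const_mul]
    have h1 : ∫ x in (0 : ℝ)..1, w e x * eval e x u ^ 2 ≤ B := by
      rw [hB, massForm_self]
      exact Finset.single_le_sum (f := fun e => ∫ x in (0 : ℝ)..1, w e x * eval e x u ^ 2)
        (fun e _ => integral_sq_nonneg hw u e) (Finset.mem_univ e)
    refine le_trans (intervalIntegral.integral_mono_on zero_le_one ?_
      (intervalIntegrable_sq (w e) e u) fun x hx => ?_) h1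
    · exact (continuous_const.mul ((continuous_eval e u).pow 2)).intervalIntegrable _ _
    · exact mul_le_mul_of_nonneg_right (hω e x hx) (sq_nonneg _)
  have heval : ∀ e, ∀ y ∈ Set.Icc (0 : ℝ) 1, eval e y u ^ 2 ≤ K * (A + B) := fun e y hy => by
    have h1 : ∫ x in (0 : ℝ)..1, eval e y u ^ 2
        ≤ ∫ x in (0 : ℝ)..1, (2 * eval e x u ^ 2 + 2 * ‖grad e u‖ ^ 2) :=
      intervalIntegral.integral_mono_on zero_le_one intervalIntegrable_const
        (((continuous_const.mul ((continuous_eval e u).pow 2)).add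
          continuous_const).intervalIntegrable _ _) fun x hx => sq_eval_le_of_mem hx hy e u
    have hi : IntervalIntegrable (fun x => 2 * eval e x u ^ 2) volume 0 1 :=
      (continuous_const.mul ((continuous_eval e u).pow 2)).intervalIntegrable _ _
    rw [intervalIntegral.integral_add hi intervalIntegrable_const, intervalIntegral.integral_const_mul] at h1
    simp only [intervalIntegral.integral_const, sub_zero, one_smul] at h1
    have h2 := hgrad e
    have h3 := hint e
    calc eval e y u ^ 2 ≤ 2 * (B / ω) + 2 * (A / σ) := by linarith
      _ = (2 / ω) * B + (2 / σ) * A := by ring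
      _ ≤ K * B + K * A := by
          refine add_le_add (mul_le_mul_of_nonneg_right ?_ hB0) (mul_le_mul_of_nonneg_right ?_ hA0)
          · rw [hK]; linarith [show 0 < 2 / σ by positivity]
          · rw [hK]; linarith [show 0 < 2 / ω by positivity]
      _ = K * (A + B) := by ring
  have hn : ‖u‖ ≤ Real.sqrt (K * (A + B)) := by
    refine norm_le (Real.sqrt_nonneg _) (fun v => ?_) fun e => ?_
    · apply Real.abs_le_sqrt
      obtain ⟨e, rfl | rfl⟩ := hG.exists_edge v
      · rw [← eval_zero]; exact heval e 0 ⟨le_rfl, zero_le_one⟩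
      · rw [← eval_one]; exact heval e 1 ⟨zero_le_one, le_rfl⟩
    · apply Real.le_sqrt_of_sq_le
      refine (hgrad e).trans ?_
      calc A / σ = 1 / σ * A := by ring
        _ ≤ K * (A + B) := by
          refine mul_le_mul ?_ (by linarith) hA0 hK0.le
          rw [hK]
          have : 1 / σ ≤ 2 / σ := by gcongr; norm_num
          linarith [show 0 < 2 / ω by positivity]
  rw [inv_mul_le_iff₀ hK0]
  calc ‖u‖ ^ 2 ≤ Real.sqrt (K * (A + B)) ^ 2 := by gcongr
    _ = K * (A + B) := Real.sq_sqrt (by positivity)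

/-- The value at `x` is compared with that at the grid point `⌊n x⌋ / n`, at distance at most `1 /
n`; the index reaches `n` when `x = 1`. -/
theorem sq_eval_le_sum {n : ℕ} (hn : 0 < n) {x : ℝ} (hx : x ∈ Set.Icc (0 : ℝ) 1) (e : E)
    (u : G.H1) :
    eval e x u ^ 2 ≤ 2 * ∑ i : Fin (n + 1), eval e ((i : ℕ) / n) u ^ 2 + 2 / n * ‖u‖ ^ 2 := by
  have hn' : (0 : ℝ) < n := by exact_mod_cast hn
  have hle : ⌊n * x⌋₊ ≤ n := Nat.floor_le_of_le (by nlinarith [hx.2])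
  set i : Fin (n + 1) := ⟨⌊n * x⌋₊, Nat.lt_succ_of_le hle⟩ with hi
  have h1 : ((i : ℕ) : ℝ) / n ≤ x := by
    rw [div_le_iff₀ hn', mul_comm]
    exact Nat.floor_le (mul_nonneg hn'.le hx.1)
  have h2 : x - ((i : ℕ) : ℝ) / n ≤ 1 / n := by
    rw [sub_le_iff_le_add, ← add_div, le_div_iff₀ hn', mul_comm, add_comm]
    exact (Nat.lt_floor_add_one (n * x)).le
  have h3 := sq_eval_le h1 e u
  have h4 : eval e ((i : ℕ) / n) u ^ 2 ≤ ∑ i : Fin (n + 1), eval e ((i : ℕ) / n) u ^ 2 :=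
    Finset.single_le_sum (f := fun i : Fin (n + 1) => eval e ((i : ℕ) / n) u ^ 2)
      (fun _ _ => sq_nonneg _) (Finset.mem_univ i)
  have h5 : (x - ((i : ℕ) : ℝ) / n) * ‖grad e u‖ ^ 2 ≤ 1 / n * ‖u‖ ^ 2 := by
    gcongr
    exact norm_grad_le e u
  calc eval e x u ^ 2 ≤ _ := h3
    _ ≤ 2 * ∑ i : Fin (n + 1), eval e ((i : ℕ) / n) u ^ 2 + 2 * (1 / n * ‖u‖ ^ 2) := by gcongr
    _ = _ := by ring

theorem compact [Nonempty E] (w : E → C(ℝ, ℝ)) {ε : ℝ} (hε : 0 < ε) :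
    ∃ (n : ℕ) (L : Fin n → G.H1 →L[ℝ] ℝ), ∀ u,
      massForm G w u u ≤ ε * ‖u‖ ^ 2 + ∑ i, L i u ^ 2 := by
  obtain ⟨M, hM0, hM⟩ := exists_upper_bound w
  -- With grid width `1 / n` the error on each edge is `2 M / n * ‖u‖ ^ 2`, and `n` makes the sum
  -- over all edges at most `ε * ‖u‖ ^ 2`. The functionals are grid evaluations weighted by `√(2
  -- M)`.
  obtain ⟨n, hn⟩ := exists_nat_gt (2 * M * Fintype.card E / ε)
  have hn' : (0 : ℝ) < n := lt_of_le_of_lt (by positivity) hn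
  let eq := Fintype.equivFin (E × Fin (n + 1))
  refine ⟨_, fun j => Real.sqrt (2 * M) • eval (eq.symm j).1 (((eq.symm j).2 : ℕ) / n),
    fun u => ?_⟩
  have hL : ∑ j, ((Real.sqrt (2 * M) • eval (eq.symm j).1 (((eq.symm j).2 : ℕ) / n) :
      G.H1 →L[ℝ] ℝ) u) ^ 2 = ∑ e, M * (2 * ∑ i : Fin (n + 1), eval e ((i : ℕ) / n) u ^ 2) := by
    rw [Equiv.sum_comp eq.symm
      (fun q => ((Real.sqrt (2 * M) • eval q.1 ((q.2 : ℕ) / n) : G.H1 →L[ℝ] ℝ) u) ^ 2),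
      Fintype.sum_prod_type]
    refine Finset.sum_congr rfl fun e _ => ?_
    rw [Finset.mul_sum, Finset.mul_sum]
    refine Finset.sum_congr rfl fun i _ => ?_
    rw [smul_apply, smul_eq_mul, mul_pow, Real.sq_sqrt (by positivity)]
    ring
  rw [hL, massForm_self]
  have hedge : ∀ e ∈ Finset.univ, ∫ x in (0 : ℝ)..1, w e x * eval e x u ^ 2 ≤
      M * (2 * ∑ i : Fin (n + 1), eval e ((i : ℕ) / n) u ^ 2) + M * (2 / n * ‖u‖ ^ 2) :=
    fun e _ => by
      have h1 : ∫ x in (0 : ℝ)..1, w e x * eval e x u ^ 2 ≤ ∫ x in (0 : ℝ)..1,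
          M * (2 * ∑ i : Fin (n + 1), eval e ((i : ℕ) / n) u ^ 2 + 2 / n * ‖u‖ ^ 2) := by
        refine intervalIntegral.integral_mono_on zero_le_one (intervalIntegrable_sq (w e) e u)
          intervalIntegrable_const fun x hx => ?_
        exact mul_le_mul (hM e x hx) (sq_eval_le_sum (by exact_mod_cast hn') hx e u)
          (sq_nonneg _) hM0.le
      simp only [intervalIntegral.integral_const, sub_zero, one_smul] at h1
      rw [← mul_add]
      exact h1
  refine (Finset.sum_le_sum hedge).trans ?_
  rw [Finset.sum_add_distrib, add_comm]
  gcongr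
  rw [Finset.sum_const, Finset.card_univ, nsmul_eq_mul]
  have h2 := (div_lt_iff₀ hε).mp hn
  calc (Fintype.card E : ℝ) * (M * (2 / n * ‖u‖ ^ 2))
      = (2 * M * Fintype.card E) / n * ‖u‖ ^ 2 := by ring
    _ ≤ ε * ‖u‖ ^ 2 := by
        gcongr
        rw [div_le_iff₀ hn']
        linarith

theorem isCompactPencil [Nonempty E] (hG : G.Connected) (hs : ∀ e, 0 < s e)
    (hw : ∀ e, ∀ x ∈ Set.Icc (0 : ℝ) 1, 0 < w e x) :
    IsCompactPencil (stiffnessForm G s) (massForm G w) where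
  symm_left u v := by
    rw [stiffnessForm_apply, stiffnessForm_apply]
    simp only [real_inner_comm]
  symm_right u v := by
    rw [massForm_apply, massForm_apply]
    simp only [mul_right_comm]
  nonneg u := by
    rw [stiffnessForm_self]
    exact Finset.sum_nonneg fun e _ => mul_nonneg (hs e).le (sq_nonneg _)
  pos u hu := massForm_pos hG hw hu
  coercive := coercive hG hs hw
  compact _ hε := compact w hε

end H1

end Multigraph

/-! ### Weak eigenvectors, their fluxes and Green's formula. -/

namespace Multigraph

namespace H1

variable {V E : Type*} [Fintype V] [Fintype E] {G : Multigraph V E}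

/-- The function with given vertex values and edge derivatives. -/
def ofPair (c : V → ℝ) (h : E → UnitL2)
    (H : ∀ e, c (G.tgt e) = c (G.src e) + UnitL2.prim 1 (h e)) : G.H1 := ⟨(c, h), H⟩

theorem vertex_ofPair (c : V → ℝ) (h : E → UnitL2)
    (H : ∀ e, c (G.tgt e) = c (G.src e) + UnitL2.prim 1 (h e)) (v : V) :
    vertex v (ofPair (G := G) c h H) = c v := rfl

theorem grad_ofPair (c : V → ℝ) (h : E → UnitL2)
    (H : ∀ e, c (G.tgt e) = c (G.src e) + UnitL2.prim 1 (h e)) (e : E) :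
    grad e (ofPair (G := G) c h H) = h e := rfl

theorem ext_iff_vertex_grad {u v : G.H1} :
    u = v ↔ (∀ x, vertex x u = vertex x v) ∧ ∀ e, grad e u = grad e v := by
  refine ⟨fun h => by simp [h], fun ⟨h1, h2⟩ => Subtype.ext (Prod.ext (funext h1) (funext h2))⟩

/-- The continuous function defined by a polynomial. -/
noncomputable def polyMap : Polynomial ℝ →ₗ[ℝ] C(ℝ, ℝ) :=
  (Polynomial.toContinuousMapAlgHom (R := ℝ)).toLinearMap

theorem polyMap_apply (q : Polynomial ℝ) (x : ℝ) : polyMap q x = q.eval x := rfl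

theorem prim_polyMap_derivative {x : ℝ} (hx : x ∈ Set.Icc (0 : ℝ) 1) (q : Polynomial ℝ) :
    UnitL2.prim x (UnitL2.ofContinuous (polyMap (Polynomial.derivative q)))
      = q.eval x - q.eval 0 := by
  rw [UnitL2.prim_ofContinuous hx]
  simp only [polyMap_apply]
  exact intervalIntegral.integral_eq_sub_of_hasDerivAt (fun y _ => q.hasDerivAt y)
    ((Polynomial.derivative q).continuous.intervalIntegrable _ _)

open Classical in
/-- The functions vanishing at the vertices and given on the edge `e` by a polynomial multiple of
`x * (1 - x)`. -/
noncomputable def bubble (G : Multigraph V E) (e : E) : Polynomial ℝ →ₗ[ℝ] G.H1 where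
  toFun q := ofPair 0 (Pi.single e (UnitL2.ofContinuous (polyMap (Polynomial.derivative
    (Polynomial.X * (1 - Polynomial.X) * q))))) fun e' => by
      rcases eq_or_ne e' e with rfl | h
      · rw [Pi.single_eq_same, prim_polyMap_derivative ⟨zero_le_one, le_rfl⟩]; simp
      · rw [Pi.single_eq_of_ne h]; simp
  map_add' p q := by
    refine ext_iff_vertex_grad.mpr ⟨fun v => by simp [vertex_ofPair], fun e' => ?_⟩
    rw [map_add]
    simp only [grad_ofPair, mul_add, map_add, Pi.single_add, Pi.add_apply]
  map_smul' c q := by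
    refine ext_iff_vertex_grad.mpr ⟨fun v => by simp [vertex_ofPair], fun e' => ?_⟩
    rw [RingHom.id_apply, map_smul]
    simp only [grad_ofPair, mul_smul_comm, map_smul, Pi.single_smul,
      Pi.smul_apply]

theorem eval_bubble (e : E) (q : Polynomial ℝ) {x : ℝ} (hx : x ∈ Set.Icc (0 : ℝ) 1) :
    eval e x (bubble G e q) = x * (1 - x) * q.eval x := by
  classical
  have hg : grad e (bubble G e q) = UnitL2.ofContinuous (polyMap (Polynomial.derivative
      (Polynomial.X * (1 - Polynomial.X) * q))) := by
    change (Pi.single e _ : E → UnitL2) e = _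
    rw [Pi.single_eq_same]
  have hv : vertex (G.src e) (bubble G e q) = 0 := rfl
  rw [eval_apply, hg, hv, prim_polyMap_derivative hx]
  simp

/-- The bubbles on one edge embed the space of polynomials. -/
theorem not_finiteDimensional [Nonempty E] : ¬ FiniteDimensional ℝ G.H1 := by
  intro hfin
  obtain ⟨e⟩ := ‹Nonempty E›
  refine Polynomial.not_finite (R := ℝ) (FiniteDimensional.of_injective (bubble G e) ?_)
  rw [← LinearMap.ker_eq_bot, Submodule.eq_bot_iff]
  intro q hq
  refine Polynomial.eq_zero_of_infinite_isRoot q ((Set.Ioo_infinite (zero_lt_one' ℝ)).mono ?_)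
  intro x hx
  have h1 := eval_bubble (G := G) e q (Set.Ioo_subset_Icc_self hx)
  rw [LinearMap.mem_ker.mp hq, map_zero] at h1
  have h2 : x * (1 - x) ≠ 0 := mul_ne_zero hx.1.ne' (sub_pos.mpr hx.2).ne'
  exact (mul_eq_zero.mp h1.symm).resolve_left h2

theorem exists_isSpectralSequence [Nonempty E] (hG : G.Connected) {s : E → ℝ} {w : E → C(ℝ, ℝ)}
    (hs : ∀ e, 0 < s e) (hw : ∀ e, ∀ x ∈ Set.Icc (0 : ℝ) 1, 0 < w e x) :
    ∃ e ν, IsSpectralSequence (stiffnessForm G s) (massForm G w) e ν :=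
  (isCompactPencil hG hs hw).exists_isSpectralSequence not_finiteDimensional

/-- Green's formula on an edge. -/
theorem integral_mul_eval {P ω : C(ℝ, ℝ)} (hP : ∀ x ∈ Set.Ioo (0 : ℝ) 1, HasDerivAt P (-ω x) x)
    (e : E) (v : G.H1) :
    ∫ x in (0 : ℝ)..1, ω x * eval e x v = inner ℝ (UnitL2.ofContinuous P) (grad e v)
      + P 0 * vertex (G.src e) v - P 1 * vertex (G.tgt e) v := by
  have h1 := UnitL2.integral_mul_prim hP (grad e v)
  have h2 : ∫ x in (0 : ℝ)..1, ω x = P 0 - P 1 := by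
    have := intervalIntegral.integral_eq_sub_of_hasDerivAt_of_le (f := P) (f' := fun y => -ω y)
      zero_le_one P.continuous.continuousOn hP (ω.continuous.intervalIntegrable 0 1).neg
    rw [intervalIntegral.integral_neg] at this
    linarith
  have h3 : vertex (G.tgt e) v = vertex (G.src e) v + UnitL2.prim 1 (grad e v) := by
    rw [← eval_one, eval_apply]
  have h4 : ∫ x in (0 : ℝ)..1, ω x * eval e x v
      = (∫ x in (0 : ℝ)..1, ω x) * vertex (G.src e) v
        + ∫ x in (0 : ℝ)..1, ω x * UnitL2.prim x (grad e v) := by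
    have hi1 : IntervalIntegrable (fun x => ω x * vertex (G.src e) v) volume 0 1 :=
      (ω.continuous.mul continuous_const).intervalIntegrable _ _
    have hi2 : IntervalIntegrable (fun x => ω x * UnitL2.prim x (grad e v)) volume 0 1 :=
      (ω.continuous.mul (UnitL2.continuous_prim _)).intervalIntegrable _ _
    rw [← intervalIntegral.integral_mul_const, ← intervalIntegral.integral_add hi1 hi2]
    simp only [eval_apply, mul_add]
  rw [h4, h1, h2, h3]
  ring

/-- The evaluation of a function along an edge as a continuous map. -/
noncomputable def evalMap (e : E) (u : G.H1) : C(ℝ, ℝ) := ⟨fun x => eval e x u, continuous_eval e u⟩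

variable {s : E → ℝ} {w : E → C(ℝ, ℝ)} {μ : ℝ} {u : G.H1}

/-- If the fluxes `P e` represent `s e * u'`, then `u` is an eigenvector if and only if the fluxes
satisfy Kirchhoff's condition. -/
theorem isPencilEigenvector_iff {P : E → C(ℝ, ℝ)}
    (hP : ∀ e, ∀ x ∈ Set.Ioo (0 : ℝ) 1, HasDerivAt (P e) (-(μ * (w e x * eval e x u))) x)
    (hPu : ∀ e, UnitL2.ofContinuous (P e) = s e • grad e u) (v : G.H1) :
    stiffnessForm G s u v = μ * massForm G w u v ↔
      ∑ e, P e 0 * vertex (G.src e) v + ∑ e, -(P e 1) * vertex (G.tgt e) v = 0 := by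
  have h1 : ∀ e, μ * ∫ x in (0 : ℝ)..1, w e x * eval e x u * eval e x v
      = s e * inner ℝ (grad e u) (grad e v)
      + P e 0 * vertex (G.src e) v - P e 1 * vertex (G.tgt e) v := fun e => by
    have h2 := integral_mul_eval (P := P e) (ω := μ • (w e * evalMap e u)) (hP e) e v
    rw [hPu, inner_smul_left] at h2
    rw [← intervalIntegral.integral_const_mul]
    simp only [mul_assoc, ContinuousMap.coe_smul, ContinuousMap.coe_mul, Pi.smul_apply,
      Pi.mul_apply, smul_eq_mul] at h2 ⊢
    simpa using! h2
  rw [stiffnessForm_apply, massForm_apply, Finset.mul_sum, Finset.sum_congr rfl fun e _ => h1 e,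
    Finset.sum_sub_distrib, Finset.sum_add_distrib]
  simp only [neg_mul, Finset.sum_neg_distrib]
  constructor <;> intro h <;> linarith

/-- The flux of an eigenvector on an edge is represented by a differentiable function. -/
theorem exists_flux (hu : IsPencilEigenvector (stiffnessForm G s) (massForm G w) μ u) (e : E) :
    ∃ P : C(ℝ, ℝ), (∀ x, HasDerivAt P (-(μ * (w e x * eval e x u))) x) ∧
      UnitL2.ofContinuous P = s e • grad e u := by
  classical
  have hωc : Continuous fun x => μ * (w e x * eval e x u) := by
    have := continuous_eval e u
    fun_prop
  let ω : C(ℝ, ℝ) := ⟨_, hωc⟩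
  have hd : ∀ x, HasDerivAt (fun x => -∫ y in (0 : ℝ)..x, ω y) (-ω x) x := fun x =>
    (intervalIntegral.integral_hasDerivAt_right (ω.continuous.intervalIntegrable _ _)
      (ω.continuous.stronglyMeasurableAtFilter _ _) ω.continuous.continuousAt).neg
  let Q : C(ℝ, ℝ) := ⟨fun x => -∫ y in (0 : ℝ)..x, ω y,
    continuous_iff_continuousAt.mpr fun x => (hd x).continuousAt⟩
  set one := UnitL2.ofContinuous 1 with hone
  have hone1 : inner ℝ one one = (1 : ℝ) := by
    rw [hone, UnitL2.inner_ofContinuous_ofContinuous]; simp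
  set ψ : UnitL2 := s e • grad e u - UnitL2.ofContinuous Q with hψ
  set m : ℝ := inner ℝ one ψ with hm
  -- The du Bois-Reymond argument: a mean-zero `φ` is the derivative of a test function vanishing at
  -- all vertices and supported on `e`. So the difference between the weak flux and the explicit
  -- primitive is orthogonal to all mean-zero functions, hence constant.
  have horth : ∀ φ : UnitL2, inner ℝ one φ = (0 : ℝ) → inner ℝ ψ φ = (0 : ℝ) := fun φ hφ => by
    have hφ1 : UnitL2.prim 1 φ = 0 := by rw [UnitL2.prim_one_eq_inner, ← hone, hφ]
    let v : G.H1 := ofPair 0 (Pi.single e φ) fun e' => by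
      rcases eq_or_ne e' e with rfl | h
      · rw [Pi.single_eq_same, hφ1]; simp
      · rw [Pi.single_eq_of_ne h]; simp
    have hv := hu v
    have hgrad : ∀ e', e' ≠ e → grad e' v = 0 := fun e' h => Pi.single_eq_of_ne h _
    have hgrad' : grad e v = φ := by
      change (Pi.single e φ : E → UnitL2) e = φ
      rw [Pi.single_eq_same]
    have hvert : ∀ x, vertex x v = 0 := fun x => rfl
    have hev : ∀ e', e' ≠ e → ∀ x, eval e' x v = 0 := fun e' h x => by
      rw [eval_apply, hgrad e' h, hvert]; simp
    rw [stiffnessForm_apply, massForm_apply, Finset.sum_eq_single e, Finset.sum_eq_single e] at hv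
    · have h2 := integral_mul_eval (P := Q) (ω := ω) (fun x _ => hd x) e v
      rw [hvert, hvert, hgrad', mul_zero, mul_zero, add_zero, sub_zero] at h2
      rw [hgrad', ← intervalIntegral.integral_const_mul] at hv
      rw [hψ, inner_sub_left, inner_smul_left, ← h2]
      have h3 : ∀ x, ω x * eval e x v = μ * (w e x * eval e x u * eval e x v) := fun x => by
        change μ * (w e x * eval e x u) * eval e x v = _
        ring
      simp only [h3, ← hv]
      simp
    · intro e' _ h; simp [hev e' h]
    · intro h; exact absurd (Finset.mem_univ e) h
    · intro e' _ h; simp [hgrad e' h]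
    · intro h; exact absurd (Finset.mem_univ e) h
  have hψm : ψ = m • one := by
    have h1 : inner ℝ one (ψ - m • one) = (0 : ℝ) := by
      rw [inner_sub_right, inner_smul_right, hone1, mul_one, sub_self]
    have h2 := horth _ h1
    have h3 : inner ℝ (ψ - m • one) (ψ - m • one) = (0 : ℝ) := by
      rw [inner_sub_left, h2, inner_smul_left, h1, mul_zero, sub_zero]
    exact sub_eq_zero.mp (inner_self_eq_zero.mp h3)
  refine ⟨m • 1 + Q, fun x => ?_, ?_⟩
  · have h1 : HasDerivAt (fun x => m + -∫ y in (0 : ℝ)..x, ω y) (-ω x) x := (hd x).const_add m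
    refine h1.congr_of_eventuallyEq (Eventually.of_forall fun y => ?_)
    simp [Q]
  · rw [map_add, map_smul, ← hone, ← hψm, hψ, sub_add_cancel]

end H1

end Multigraph

/-! ### Weak eigenvectors are the classical eigenfunctions. -/

namespace MetricDensity

variable {E : Type*} (p : MetricDensity E)

theorem length_pos (e : E) : 0 < p.length e := Real.sqrt_pos.mpr (p.g_pos e)

theorem length_sq (e : E) : p.length e ^ 2 = p.g e := Real.sq_sqrt (p.g_pos e).le

/-- The reciprocals of the edge lengths. -/
noncomputable def stiffness (e : E) : ℝ := (p.length e)⁻¹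

theorem stiffness_pos (e : E) : 0 < p.stiffness e := inv_pos.mpr (p.length_pos e)

/-- The mass density in the coordinate of an edge, extended to the real line. -/
noncomputable def mass (e : E) : C(ℝ, ℝ) where
  toFun x := p.length e * p.ρ e (Set.projIcc (0 : ℝ) 1 zero_le_one x)
  continuous_toFun := continuous_const.mul ((p.ρ_smooth e).continuousOn.comp_continuous
    (continuous_subtype_val.comp continuous_projIcc) fun x => (Set.projIcc _ _ _ x).2)

theorem mass_apply (e : E) {x : ℝ} (hx : x ∈ Set.Icc (0 : ℝ) 1) :
    p.mass e x = p.length e * p.ρ e x := by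
  simp [mass, Set.projIcc_of_mem _ hx]

theorem mass_pos (e : E) (x : ℝ) (hx : x ∈ Set.Icc (0 : ℝ) 1) : 0 < p.mass e x := by
  rw [p.mass_apply e hx]
  exact mul_pos (p.length_pos e) (p.ρ_pos e x hx)

end MetricDensity

namespace Multigraph

namespace H1

variable {V E : Type*} [Fintype V] [Fintype E] {G : Multigraph V E}

theorem exists_vertex_eq (G : Multigraph V E) (c : V → ℝ) : ∃ v : G.H1, ∀ x, vertex x v = c x := by
  refine ⟨ofPair c (fun e => (c (G.tgt e) - c (G.src e)) • UnitL2.ofContinuous 1) fun e => ?_,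
    fun x => rfl⟩
  rw [map_smul, UnitL2.prim_ofContinuous ⟨zero_le_one, le_rfl⟩]
  simp

theorem hasDerivWithinAt_eval {s : ℝ} (hs : 0 < s) {u : G.H1} {e : E} {P : C(ℝ, ℝ)}
    (hP : UnitL2.ofContinuous P = s • grad e u) {x : ℝ} (hx : x ∈ Set.Icc (0 : ℝ) 1) :
    HasDerivWithinAt (fun x => eval e x u) (P x / s) (Set.Icc 0 1) x := by
  have h1 : ∀ y ∈ Set.Icc (0 : ℝ) 1,
      eval e y u = vertex (G.src e) u + (∫ z in (0 : ℝ)..y, P z) / s := fun y hy => by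
    rw [eval_apply, ← UnitL2.prim_ofContinuous hy, hP, map_smul, smul_eq_mul,
      mul_div_cancel_left₀ _ hs.ne']
  have h2 : HasDerivAt (fun y => vertex (G.src e) u + (∫ z in (0 : ℝ)..y, P z) / s) (P x / s) x :=
    ((intervalIntegral.integral_hasDerivAt_right (P.continuous.intervalIntegrable _ _)
      (P.continuous.stronglyMeasurableAtFilter _ _) P.continuous.continuousAt).div_const s).const_add
      _
  exact h2.hasDerivWithinAt.congr h1 (h1 x hx)

variable {p : MetricDensity E} {μ : ℝ}

/-- The flux of `exists_flux` is continuously differentiable and is a multiple of the derivative of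
`u`, so `u` is twice continuously differentiable and solves the equation pointwise. -/
theorem isSolution_of_isPencilEigenvector {u : G.H1}
    (hu : IsPencilEigenvector (stiffnessForm G p.stiffness) (massForm G p.mass) μ u) :
    G.IsSolution p μ fun e x => eval e x u := by
  classical
  choose P hPd hPu using fun e => exists_flux hu e
  have hD : ∀ e, ∀ x ∈ Set.Icc (0 : ℝ) 1,
      HasDerivWithinAt (fun x => eval e x u) (P e x / p.stiffness e) (Set.Icc 0 1) x :=
    fun e x hx => hasDerivWithinAt_eval (p.stiffness_pos e) (hPu e) hx
  have huniq : UniqueDiffOn ℝ (Set.Icc (0 : ℝ) 1) := uniqueDiffOn_Icc zero_lt_one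
  have hdw : ∀ e, ∀ x ∈ Set.Icc (0 : ℝ) 1,
      derivWithin (fun x => eval e x u) (Set.Icc 0 1) x = P e x / p.stiffness e :=
    fun e x hx => (hD e x hx).derivWithin (huniq x hx)
  have hPC : ∀ e, ContDiff ℝ 1 (P e) := fun e => by
    rw [contDiff_one_iff_deriv]
    refine ⟨fun x => (hPd e x).differentiableAt, ?_⟩
    have : deriv (P e) = fun x => -(μ * (p.mass e x * eval e x u)) :=
      funext fun x => (hPd e x).deriv
    rw [this]
    have := continuous_eval e u
    fun_prop
  refine ⟨fun e => ?_, fun e x hx => ?_, ⟨fun v => vertex v u, fun e => ⟨eval_zero e u, eval_one e u⟩⟩,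
    fun v => ?_⟩
  · rw [show (2 : WithTop ℕ∞) = 1 + 1 by norm_num, contDiffOn_succ_iff_derivWithin huniq]
    refine ⟨fun x hx => (hD e x hx).differentiableWithinAt, by simp, ?_⟩
    exact ((hPC e).div_const _).contDiffOn.congr (hdw e)
  · rw [derivWithin_congr (hdw e) (hdw e x hx),
      (((hPd e x).div_const _).hasDerivWithinAt).derivWithin (huniq x hx), p.mass_apply e hx,
      ← p.length_sq, MetricDensity.stiffness]
    have := p.length_pos e
    field_simp
  -- Testing with a function equal to one at `v` and zero at the other vertices isolates the
  -- Kirchhoff condition at `v`.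
  · obtain ⟨t, ht⟩ := exists_vertex_eq G fun x => if x = v then 1 else 0
    have h1 := (isPencilEigenvector_iff (fun e x _ => hPd e x) hPu t).mp (hu t)
    have h2 : ∀ e, ∀ x ∈ Set.Icc (0 : ℝ) 1,
        derivWithin (fun x => eval e x u) (Set.Icc 0 1) x / p.length e = P e x := fun e x hx => by
      rw [hdw e x hx, MetricDensity.stiffness]
      have := p.length_pos e
      field_simp
    simp only [ht] at h1
    refine Eq.trans ?_ h1
    congr 1
    · refine Finset.sum_congr rfl fun e _ => ?_
      rw [h2 e 0 ⟨le_rfl, zero_le_one⟩, mul_ite, mul_one, mul_zero]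
    · refine Finset.sum_congr rfl fun e _ => ?_
      rw [neg_div, h2 e 1 ⟨zero_le_one, le_rfl⟩, mul_ite, mul_one, mul_zero]

theorem exists_isPencilEigenvector_of_isSolution {f : E → ℝ → ℝ} (hf : G.IsSolution p μ f) :
    ∃ u : G.H1, IsPencilEigenvector (stiffnessForm G p.stiffness) (massForm G p.mass) μ u ∧
      ∀ e, ∀ x ∈ Set.Icc (0 : ℝ) 1, eval e x u = f e x := by
  classical
  have huniq : UniqueDiffOn ℝ (Set.Icc (0 : ℝ) 1) := uniqueDiffOn_Icc zero_lt_one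
  have hC1 : ∀ e, ContDiffOn ℝ 1 (derivWithin (f e) (Set.Icc 0 1)) (Set.Icc 0 1) := fun e =>
    ((contDiffOn_succ_iff_derivWithin (n := 1) huniq).mp
      (by simpa [one_add_one_eq_two] using hf.contDiffOn e)).2.2
  let D : E → C(ℝ, ℝ) := fun e =>
    { toFun := fun x => derivWithin (f e) (Set.Icc 0 1) (Set.projIcc (0 : ℝ) 1 zero_le_one x)
      continuous_toFun := (hC1 e).continuousOn.comp_continuous
        (continuous_subtype_val.comp continuous_projIcc) fun x => (Set.projIcc _ _ _ x).2 }
  have hDx : ∀ e, ∀ x ∈ Set.Icc (0 : ℝ) 1, D e x = derivWithin (f e) (Set.Icc 0 1) x :=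
    fun e x hx => by
      change derivWithin (f e) (Set.Icc 0 1) (Set.projIcc (0 : ℝ) 1 zero_le_one x) = _
      rw [Set.projIcc_of_mem _ hx]
  obtain ⟨c, hc⟩ := hf.continuous
  have hFTC : ∀ e, ∀ x ∈ Set.Icc (0 : ℝ) 1,
      UnitL2.prim x (UnitL2.ofContinuous (D e)) = f e x - f e 0 := fun e x hx => by
    rw [UnitL2.prim_ofContinuous hx]
    refine intervalIntegral.integral_eq_sub_of_hasDerivAt_of_le hx.1
      ((hf.contDiffOn e).continuousOn.mono (Set.Icc_subset_Icc_right hx.2)) (fun y hy => ?_)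
      ((D e).continuous.intervalIntegrable _ _)
    have hy' : y ∈ Set.Ioo (0 : ℝ) 1 := ⟨hy.1, hy.2.trans_le hx.2⟩
    rw [hDx e y (Set.Ioo_subset_Icc_self hy')]
    exact (((hf.contDiffOn e).differentiableOn (by norm_num) y
      (Set.Ioo_subset_Icc_self hy')).hasDerivWithinAt).hasDerivAt (Icc_mem_nhds hy'.1 hy'.2)
  let u : G.H1 := ofPair c (fun e => UnitL2.ofContinuous (D e)) fun e => by
    rw [hFTC e 1 ⟨zero_le_one, le_rfl⟩, (hc e).1, (hc e).2]; ring
  have heval : ∀ e, ∀ x ∈ Set.Icc (0 : ℝ) 1, eval e x u = f e x := fun e x hx => by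
    change c (G.src e) + UnitL2.prim x (UnitL2.ofContinuous (D e)) = f e x
    rw [hFTC e x hx, (hc e).1]; ring
  refine ⟨u, fun v => ?_, heval⟩
  have hP : ∀ e, ∀ x ∈ Set.Ioo (0 : ℝ) 1, HasDerivAt (p.stiffness e • D e : C(ℝ, ℝ))
      (-(μ * (p.mass e x * eval e x u))) x := fun e x hx => by
    have hx' := Set.Ioo_subset_Icc_self hx
    have h1 : HasDerivAt (derivWithin (f e) (Set.Icc 0 1))
        (derivWithin (derivWithin (f e) (Set.Icc 0 1)) (Set.Icc 0 1) x) x :=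
      (((hC1 e).differentiableOn one_ne_zero x hx').hasDerivWithinAt).hasDerivAt
        (Icc_mem_nhds hx.1 hx.2)
    have h2 : HasDerivAt (D e) (derivWithin (derivWithin (f e) (Set.Icc 0 1)) (Set.Icc 0 1) x) x := by
      refine h1.congr_of_eventuallyEq ?_
      filter_upwards [Ioo_mem_nhds hx.1 hx.2] with y hy
      exact hDx e y (Set.Ioo_subset_Icc_self hy)
    have h3 := hf.equation e x hx'
    refine (h2.const_mul (p.stiffness e)).congr_deriv ?_
    rw [div_eq_iff (p.g_pos e).ne', neg_eq_iff_eq_neg] at h3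
    rw [h3, heval e x hx', p.mass_apply e hx', ← p.length_sq, MetricDensity.stiffness]
    have := p.length_pos e
    field_simp
  refine (isPencilEigenvector_iff (P := fun e => p.stiffness e • D e) hP
    (fun e => map_smul _ _ _) v).mpr ?_
  -- The Kirchhoff conditions, weighted by the vertex values of the test function and summed, are
  -- the boundary terms of Green's formula regrouped by vertex.
  have hK : ∑ x, vertex x v * ((∑ e : E, if G.src e = x
        then derivWithin (f e) (Set.Icc 0 1) 0 / p.length e else 0)
      + (∑ e : E, if G.tgt e = x
        then -(derivWithin (f e) (Set.Icc 0 1) 1) / p.length e else 0)) = 0 :=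
    Finset.sum_eq_zero fun x _ => by rw [hf.kirchhoff x, mul_zero]
  refine Eq.trans ?_ hK
  simp only [mul_add, Finset.mul_sum, Finset.sum_add_distrib]
  congr 1
  · rw [Finset.sum_comm]
    refine Finset.sum_congr rfl fun e _ => ?_
    simp only [mul_ite, mul_zero, Finset.sum_ite_eq, Finset.mem_univ, if_true]
    change p.stiffness e * D e 0 * _ = _
    rw [hDx e 0 ⟨le_rfl, zero_le_one⟩, MetricDensity.stiffness]
    ring
  · rw [Finset.sum_comm]
    refine Finset.sum_congr rfl fun e _ => ?_
    simp only [mul_ite, mul_zero, Finset.sum_ite_eq, Finset.mem_univ, if_true]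
    change -(p.stiffness e * D e 1) * _ = _
    rw [hDx e 1 ⟨zero_le_one, le_rfl⟩, MetricDensity.stiffness]
    ring

/-- The restriction of a function to the points of the edges. -/
noncomputable def toFunction (G : Multigraph V E) : G.H1 →ₗ[ℝ] (E × Set.Icc (0 : ℝ) 1 → ℝ) :=
  LinearMap.pi fun x => (eval x.1 x.2 : G.H1 →L[ℝ] ℝ)

theorem ker_toFunction [Nonempty E] (hG : G.Connected) : LinearMap.ker (toFunction G) = ⊥ := by
  rw [Submodule.eq_bot_iff]
  exact fun u hu => ext_of_eval_eq_zero hG fun e x hx =>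
    congrFun (LinearMap.mem_ker.mp hu) (e, ⟨x, hx⟩)

/-- The eigenvalues are those of the pencil of the energy and mass forms. -/
theorem eigenvalue_eq [Nonempty E] (hG : G.Connected) {e : ℕ → G.H1} {ν : ℕ → ℝ}
    (h : IsSpectralSequence (stiffnessForm G p.stiffness) (massForm G p.mass) e ν) (k : ℕ) :
    G.eigenvalue k p = ν k := by
  have hP : IsCompactPencil (stiffnessForm G p.stiffness) (massForm G p.mass) :=
    isCompactPencil hG p.stiffness_pos p.mass_pos
  rw [← (h.isLeast hP k).csInf_eq, eigenvalue]
  congr 1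
  ext Λ
  constructor
  · rintro ⟨μ, f, hf, hli⟩
    choose u hu hfu using fun i => exists_isPencilEigenvector_of_isSolution (hf i).2
    refine ⟨μ, u, fun i => ⟨(hf i).1, hu i⟩, ?_⟩
    rw [← LinearMap.linearIndependent_iff (toFunction G) (ker_toFunction hG)]
    have h1 : toFunction G ∘ u = fun i => fun x : E × Set.Icc (0 : ℝ) 1 => f i x.1 x.2 :=
      funext fun i => funext fun x => hfu i x.1 x.2 x.2.2
    rw [h1]
    exact hli
  · rintro ⟨μ, u, hu, hli⟩
    refine ⟨μ, fun i e x => eval e x (u i),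
      fun i => ⟨(hu i).1, isSolution_of_isPencilEigenvector (hu i).2⟩, ?_⟩
    exact (LinearMap.linearIndependent_iff (toFunction G) (ker_toFunction hG)).mpr hli

end H1

end Multigraph

/-! ### The normalising factor and affine perturbations of the data. -/

/-- The normalising factor as a function of the reciprocal edge lengths and the edge masses. -/
noncomputable def normFactor {E : Type*} [Fintype E] (α : ℝ) (s M : E → ℝ) : ℝ :=
  (∑ e, s e ^ (2 * α - 2)) * ∑ e, s e ^ (1 - 2 * α) * M e

/-- The logarithmic derivative of the normalising factor. -/
noncomputable def logDerivNormFactor {E : Type*} [Fintype E] (α : ℝ) (s M x N : E → ℝ) : ℝ :=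
  (∑ e, (2 * α - 2) * s e ^ (2 * α - 3) * x e) / (∑ e, s e ^ (2 * α - 2)) +
    (∑ e, ((1 - 2 * α) * s e ^ (-(2 * α)) * M e * x e + s e ^ (1 - 2 * α) * N e)) /
      (∑ e, s e ^ (1 - 2 * α) * M e)

section normFactor

variable {E : Type*} [Fintype E] {α : ℝ} {s M : E → ℝ}

theorem sum_rpow_pos [Nonempty E] (hs : ∀ e, 0 < s e) (a : ℝ) : 0 < ∑ e, s e ^ a :=
  Finset.sum_pos (fun e _ => Real.rpow_pos_of_pos (hs e) a) Finset.univ_nonempty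

theorem sum_rpow_mul_pos [Nonempty E] (hs : ∀ e, 0 < s e) (hM : ∀ e, 0 < M e) (a : ℝ) :
    0 < ∑ e, s e ^ a * M e :=
  Finset.sum_pos (fun e _ => mul_pos (Real.rpow_pos_of_pos (hs e) a) (hM e)) Finset.univ_nonempty

theorem normFactor_pos [Nonempty E] (hs : ∀ e, 0 < s e) (hM : ∀ e, 0 < M e) :
    0 < normFactor α s M :=
  mul_pos (sum_rpow_pos hs _) (sum_rpow_mul_pos hs hM _)

theorem hasDerivAt_normFactor [Nonempty E] (hs : ∀ e, 0 < s e) (hM : ∀ e, 0 < M e)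
    (x N : E → ℝ) :
    HasDerivAt (fun t : ℝ => normFactor α (fun e => s e + t * x e) (fun e => M e + t * N e))
      (normFactor α s M * logDerivNormFactor α s M x N) 0 := by
  have hlin : ∀ a b : ℝ, HasDerivAt (fun t : ℝ => a + t * b) b 0 := fun a b => by
    simpa using ((hasDerivAt_id (0 : ℝ)).mul_const b).const_add a
  have hpow : ∀ e (r : ℝ), HasDerivAt (fun t : ℝ => (s e + t * x e) ^ r)
      (r * s e ^ (r - 1) * x e) 0 := fun e r => by
    have h1 := (hlin (s e) (x e)).rpow_const (p := r) (Or.inl (by simpa using (hs e).ne'))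
    refine h1.congr_deriv ?_
    simp; ring
  have h1 : HasDerivAt (fun t : ℝ => ∑ e, (s e + t * x e) ^ (2 * α - 2))
      (∑ e, (2 * α - 2) * s e ^ (2 * α - 3) * x e) 0 := by
    refine (HasDerivAt.fun_sum fun e _ => hpow e (2 * α - 2)).congr_deriv ?_
    refine Finset.sum_congr rfl fun e _ => ?_
    rw [show 2 * α - 2 - 1 = 2 * α - 3 by ring]
  have h2 : HasDerivAt (fun t : ℝ => ∑ e, (s e + t * x e) ^ (1 - 2 * α) * (M e + t * N e))
      (∑ e, ((1 - 2 * α) * s e ^ (-(2 * α)) * M e * x e + s e ^ (1 - 2 * α) * N e)) 0 := by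
    refine (HasDerivAt.fun_sum fun e _ =>
      (hpow e (1 - 2 * α)).mul (hlin (M e) (N e))).congr_deriv ?_
    refine Finset.sum_congr rfl fun e _ => ?_
    rw [show 1 - 2 * α - 1 = -(2 * α) by ring]
    simp only [zero_mul, add_zero]
    ring
  refine (h1.mul h2).congr_deriv ?_
  have h3 := (sum_rpow_pos hs (2 * α - 2)).ne'
  have h4 := (sum_rpow_mul_pos hs hM (1 - 2 * α)).ne'
  simp only [zero_mul, add_zero, normFactor, logDerivNormFactor]
  generalize (∑ e, s e ^ (2 * α - 2)) = S at h3 ⊢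
  generalize (∑ e, s e ^ (1 - 2 * α) * M e) = S' at h4 ⊢
  rw [mul_add, mul_right_comm, mul_div_cancel₀ _ h3, mul_assoc S, mul_div_cancel₀ _ h4]

end normFactor

namespace MetricDensity

variable {E : Type*} (p : MetricDensity E)

/-- The pair whose reciprocal lengths and mass densities are affine in `t`. -/
noncomputable def perturb (x : E → ℝ) (η : E → Polynomial ℝ) (t : ℝ)
    (h1 : ∀ e, 0 < p.stiffness e + t * x e)
    (h2 : ∀ e, ∀ y ∈ Set.Icc (0 : ℝ) 1, 0 < p.length e * p.ρ e y + t * (η e).eval y) :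
    MetricDensity E where
  g e := ((p.stiffness e + t * x e)⁻¹) ^ 2
  -- The first factor is the reciprocal of the new length, so that length times density is affine in
  -- `t`.
  ρ e y := (p.stiffness e + t * x e) * (p.length e * p.ρ e y + t * (η e).eval y)
  g_pos e := pow_pos (inv_pos.mpr (h1 e)) 2
  ρ_smooth e := contDiffOn_const.mul ((contDiffOn_const.mul (p.ρ_smooth e)).add
    (contDiffOn_const.mul ((η e).contDiff_aeval _).contDiffOn))
  ρ_pos e y hy := mul_pos (h1 e) (h2 e y hy)

variable {p} {x : E → ℝ} {η : E → Polynomial ℝ} {t : ℝ}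
  {h1 : ∀ e, 0 < p.stiffness e + t * x e}
  {h2 : ∀ e, ∀ y ∈ Set.Icc (0 : ℝ) 1, 0 < p.length e * p.ρ e y + t * (η e).eval y}

theorem length_perturb (e : E) :
    (p.perturb x η t h1 h2).length e = (p.stiffness e + t * x e)⁻¹ :=
  Real.sqrt_sq (inv_nonneg.mpr (h1 e).le)

theorem stiffness_perturb (e : E) :
    (p.perturb x η t h1 h2).stiffness e = p.stiffness e + t * x e := by
  rw [stiffness, length_perturb, inv_inv]

theorem mass_perturb (e : E) {y : ℝ} (hy : y ∈ Set.Icc (0 : ℝ) 1) :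
    (p.perturb x η t h1 h2).mass e y = p.mass e y + t * (η e).eval y := by
  rw [mass_apply _ _ hy, mass_apply _ _ hy, length_perturb]
  exact inv_mul_cancel_left₀ (h1 e).ne' _

variable (p)

/-- The mass of an edge. -/
noncomputable def edgeMass (e : E) : ℝ := ∫ y in (0 : ℝ)..1, p.mass e y

theorem edgeMass_pos (e : E) : 0 < p.edgeMass e :=
  intervalIntegral.intervalIntegral_pos_of_pos_on ((p.mass e).continuous.intervalIntegrable _ _)
    (fun y hy => p.mass_pos e y (Set.Ioo_subset_Icc_self hy)) zero_lt_one

variable {p}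

theorem edgeMass_perturb (e : E) : (p.perturb x η t h1 h2).edgeMass e =
    p.edgeMass e + t * ∫ y in (0 : ℝ)..1, (η e).eval y := by
  have hi : IntervalIntegrable (fun y => t * (η e).eval y) volume 0 1 :=
    (continuous_const.mul (η e).continuous).intervalIntegrable _ _
  rw [edgeMass, edgeMass, ← intervalIntegral.integral_const_mul, ← intervalIntegral.integral_add
    ((p.mass e).continuous.intervalIntegrable _ _) hi]
  refine intervalIntegral.integral_congr fun y hy => ?_
  rw [Set.uIcc_of_le zero_le_one] at hy
  exact mass_perturb e hy

variable (p)

theorem g_eq (e : E) : p.g e = p.stiffness e ^ (-2 : ℝ) := by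
  rw [← p.length_sq, stiffness, Real.inv_rpow (p.length_pos e).le, Real.rpow_neg (p.length_pos e).le,
    inv_inv]
  norm_cast

theorem g_rpow (e : E) (a : ℝ) : p.g e ^ a = p.stiffness e ^ (-2 * a) := by
  rw [g_eq, ← Real.rpow_mul (p.stiffness_pos e).le]

theorem integral_ρ (e : E) : ∫ y in (0 : ℝ)..1, p.ρ e y = p.stiffness e * p.edgeMass e := by
  rw [edgeMass, ← intervalIntegral.integral_const_mul]
  refine intervalIntegral.integral_congr fun y hy => ?_
  rw [Set.uIcc_of_le zero_le_one] at hy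
  simp only [p.mass_apply e hy, stiffness]
  exact (inv_mul_cancel_left₀ (p.length_pos e).ne' _).symm

end MetricDensity

namespace Multigraph

variable {V E : Type*} [Fintype E] (G : Multigraph V E)

/-- Since `g = s ^ (-2)` and `∫ ρ = s * M`, the summands become `s ^ (2α - 2)` and `s ^ (-2α) * s *
M`. -/
theorem normalisedEigenvalue_eq (k : ℕ) (α : ℝ) (p : MetricDensity E) :
    G.normalisedEigenvalue k α p =
      G.eigenvalue k p * normFactor α p.stiffness p.edgeMass := by
  rw [normalisedEigenvalue, normFactor, mul_assoc]
  congr 2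
  · refine Finset.sum_congr rfl fun e _ => ?_
    rw [p.g_rpow]
    congr 1
    ring
  · refine Finset.sum_congr rfl fun e _ => ?_
    rw [p.g_rpow, p.integral_ρ, ← mul_assoc]
    congr 1
    nth_rewrite 2 [← Real.rpow_one (p.stiffness e)]
    rw [← Real.rpow_add (p.stiffness_pos e)]
    congr 1
    ring

namespace H1

variable [Fintype V] {G}

theorem stiffnessForm_add_smul (s x : E → ℝ) (t : ℝ) :
    stiffnessForm G (fun e => s e + t * x e) = stiffnessForm G s + t • stiffnessForm G x := by
  ext u v
  change _ = stiffnessForm G s u v + t * stiffnessForm G x u v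
  simp only [stiffnessForm_apply, Finset.mul_sum, ← Finset.sum_add_distrib]
  exact Finset.sum_congr rfl fun e _ => by ring

theorem massForm_congr_add_smul {w w₁ w₂ : E → C(ℝ, ℝ)} {t : ℝ}
    (h : ∀ e, ∀ y ∈ Set.Icc (0 : ℝ) 1, w e y = w₁ e y + t * w₂ e y) :
    massForm G w = massForm G w₁ + t • massForm G w₂ := by
  ext u v
  change _ = massForm G w₁ u v + t * massForm G w₂ u v
  simp only [massForm_apply, Finset.mul_sum, ← Finset.sum_add_distrib]
  refine Finset.sum_congr rfl fun e _ => ?_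
  rw [← intervalIntegral.integral_const_mul, ← intervalIntegral.integral_add
    (intervalIntegrable_weight (w₁ e) e u v) ((intervalIntegrable_weight (w₂ e) e u v).const_mul t)]
  refine intervalIntegral.integral_congr fun y hy => ?_
  rw [Set.uIcc_of_le zero_le_one] at hy
  simp only [h e y hy]
  ring

theorem eventually_perturb_pos [Nonempty E] (p : MetricDensity E) (x : E → ℝ)
    (η : E → Polynomial ℝ) : ∀ᶠ t in 𝓝[>] (0 : ℝ), (∀ e, 0 < p.stiffness e + t * x e) ∧
      ∀ e, ∀ y ∈ Set.Icc (0 : ℝ) 1, 0 < p.length e * p.ρ e y + t * (η e).eval y := by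
  have h1 : ∀ᶠ t in 𝓝[>] (0 : ℝ), ∀ e, 0 < p.stiffness e + t * x e := by
    refine eventually_all.mpr fun e => ?_
    have hc : Continuous fun t : ℝ => p.stiffness e + t * x e := by fun_prop
    have := (hc.tendsto 0).mono_left (nhdsWithin_le_nhds (s := Set.Ioi 0))
    simp only [zero_mul, add_zero] at this
    exact this.eventually_const_lt (p.stiffness_pos e)
  obtain ⟨c, hc, hcm⟩ := exists_lower_bound p.mass_pos
  obtain ⟨C, hC, hCη⟩ := exists_upper_bound fun e => -polyMap (η e)
  have h2 : ∀ᶠ t in 𝓝[>] (0 : ℝ), t < c / C :=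
    (tendsto_id.mono_left nhdsWithin_le_nhds).eventually_lt_const (by positivity)
  filter_upwards [h1, h2, self_mem_nhdsWithin] with t ht1 ht2 ht0
  refine ⟨ht1, fun e y hy => ?_⟩
  rw [← p.mass_apply e hy]
  have h3 := hcm e y hy
  have h4 : -(η e).eval y ≤ C := hCη e y hy
  have h5 : t * C < c := (lt_div_iff₀ hC).mp ht2
  have h6 : 0 < t := ht0
  nlinarith

end H1

end Multigraph

/-! ### First variation of the normalised eigenvalue and the Euler-Lagrange equation. -/

namespace Multigraph

variable {V E : Type*} [Fintype V] [Fintype E] {G : Multigraph V E}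

namespace H1

open Polynomial in
/-- The first variation of the Rayleigh quotient, corrected by that of the normalising factor. -/
noncomputable def variationForm (G : Multigraph V E) (α : ℝ) (p : MetricDensity E) (Λ : ℝ) :
    ((E → ℝ) × (E → ℝ[X])) →ₗ[ℝ] G.H1 →L[ℝ] G.H1 →L[ℝ] ℝ where
  toFun d := stiffnessForm G d.1 + (Λ * logDerivNormFactor α p.stiffness p.edgeMass d.1
    fun e => ∫ y in (0 : ℝ)..1, (d.2 e).eval y) • massForm G p.mass
    - Λ • massForm G fun e => polyMap (d.2 e)
  map_add' d d' := by
    have h1 := stiffnessForm_add_smul (G := G) d.1 d'.1 1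
    have h2 := massForm_congr_add_smul (G := G) (w := fun e => polyMap ((d + d').2 e))
      (w₁ := fun e => polyMap (d.2 e)) (w₂ := fun e => polyMap (d'.2 e)) (t := 1)
      fun e y _ => by simp [polyMap_apply]
    have h3 : stiffnessForm G (d + d').1 = stiffnessForm G fun e => d.1 e + 1 * d'.1 e := by
      congr 1; ext e; simp
    have h4 : logDerivNormFactor α p.stiffness p.edgeMass (d + d').1
        (fun e => ∫ y in (0 : ℝ)..1, ((d + d').2 e).eval y) =
        logDerivNormFactor α p.stiffness p.edgeMass d.1
          (fun e => ∫ y in (0 : ℝ)..1, (d.2 e).eval y) +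
        logDerivNormFactor α p.stiffness p.edgeMass d'.1
          (fun e => ∫ y in (0 : ℝ)..1, (d'.2 e).eval y) := by
      have hi : ∀ e, ∫ y in (0 : ℝ)..1, ((d + d').2 e).eval y =
          (∫ y in (0 : ℝ)..1, (d.2 e).eval y) + ∫ y in (0 : ℝ)..1, (d'.2 e).eval y := fun e => by
        rw [← intervalIntegral.integral_add ((d.2 e).continuous.intervalIntegrable _ _)
          ((d'.2 e).continuous.intervalIntegrable _ _)]
        simp
      simp only [logDerivNormFactor, hi, Prod.fst_add, Pi.add_apply, mul_add,
        Finset.sum_add_distrib, add_div]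
      ring
    rw [h2, h3, h1, h4]
    generalize stiffnessForm G d.1 = A₁, stiffnessForm G d'.1 = A₂,
      massForm G (fun e => polyMap (d.2 e)) = B₁, massForm G (fun e => polyMap (d'.2 e)) = B₂,
      logDerivNormFactor α p.stiffness p.edgeMass d.1 _ = a,
      logDerivNormFactor α p.stiffness p.edgeMass d'.1 _ = b, massForm G p.mass = B
    ext u v
    change A₁ u v + 1 * A₂ u v + Λ * (a + b) * B u v - Λ * (B₁ u v + 1 * B₂ u v) =
      (A₁ u v + Λ * a * B u v - Λ * B₁ u v) + (A₂ u v + Λ * b * B u v - Λ * B₂ u v)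
    ring
  map_smul' c d := by
    have h1 := stiffnessForm_add_smul (G := G) 0 d.1 c
    have h2 := massForm_congr_add_smul (G := G) (w := fun e => polyMap ((c • d).2 e))
      (w₁ := 0) (w₂ := fun e => polyMap (d.2 e)) (t := c)
      fun e y _ => by simp [polyMap_apply]
    have h3 : stiffnessForm G (c • d).1 = stiffnessForm G fun e => (0 : E → ℝ) e + c * d.1 e := by
      congr 1; ext e; simp
    have h4 : logDerivNormFactor α p.stiffness p.edgeMass (c • d).1
        (fun e => ∫ y in (0 : ℝ)..1, ((c • d).2 e).eval y) =
        c * logDerivNormFactor α p.stiffness p.edgeMass d.1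
          (fun e => ∫ y in (0 : ℝ)..1, (d.2 e).eval y) := by
      have hi : ∀ e, ∫ y in (0 : ℝ)..1, ((c • d).2 e).eval y =
          c * ∫ y in (0 : ℝ)..1, (d.2 e).eval y := fun e => by
        rw [← intervalIntegral.integral_const_mul]
        simp
      simp only [logDerivNormFactor, hi, Prod.smul_fst, Pi.smul_apply, smul_eq_mul]
      rw [mul_add, ← mul_div_assoc, ← mul_div_assoc, Finset.mul_sum, Finset.mul_sum]
      congr 2
      · exact Finset.sum_congr rfl fun e _ => by ring
      · exact Finset.sum_congr rfl fun e _ => by ring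
    have h5 : stiffnessForm G 0 = 0 := by
      ext u v; simp [stiffnessForm_apply]
    have h6 : massForm G 0 = 0 := by
      ext u v; simp [massForm_apply]
    rw [h2, h3, h1, h4, h5, h6]
    generalize stiffnessForm G d.1 = A₁, massForm G (fun e => polyMap (d.2 e)) = B₁,
      logDerivNormFactor α p.stiffness p.edgeMass d.1 _ = a, massForm G p.mass = B
    ext u v
    change 0 + c * A₁ u v + Λ * (c * a) * B u v - Λ * (0 + c * B₁ u v) =
      c * (A₁ u v + Λ * a * B u v - Λ * B₁ u v)
    ring

open Polynomial in
theorem variationForm_apply (α : ℝ) (p : MetricDensity E) (Λ : ℝ) (d : (E → ℝ) × (E → ℝ[X]))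
    (u v : G.H1) : variationForm G α p Λ d u v = stiffnessForm G d.1 u v +
      Λ * logDerivNormFactor α p.stiffness p.edgeMass d.1
        (fun e => ∫ y in (0 : ℝ)..1, (d.2 e).eval y) * massForm G p.mass u v -
      Λ * massForm G (fun e => polyMap (d.2 e)) u v := rfl

variable {α : ℝ} {p : MetricDensity E} {e : ℕ → G.H1} {ν : ℕ → ℝ} {k : ℕ}

theorem massForm_perturb (x : E → ℝ) (η : E → Polynomial ℝ) (t : ℝ)
    (h1 : ∀ e, 0 < p.stiffness e + t * x e)
    (h2 : ∀ e, ∀ y ∈ Set.Icc (0 : ℝ) 1, 0 < p.length e * p.ρ e y + t * (η e).eval y) :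
    massForm G (p.perturb x η t h1 h2).mass =
      massForm G p.mass + t • massForm G fun e => polyMap (η e) :=
  massForm_congr_add_smul fun e _ hy => MetricDensity.mass_perturb e hy

theorem stiffnessForm_perturb (x : E → ℝ) (η : E → Polynomial ℝ) (t : ℝ)
    (h1 : ∀ e, 0 < p.stiffness e + t * x e)
    (h2 : ∀ e, ∀ y ∈ Set.Icc (0 : ℝ) 1, 0 < p.length e * p.ρ e y + t * (η e).eval y) :
    stiffnessForm G (p.perturb x η t h1 h2).stiffness =
      stiffnessForm G p.stiffness + t • stiffnessForm G x := by
  rw [← stiffnessForm_add_smul]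
  congr 1
  exact funext fun e => MetricDensity.stiffness_perturb e

variable [Nonempty E]

/-- Along an affine perturbation, the ratio of the normalising factors has a right derivative. -/
theorem tendsto_slope_normFactor (α : ℝ) (p : MetricDensity E) (x N : E → ℝ) (Λ : ℝ) :
    Tendsto (slope (fun t : ℝ => Λ * normFactor α p.stiffness p.edgeMass /
      normFactor α (fun e => p.stiffness e + t * x e) fun e => p.edgeMass e + t * N e) 0)
      (𝓝[>] 0) (𝓝 (-(Λ * logDerivNormFactor α p.stiffness p.edgeMass x N))) := by
  have h0 : 0 < normFactor α p.stiffness p.edgeMass :=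
    normFactor_pos p.stiffness_pos p.edgeMass_pos
  have h1 := hasDerivAt_normFactor (α := α) p.stiffness_pos p.edgeMass_pos x N
  have h2 := (hasDerivAt_const (0 : ℝ) (Λ * normFactor α p.stiffness p.edgeMass)).div h1
    (by simpa using h0.ne')
  have h3 := (hasDerivAt_iff_tendsto_slope.mp h2).mono_left
    (nhdsWithin_mono (0 : ℝ) fun t (ht : 0 < t) => ht.ne')
  refine (tendsto_congr fun t => rfl).mp (h3.trans_eq ?_)
  congr 1
  simp only [zero_mul, add_zero, zero_sub]
  field_simp

/-- With `Φ` the normalising factor along the perturbation, the eigenvalue is compared with `ν k * Φ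
0 / Φ t`. Taking `κ` to be the slope of this function makes `ν k + t * κ t` equal to it, so
`eventually_lt` says directly that the product with `Φ t` has grown. The limit of the slope turns
the hypothesis of that lemma into positivity of `variationForm`. -/
theorem exists_lt_normalisedEigenvalue (hG : G.Connected)
    (h : IsSpectralSequence (stiffnessForm G p.stiffness) (massForm G p.mass) e ν)
    (d : (E → ℝ) × (E → Polynomial ℝ))
    (hd : ∀ w ∈ IsSpectralSequence.eigenspan e ν (ν k), w ≠ 0 → 0 < variationForm G α p (ν k) d w w) :
    ∃ p', G.normalisedEigenvalue k α p < G.normalisedEigenvalue k α p' := by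
  have hP := isCompactPencil hG p.stiffness_pos p.mass_pos
  have hlim := tendsto_slope_normFactor α p d.1 (fun e => ∫ y in (0 : ℝ)..1, (d.2 e).eval y) (ν k)
  have hev := h.eventually_lt hP k (stiffnessForm G d.1) (massForm G fun e => polyMap (d.2 e)) hlim
    fun w hw hw0 => by
      have := hd w hw hw0
      rw [variationForm_apply] at this
      linarith
  obtain ⟨t, ht, ⟨h1, h2⟩, ht0⟩ :=
    (hev.and ((eventually_perturb_pos p d.1 d.2).and self_mem_nhdsWithin)).exists
  set p' := p.perturb d.1 d.2 t h1 h2 with hp'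
  obtain ⟨e', ν', h'⟩ := exists_isSpectralSequence hG p'.stiffness_pos p'.mass_pos
  refine ⟨p', ?_⟩
  rw [normalisedEigenvalue_eq, normalisedEigenvalue_eq, eigenvalue_eq hG h, eigenvalue_eq hG h']
  have hΦ := normFactor_pos (α := α) p'.stiffness_pos p'.edgeMass_pos
  have hΦ0 := normFactor_pos (α := α) p.stiffness_pos p.edgeMass_pos
  rw [hp', massForm_perturb, stiffnessForm_perturb] at h'
  have hlt := ht e' ν' h'
  have hs := sub_smul_slope (fun t : ℝ => ν k * normFactor α p.stiffness p.edgeMass /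
      normFactor α (fun e => p.stiffness e + t * d.1 e) fun e => p.edgeMass e +
        t * ∫ y in (0 : ℝ)..1, (d.2 e).eval y) 0 t
  simp only [zero_mul, add_zero, sub_zero, smul_eq_mul, vsub_eq_sub,
    mul_div_cancel_right₀ _ hΦ0.ne'] at hs
  rw [hs, add_sub_cancel] at hlt
  have e1 : p'.stiffness = fun e => p.stiffness e + t * d.1 e :=
    funext fun e => MetricDensity.stiffness_perturb e
  have e2 : p'.edgeMass = fun e => p.edgeMass e + t * ∫ y in (0 : ℝ)..1, (d.2 e).eval y :=
    funext fun e => MetricDensity.edgeMass_perturb e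
  rw [e1, e2] at hΦ ⊢
  exact (div_lt_iff₀ hΦ).mp hlt

theorem exists_normalisedEigenvalue_lt (hG : G.Connected)
    (h : IsSpectralSequence (stiffnessForm G p.stiffness) (massForm G p.mass) e ν)
    (d : (E → ℝ) × (E → Polynomial ℝ))
    (hd : ∀ w ∈ IsSpectralSequence.eigenspan e ν (ν k), w ≠ 0 → variationForm G α p (ν k) d w w < 0) :
    ∃ p', G.normalisedEigenvalue k α p' < G.normalisedEigenvalue k α p := by
  have hP := isCompactPencil hG p.stiffness_pos p.mass_pos
  have hlim := tendsto_slope_normFactor α p d.1 (fun e => ∫ y in (0 : ℝ)..1, (d.2 e).eval y) (ν k)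
  have hev := h.eventually_gt hP k (stiffnessForm G d.1) (massForm G fun e => polyMap (d.2 e)) hlim
    fun w hw hw0 => by
      have := hd w hw hw0
      rw [variationForm_apply] at this
      linarith
  obtain ⟨t, ht, ⟨h1, h2⟩, ht0⟩ :=
    (hev.and ((eventually_perturb_pos p d.1 d.2).and self_mem_nhdsWithin)).exists
  set p' := p.perturb d.1 d.2 t h1 h2 with hp'
  have hP' := isCompactPencil hG p'.stiffness_pos p'.mass_pos
  obtain ⟨e', ν', h'⟩ := exists_isSpectralSequence hG p'.stiffness_pos p'.mass_pos
  refine ⟨p', ?_⟩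
  rw [normalisedEigenvalue_eq, normalisedEigenvalue_eq, eigenvalue_eq hG h, eigenvalue_eq hG h']
  have hΦ := normFactor_pos (α := α) p'.stiffness_pos p'.edgeMass_pos
  have hΦ0 := normFactor_pos (α := α) p.stiffness_pos p.edgeMass_pos
  rw [hp', massForm_perturb, stiffnessForm_perturb] at h' hP'
  have hlt := ht e' ν' h' hP'
  have hs := sub_smul_slope (fun t : ℝ => ν k * normFactor α p.stiffness p.edgeMass /
      normFactor α (fun e => p.stiffness e + t * d.1 e) fun e => p.edgeMass e +
        t * ∫ y in (0 : ℝ)..1, (d.2 e).eval y) 0 t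
  simp only [zero_mul, add_zero, sub_zero, smul_eq_mul, vsub_eq_sub,
    mul_div_cancel_right₀ _ hΦ0.ne'] at hs
  rw [hs, add_sub_cancel] at hlt
  have e1 : p'.stiffness = fun e => p.stiffness e + t * d.1 e :=
    funext fun e => MetricDensity.stiffness_perturb e
  have e2 : p'.edgeMass = fun e => p.edgeMass e + t * ∫ y in (0 : ℝ)..1, (d.2 e).eval y :=
    funext fun e => MetricDensity.edgeMass_perturb e
  rw [e1, e2] at hΦ ⊢
  exact (lt_div_iff₀ hΦ).mp hlt

/-- At an extremum of the normalised eigenvalue some eigenfunctions solve the Euler-Lagrange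
equation. -/
theorem exists_sum_variationForm_eq_zero (hG : G.Connected)
    (h : IsSpectralSequence (stiffnessForm G p.stiffness) (massForm G p.mass) e ν)
    (hp : IsMaxOn (G.normalisedEigenvalue k α) Set.univ p ∨
      IsMinOn (G.normalisedEigenvalue k α) Set.univ p) :
    ∃ (ι : Type) (_ : Fintype ι) (u : ι → G.H1),
      (∀ i, IsPencilEigenvector (stiffnessForm G p.stiffness) (massForm G p.mass) (ν k) (u i)) ∧
      (∃ i, u i ≠ 0) ∧ ∀ d, ∑ i, variationForm G α p (ν k) d (u i) (u i) = 0 := by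
  have := h.finiteDimensional_eigenspan (ν k)
  obtain ⟨ι, hι, u, hu, hne, hsum⟩ := exists_sum_eq_zero_of_forall_not_pos
    (variationForm G α p (ν k)) (IsSpectralSequence.eigenspan e ν (ν k)) (fun d hd => by
      rcases hp with hp | hp
      · obtain ⟨p', hp'⟩ := exists_lt_normalisedEigenvalue hG h d hd
        exact hp'.not_ge (hp (Set.mem_univ p'))
      -- At a minimum the opposite direction is used: its variation is negative definite.
      · obtain ⟨p', hp'⟩ := exists_normalisedEigenvalue_lt (α := α) hG h (-d) fun w hw hw0 => by
          rw [map_neg]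
          exact neg_neg_of_pos (hd w hw hw0)
        exact hp'.not_ge (hp (Set.mem_univ p')))
  exact ⟨ι, hι, u, fun i => h.isPencilEigenvector_of_mem (hu i), hne, hsum⟩

end H1

end Multigraph

/-! ### Consequences of the Euler-Lagrange equation. -/

/-- A continuous function orthogonal to all polynomials on the unit interval vanishes there. -/
theorem eq_zero_of_integral_polynomial_mul_eq_zero {φ : ℝ → ℝ} (hφ : Continuous φ)
    (h : ∀ q : Polynomial ℝ, ∫ x in (0 : ℝ)..1, q.eval x * φ x = 0) :
    ∀ x ∈ Set.Icc (0 : ℝ) 1, φ x = 0 := by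
  by_contra! hx
  obtain ⟨x, hx, hne⟩ := hx
  have hI : 0 < ∫ x in (0 : ℝ)..1, φ x * φ x :=
    intervalIntegral.integral_pos zero_lt_one (hφ.mul hφ).continuousOn
      (fun y _ => mul_self_nonneg _) ⟨x, hx, mul_self_pos.mpr hne⟩
  set I := ∫ x in (0 : ℝ)..1, φ x * φ x
  have hK : 0 ≤ ∫ x in (0 : ℝ)..1, |φ x| :=
    intervalIntegral.integral_nonneg zero_le_one fun y _ => abs_nonneg _
  set K := ∫ x in (0 : ℝ)..1, |φ x| with hKdef
  -- This accuracy yields `I ≤ I * K / (K + 1)`, impossible for `I > 0`; the added one avoids a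
  -- division by zero.
  obtain ⟨q, hq⟩ := exists_polynomial_near_of_continuousOn 0 1 φ hφ.continuousOn (I / (K + 1))
    (by positivity)
  have hqc := q.continuous
  have h1 : I = ∫ x in (0 : ℝ)..1, (φ x * φ x - q.eval x * φ x) := by
    have hi : IntervalIntegrable (fun x => φ x * φ x) volume 0 1 :=
      (hφ.mul hφ).intervalIntegrable _ _
    have hj : IntervalIntegrable (fun x => q.eval x * φ x) volume 0 1 :=
      (hqc.mul hφ).intervalIntegrable _ _
    rw [intervalIntegral.integral_sub hi hj, h, sub_zero]
  have h2 : I ≤ ∫ x in (0 : ℝ)..1, I / (K + 1) * |φ x| := by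
    rw [h1]
    refine intervalIntegral.integral_mono_on zero_le_one
      (((hφ.mul hφ).sub (hqc.mul hφ)).intervalIntegrable _ _)
      ((continuous_const.mul hφ.abs).intervalIntegrable _ _) fun y hy => ?_
    rw [← h1, ← sub_mul]
    refine (le_abs_self _).trans ?_
    rw [abs_mul, abs_sub_comm]
    exact mul_le_mul_of_nonneg_right (hq y hy).le (abs_nonneg _)
  rw [intervalIntegral.integral_const_mul, ← hKdef, div_mul_eq_mul_div,
    le_div_iff₀ (by positivity)] at h2
  linarith

namespace Multigraph

variable {V E : Type*} [Fintype V] [Fintype E] {G : Multigraph V E}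

namespace H1

variable {α Λ : ℝ} {p : MetricDensity E} {ι : Type} [Fintype ι] {u : ι → G.H1}

theorem continuous_sum_sq_eval (u : ι → G.H1) (e : E) :
    Continuous fun x => ∑ i, eval e x (u i) ^ 2 :=
  continuous_finsetSum _ fun i _ => (continuous_eval e (u i)).pow 2

/-- Variations of the density: the sum of the squares is constant on each edge. -/
theorem sum_sq_eval_eq (hΛ : Λ ≠ 0)
    (hsum : ∀ d, ∑ i, variationForm G α p Λ d (u i) (u i) = 0) (e : E) :
    ∀ x ∈ Set.Icc (0 : ℝ) 1, ∑ i, eval e x (u i) ^ 2 =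
      (∑ i, massForm G p.mass (u i) (u i)) * p.stiffness e ^ (1 - 2 * α) /
        ∑ e, p.stiffness e ^ (1 - 2 * α) * p.edgeMass e := by
  classical
  set 𝓑 := ∑ i, massForm G p.mass (u i) (u i) with h𝓑
  set S := ∑ e, p.stiffness e ^ (1 - 2 * α) * p.edgeMass e with hS
  set c := 𝓑 * p.stiffness e ^ (1 - 2 * α) / S with hc
  have hQ := continuous_sum_sq_eval u e
  have key := eq_zero_of_integral_polynomial_mul_eq_zero
    (hQ.sub (continuous_const (y := c))) fun q => by
    -- Only the density on `e` varies, in an arbitrary polynomial direction.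
    have h1 := hsum (0, Pi.single e q)
    have hN : ∀ e', ∫ y in (0 : ℝ)..1, ((Pi.single e q : E → Polynomial ℝ) e').eval y =
        (Pi.single e (∫ y in (0 : ℝ)..1, q.eval y) : E → ℝ) e' := fun e' => by
      rcases eq_or_ne e' e with rfl | hne
      · simp
      · simp [Pi.single_eq_of_ne hne]
    have hmass : ∀ i, massForm G (fun e' => polyMap ((Pi.single e q : E → Polynomial ℝ) e'))
        (u i) (u i) = ∫ y in (0 : ℝ)..1, q.eval y * eval e y (u i) ^ 2 := fun i => by
      rw [massForm_self, Finset.sum_eq_single e]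
      · simp [polyMap_apply]
      · intro e' _ hne
        simp [Pi.single_eq_of_ne hne]
      · simp
    have hlog : logDerivNormFactor α p.stiffness p.edgeMass 0
        (fun e' => ∫ y in (0 : ℝ)..1, ((Pi.single e q : E → Polynomial ℝ) e').eval y) =
        p.stiffness e ^ (1 - 2 * α) * (∫ y in (0 : ℝ)..1, q.eval y) / S := by
      simp only [logDerivNormFactor, hN]
      simp [Pi.single_apply, hS]
    have hst : ∀ i, stiffnessForm G 0 (u i) (u i) = 0 := fun i => by simp [stiffnessForm_apply]
    simp only [variationForm_apply, hlog, hmass, hst, zero_add, Finset.sum_sub_distrib,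
      ← Finset.mul_sum] at h1
    rw [← h𝓑, mul_assoc, ← mul_sub, mul_eq_zero, or_iff_right hΛ] at h1
    have h2 : ∫ y in (0 : ℝ)..1, q.eval y * (∑ i, eval e y (u i) ^ 2 - c) =
        (∑ i, ∫ y in (0 : ℝ)..1, q.eval y * eval e y (u i) ^ 2) -
          (∫ y in (0 : ℝ)..1, q.eval y) * c := by
      have hi : ∀ i ∈ Finset.univ, IntervalIntegrable
          (fun y => q.eval y * eval e y (u i) ^ 2) volume 0 1 := fun i _ =>
        (q.continuous.mul ((continuous_eval e (u i)).pow 2)).intervalIntegrable _ _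
      rw [← intervalIntegral.integral_finsetSum hi, ← intervalIntegral.integral_mul_const,
        ← intervalIntegral.integral_sub]
      · simp only [mul_sub, Finset.mul_sum]
      · exact (continuous_finsetSum _ fun i _ =>
          q.continuous.mul ((continuous_eval e (u i)).pow 2)).intervalIntegrable _ _
      · exact (q.continuous.mul continuous_const).intervalIntegrable _ _
    refine h2.trans ?_
    rw [hc]
    linear_combination -h1
  exact fun x hx => sub_eq_zero.mp (key x hx)

/-- The sum of squares takes the same value at both ends of each edge and is single-valued at
vertices, so by connectedness its edge constants all agree. -/
theorem rpow_stiffness_eq [Nonempty E] (hG : G.Connected) (hΛ : Λ ≠ 0)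
    (hB : 0 < ∑ i, massForm G p.mass (u i) (u i))
    (hsum : ∀ d, ∑ i, variationForm G α p Λ d (u i) (u i) = 0) (e e' : E) :
    p.stiffness e ^ (1 - 2 * α) = p.stiffness e' ^ (1 - 2 * α) := by
  have h0 : ∀ e, ∑ i, vertex (G.src e) (u i) ^ 2 = (∑ i, massForm G p.mass (u i) (u i)) *
      p.stiffness e ^ (1 - 2 * α) / ∑ e, p.stiffness e ^ (1 - 2 * α) * p.edgeMass e := fun e => by
    simpa only [eval_zero] using sum_sq_eval_eq hΛ hsum e 0 ⟨le_rfl, zero_le_one⟩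
  have h1 : ∀ e, ∑ i, vertex (G.tgt e) (u i) ^ 2 = (∑ i, massForm G p.mass (u i) (u i)) *
      p.stiffness e ^ (1 - 2 * α) / ∑ e, p.stiffness e ^ (1 - 2 * α) * p.edgeMass e := fun e => by
    simpa only [eval_one] using sum_sq_eval_eq hΛ hsum e 1 ⟨zero_le_one, le_rfl⟩
  have h2 := hG.eq_of_forall_edge (c := fun v => ∑ i, vertex v (u i) ^ 2)
    (fun e => (h1 e).trans (h0 e).symm) (G.src e) (G.src e')
  simp only [h0] at h2
  have hS := (sum_rpow_mul_pos p.stiffness_pos p.edgeMass_pos (1 - 2 * α)).ne'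
  rw [div_left_inj' hS] at h2
  exact mul_left_cancel₀ hB.ne' h2

/-- If the sum of the squares of eigenvectors is constant on an edge, then the mass density is
constant there. -/
theorem mass_eq_of_sum_sq_eval_eq {s : E → ℝ} {w : E → C(ℝ, ℝ)} (hs : ∀ e, 0 < s e)
    (hΛ : Λ ≠ 0) (hu : ∀ i, IsPencilEigenvector (stiffnessForm G s) (massForm G w) Λ (u i))
    {e : E} {c : ℝ} (hc : c ≠ 0)
    (hQ : ∀ x ∈ Set.Icc (0 : ℝ) 1, ∑ i, eval e x (u i) ^ 2 = c) :
    (∀ x ∈ Set.Icc (0 : ℝ) 1, w e x = w e 0) ∧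
      s e * ∑ i, ‖grad e (u i)‖ ^ 2 = Λ * c * w e 0 := by
  have huniq : UniqueDiffOn ℝ (Set.Icc (0 : ℝ) 1) := uniqueDiffOn_Icc zero_lt_one
  choose P hPd hPu using fun i => exists_flux (hu i) e
  have hsne := (hs e).ne'
  have hev : ∀ i, ∀ x ∈ Set.Icc (0 : ℝ) 1,
      HasDerivWithinAt (fun x => eval e x (u i)) (P i x / s e) (Set.Icc 0 1) x :=
    fun i x hx => hasDerivWithinAt_eval (hs e) (hPu i) hx
  have hPw : ∀ i x, HasDerivWithinAt (P i) (-(Λ * (w e x * eval e x (u i)))) (Set.Icc 0 1) x :=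
    fun i x => (hPd i x).hasDerivWithinAt
  have hconst : ∀ {f : ℝ → ℝ} {f' a x : ℝ}, (∀ y ∈ Set.Icc (0 : ℝ) 1, f y = a) →
      x ∈ Set.Icc (0 : ℝ) 1 → HasDerivWithinAt f f' (Set.Icc 0 1) x → f' = 0 :=
    fun {f f' a x} hf hx hd => by
      have h0 : HasDerivWithinAt f 0 (Set.Icc 0 1) x :=
        (hasDerivWithinAt_const x _ a).congr hf (hf x hx)
      exact (huniq x hx).eq_deriv _ hd h0
  have hR : ∀ x ∈ Set.Icc (0 : ℝ) 1, ∑ i, eval e x (u i) * P i x = 0 := fun x hx => by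
    have h1 := hconst hQ hx (HasDerivWithinAt.fun_sum fun i _ => (hev i x hx).pow 2)
    have h2 : ∑ i, ((2 : ℕ) : ℝ) * eval e x (u i) ^ (2 - 1) * (P i x / s e) =
        2 / s e * ∑ i, eval e x (u i) * P i x := by
      rw [Finset.mul_sum]
      exact Finset.sum_congr rfl fun i _ => by push_cast; ring
    rw [h2] at h1
    exact (mul_eq_zero.mp h1).resolve_left (by positivity)
  -- The derivative of `∑ u i * P i = 0` combines the squared fluxes with the eigenvalue equation,
  -- expressing `w e` through `∑ P i ^ 2`.
  have hT : ∀ x ∈ Set.Icc (0 : ℝ) 1, ∑ i, P i x ^ 2 = s e * Λ * c * w e x := fun x hx => by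
    have h1 := hconst hR hx (HasDerivWithinAt.fun_sum fun i _ => (hev i x hx).mul (hPw i x))
    have h2 : ∑ i, (P i x / s e * P i x + eval e x (u i) * -(Λ * (w e x * eval e x (u i)))) =
        (∑ i, P i x ^ 2) / s e - Λ * w e x * ∑ i, eval e x (u i) ^ 2 := by
      rw [Finset.mul_sum, Finset.sum_div, ← Finset.sum_sub_distrib]
      exact Finset.sum_congr rfl fun i _ => by ring
    rw [h2, hQ x hx] at h1
    field_simp at h1
    linear_combination h1
  -- By the equation the derivative of `∑ P i ^ 2` is a multiple of `∑ u i * P i`, which vanishes.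
  have hTd : ∀ x ∈ Set.Icc (0 : ℝ) 1,
      HasDerivWithinAt (fun x => ∑ i, P i x ^ 2) 0 (Set.Icc 0 1) x := fun x hx => by
    refine (HasDerivWithinAt.fun_sum fun i _ => (hPw i x).pow 2).congr_deriv ?_
    have h2 : ∑ i, ((2 : ℕ) : ℝ) * P i x ^ (2 - 1) * -(Λ * (w e x * eval e x (u i))) =
        -(2 * Λ * w e x) * ∑ i, eval e x (u i) * P i x := by
      rw [Finset.mul_sum]
      exact Finset.sum_congr rfl fun i _ => by push_cast; ring
    rw [h2, hR x hx, mul_zero]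
  have hT0 := constant_of_derivWithin_zero (fun x hx => (hTd x hx).differentiableWithinAt)
    fun x hx => (hTd x (Set.Ico_subset_Icc_self hx)).derivWithin
      (huniq x (Set.Ico_subset_Icc_self hx))
  have hw : ∀ x ∈ Set.Icc (0 : ℝ) 1, w e x = w e 0 := fun x hx => by
    have h1 := hT0 x hx
    rw [hT x hx, hT 0 ⟨le_rfl, zero_le_one⟩] at h1
    exact mul_left_cancel₀ (mul_ne_zero (mul_ne_zero hsne hΛ) hc) h1
  refine ⟨hw, ?_⟩
  have hn : ∀ i, s e ^ 2 * ‖grad e (u i)‖ ^ 2 = ∫ x in (0 : ℝ)..1, P i x ^ 2 := fun i => by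
    rw [← mul_pow, ← abs_of_pos (hs e), ← Real.norm_eq_abs, ← norm_smul, ← hPu i,
      ← real_inner_self_eq_norm_sq, UnitL2.inner_ofContinuous_ofContinuous]
    simp only [sq]
  have h3 : s e ^ 2 * ∑ i, ‖grad e (u i)‖ ^ 2 = s e * Λ * c * w e 0 := by
    have hi : ∀ i ∈ Finset.univ, IntervalIntegrable (fun x => P i x ^ 2) volume 0 1 := fun i _ =>
      ((P i).continuous.pow 2).intervalIntegrable _ _
    rw [Finset.mul_sum, Finset.sum_congr rfl fun i _ => hn i,
      ← intervalIntegral.integral_finsetSum hi,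
      intervalIntegral.integral_congr (g := fun _ => s e * Λ * c * w e 0) fun x hx => ?_]
    · simp
    · rw [Set.uIcc_of_le zero_le_one] at hx
      simp only [hT x hx, hw x hx]
  refine mul_left_cancel₀ hsne ?_
  linear_combination h3

/-- Variations of the length of an edge. -/
theorem sum_sq_norm_grad_eq (hsum : ∀ d, ∑ i, variationForm G α p Λ d (u i) (u i) = 0) (e : E) :
    ∑ i, ‖grad e (u i)‖ ^ 2 = -(Λ * ((2 * α - 2) * p.stiffness e ^ (2 * α - 3) /
      (∑ e, p.stiffness e ^ (2 * α - 2)) + (1 - 2 * α) * p.stiffness e ^ (-(2 * α)) *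
        p.edgeMass e / ∑ e, p.stiffness e ^ (1 - 2 * α) * p.edgeMass e)) *
      ∑ i, massForm G p.mass (u i) (u i) := by
  classical
  have h1 := hsum (Pi.single e 1, 0)
  have hst : ∀ i, stiffnessForm G (Pi.single e 1) (u i) (u i) = ‖grad e (u i)‖ ^ 2 := fun i => by
    rw [stiffnessForm_self, Finset.sum_eq_single e]
    · simp
    · intro e' _ hne
      simp [Pi.single_eq_of_ne hne]
    · simp
  have hm : ∀ i, massForm G (fun e => polyMap ((0 : E → Polynomial ℝ) e)) (u i) (u i) = 0 :=
    fun i => by simp [massForm_apply]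
  simp only [variationForm_apply, hst, hm, mul_zero, sub_zero, Finset.sum_add_distrib,
    ← Finset.mul_sum] at h1
  simp [logDerivNormFactor, Pi.single_apply] at h1
  linear_combination h1

end H1

end Multigraph

/-! ### Scaling, the eigenvalue zero and the conclusion. -/

theorem IsSpectralSequence.smul {X : Type*} [NormedAddCommGroup X] [NormedSpace ℝ X]
    {A B A' B' : X →L[ℝ] X →L[ℝ] ℝ} {e : ℕ → X} {ν : ℕ → ℝ} (h : IsSpectralSequence A B e ν)
    {s m : ℝ} (hs : 0 < s) (hm : 0 < m) (hA : ∀ u v, A' u v = s * A u v)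
    (hB : ∀ u v, B' u v = m * B u v) :
    IsSpectralSequence A' B' (fun n => (Real.sqrt m)⁻¹ • e n) (fun n => s / m * ν n) where
  eigen n v := by
    rw [hA, hB, map_smul, map_smul]
    change s * ((Real.sqrt m)⁻¹ * A (e n) v) = s / m * ν n * (m * ((Real.sqrt m)⁻¹ * B (e n) v))
    rw [h.eigen n v]
    field_simp
  ortho i j := by
    rw [hB, map_smul, map_smul]
    change m * ((Real.sqrt m)⁻¹ * ((Real.sqrt m)⁻¹ * B (e i) (e j))) = _
    have h1 : m * ((Real.sqrt m)⁻¹ * (Real.sqrt m)⁻¹) = 1 := by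
      rw [← mul_inv, Real.mul_self_sqrt hm.le, mul_inv_cancel₀ hm.ne']
    rw [← mul_assoc (Real.sqrt m)⁻¹, ← mul_assoc m, h1, one_mul, h.ortho]
  mono i j hij := mul_le_mul_of_nonneg_left (h.mono hij) (div_pos hs hm).le
  unbounded C := by
    obtain ⟨n, hn⟩ := h.unbounded (C / (s / m))
    exact ⟨n, by rwa [div_lt_iff₀' (div_pos hs hm)] at hn⟩
  min n z hz := by
    have hz' : ∀ i < n, B (e i) z = 0 := fun i hi => by
      have h1 := hz i hi
      rw [hB, map_smul] at h1
      change m * ((Real.sqrt m)⁻¹ * B (e i) z) = 0 at h1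
      have h2 : (Real.sqrt m)⁻¹ ≠ 0 := (inv_pos.mpr (Real.sqrt_pos.mpr hm)).ne'
      exact (mul_eq_zero.mp ((mul_eq_zero.mp h1).resolve_left hm.ne')).resolve_left h2
    have h3 := mul_le_mul_of_nonneg_left (h.min n z hz') hs.le
    rw [hA, hB]
    calc s / m * ν n * (m * B z z) = s * (ν n * B z z) := by field_simp
      _ ≤ s * A z z := h3

namespace Multigraph

variable {V E : Type*} [Fintype V] [Fintype E] {G : Multigraph V E}

namespace H1

theorem grad_eq_zero {s : E → ℝ} (hs : ∀ e, 0 < s e) {u : G.H1}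
    (hu : stiffnessForm G s u u = 0) (e : E) : grad e u = 0 := by
  rw [stiffnessForm_self, Finset.sum_eq_zero_iff_of_nonneg
    fun e _ => mul_nonneg (hs e).le (sq_nonneg _)] at hu
  simpa [(hs e).ne'] using hu e (Finset.mem_univ e)

theorem vertex_eq_of_grad_eq_zero (hG : G.Connected) {u : G.H1} (hu : ∀ e, grad e u = 0)
    (v v' : V) : vertex v u = vertex v' u :=
  hG.eq_of_forall_edge (c := fun v => vertex v u)
    (fun e => by rw [← eval_one, eval_apply, hu e, map_zero, add_zero]) v v'

variable [Nonempty E] {s : E → ℝ} {w : E → C(ℝ, ℝ)} {e : ℕ → G.H1} {ν : ℕ → ℝ}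

/-- Otherwise `e 0` and `e 1` would have zero energy, hence be constant on the connected graph and
proportional, contradicting orthonormality. -/
theorem eigenvalue_pos (hG : G.Connected) (hs : ∀ e, 0 < s e)
    (hw : ∀ e, ∀ x ∈ Set.Icc (0 : ℝ) 1, 0 < w e x)
    (h : IsSpectralSequence (stiffnessForm G s) (massForm G w) e ν) {k : ℕ} (hk : 1 ≤ k) :
    0 < ν k := by
  have hP := isCompactPencil hG hs hw
  by_contra! hle
  have hgrad : ∀ n ≤ k, ∀ e', grad e' (e n) = 0 := fun n hn => by
    have h0 : ν n = 0 := le_antisymm ((h.mono hn).trans hle) (h.nonneg hP n)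
    exact grad_eq_zero hs (by rw [h.eigen n, h0, zero_mul])
  obtain ⟨v⟩ := hG.nonempty
  have heq : vertex v (e 1) • e 0 = vertex v (e 0) • e 1 := by
    refine ext_iff_vertex_grad.mpr ⟨fun x => ?_, fun e' => ?_⟩
    · rw [map_smul, map_smul, vertex_eq_of_grad_eq_zero hG (hgrad 0 (Nat.zero_le k)) x v,
        vertex_eq_of_grad_eq_zero hG (hgrad 1 hk) x v, smul_eq_mul, smul_eq_mul, mul_comm]
    · rw [map_smul, map_smul, hgrad 0 (Nat.zero_le k), hgrad 1 hk, smul_zero, smul_zero]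
  have h1 := congrArg (massForm G w (e 1)) heq
  rw [map_smul, map_smul, h.ortho, h.ortho] at h1
  simp only [one_ne_zero, if_false, if_true, smul_eq_mul, mul_zero, mul_one] at h1
  have h2 : e 0 = 0 := by
    refine ext_iff_vertex_grad.mpr ⟨fun x => ?_, fun e' => ?_⟩
    · rw [vertex_eq_of_grad_eq_zero hG (hgrad 0 (Nat.zero_le k)) x v, ← h1, map_zero]
    · rw [hgrad 0 (Nat.zero_le k), map_zero]
  have h3 := h.ortho 0 0
  rw [h2, map_zero, if_pos rfl] at h3
  exact zero_ne_one h3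

theorem eigenvalue_zero_eq (hG : G.Connected) (hs : ∀ e, 0 < s e)
    (hw : ∀ e, ∀ x ∈ Set.Icc (0 : ℝ) 1, 0 < w e x)
    (h : IsSpectralSequence (stiffnessForm G s) (massForm G w) e ν) : ν 0 = 0 := by
  have hP := isCompactPencil hG hs hw
  set u : G.H1 := ofPair (fun _ => 1) (fun _ => 0) fun e => by simp with hu
  obtain ⟨v⟩ := hG.nonempty
  have hu0 : u ≠ 0 := fun h0 => by
    have h1 : vertex v u = 1 := vertex_ofPair _ _ _ v
    rw [h0, map_zero] at h1
    exact zero_ne_one h1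
  have hA : stiffnessForm G s u u = 0 := by
    rw [stiffnessForm_self]
    refine Finset.sum_eq_zero fun e _ => ?_
    rw [hu, grad_ofPair]
    simp
  have h1 := h.min 0 u fun i hi => absurd hi (Nat.not_lt_zero i)
  rw [hA] at h1
  exact le_antisymm (nonpos_of_mul_nonpos_left h1 (massForm_pos hG hw hu0)) (h.nonneg hP 0)

end H1

variable [Nonempty E]

open H1

theorem isRegular_and_hasConstantDensity (hG : G.Connected) {α : ℝ} (hα : α ≠ 1 / 2)
    (hα' : α ≠ 1) {k : ℕ} (hk : 1 ≤ k) {p : MetricDensity E}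
    (hp : IsMaxOn (G.normalisedEigenvalue k α) Set.univ p ∨
      IsMinOn (G.normalisedEigenvalue k α) Set.univ p) :
    p.IsRegular ∧ p.HasConstantDensity := by
  obtain ⟨e, ν, h⟩ := exists_isSpectralSequence hG p.stiffness_pos p.mass_pos
  obtain ⟨ι, _, u, hu, ⟨i₀, hi₀⟩, hsum⟩ := exists_sum_variationForm_eq_zero hG h hp
  have hΛ : 0 < ν k := eigenvalue_pos hG p.stiffness_pos p.mass_pos h hk
  set Λ := ν k
  have hB : 0 < ∑ i, massForm G p.mass (u i) (u i) := by
    refine Finset.sum_pos' (fun i _ => ?_)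
      ⟨i₀, Finset.mem_univ _, massForm_pos hG p.mass_pos hi₀⟩
    rw [massForm_self]
    exact Finset.sum_nonneg fun e _ => integral_sq_nonneg p.mass_pos (u i) e
  -- Here `α ≠ 1/2` enters: the exponent `1 - 2α` is not zero.
  have hs : ∀ e e', p.stiffness e = p.stiffness e' := fun e e' =>
    Real.rpow_left_injOn (x := 1 - 2 * α) (fun h0 => hα (by linarith)) (p.stiffness_pos e).le
      (p.stiffness_pos e').le (rpow_stiffness_eq hG hΛ.ne' hB hsum e e')
  refine ⟨fun e e' => inv_injective (hs e e'), ?_⟩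
  obtain ⟨e₀⟩ := ‹Nonempty E›
  have : Nonempty E := ⟨e₀⟩
  obtain ⟨s, hs0, hse⟩ : ∃ s, 0 < s ∧ ∀ e, p.stiffness e = s :=
    ⟨_, p.stiffness_pos e₀, fun e => hs e e₀⟩
  have hM : 0 < ∑ e, p.edgeMass e :=
    Finset.sum_pos (fun e _ => p.edgeMass_pos e) Finset.univ_nonempty
  have hN : (0 : ℝ) < Fintype.card E := by exact_mod_cast Fintype.card_pos
  have key : ∀ e, ∀ x ∈ Set.Icc (0 : ℝ) 1,
      p.mass e x = (∑ e, p.edgeMass e) / Fintype.card E := fun e => by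
    have hQ := sum_sq_eval_eq hΛ.ne' hsum e
    have h1 := sum_sq_norm_grad_eq hsum e
    simp only [hse, ← Finset.mul_sum, Finset.sum_const, Finset.card_univ, nsmul_eq_mul] at hQ h1
    have hpow : ∀ a, s ^ (a : ℝ) ≠ 0 := fun a => (Real.rpow_pos_of_pos hs0 a).ne'
    have e1 : s ^ (2 * α - 2) = s ^ (2 * α - 3) * s := by
      rw [← Real.rpow_add_one hs0.ne']; congr 1; ring
    have e2 : s ^ (1 - 2 * α) = s ^ (-(2 * α)) * s := by
      rw [← Real.rpow_add_one hs0.ne']; congr 1; ring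
    rw [mul_comm (s ^ (1 - 2 * α)), mul_div_mul_right _ _ (hpow _)] at hQ
    obtain ⟨hw, hg⟩ := mass_eq_of_sum_sq_eval_eq p.stiffness_pos hΛ.ne' hu (div_pos hB hM).ne' hQ
    have hMe : p.edgeMass e = p.mass e 0 := by
      rw [MetricDensity.edgeMass,
        intervalIntegral.integral_congr (g := fun _ => p.mass e 0) fun x hx => ?_]
      · simp
      · rw [Set.uIcc_of_le zero_le_one] at hx
        exact hw x hx
    intro x hx
    rw [hw x hx, eq_div_iff hN.ne']
    -- Two expressions for the energy on an edge are equated: one from constancy of the sum of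
    -- squares, the other from length variations.
    rw [h1, hse, hMe, e1, e2] at hg
    generalize (∑ e, p.edgeMass e) = S at hM hg ⊢
    generalize (∑ i, massForm G p.mass (u i) (u i)) = B at hB hg
    generalize (Fintype.card E : ℝ) = N at hN hg ⊢
    have h3 := hpow (2 * α - 3)
    have h4 := hpow (-(2 * α))
    generalize s ^ (2 * α - 3) = a at h3 hg
    generalize s ^ (-(2 * α)) = b at h4 hg
    have h5 : s * (-(Λ * ((2 * α - 2) * a / (N * (a * s)) +
        (1 - 2 * α) * b * p.mass e 0 / (b * s * S))) * B) =
        -(Λ * B * ((2 * α - 2) / N + (1 - 2 * α) * p.mass e 0 / S)) := by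
      have h6 : (2 * α - 2) * a / (N * (a * s)) = (2 * α - 2) / N / s := by field_simp
      have h7 : (1 - 2 * α) * b * p.mass e 0 / (b * s * S) =
          (1 - 2 * α) * p.mass e 0 / S / s := by field_simp
      rw [h6, h7]
      field_simp
    rw [h5] at hg
    have h8 : -((2 * α - 2) / N + (1 - 2 * α) * p.mass e 0 / S) = p.mass e 0 / S :=
      mul_left_cancel₀ (mul_pos hΛ hB).ne' (by linear_combination hg)
    have h9 : -((2 * α - 2) * S + N * ((1 - 2 * α) * p.mass e 0)) = p.mass e 0 * N := by
      rw [div_add_div _ _ hN.ne' hM.ne', ← neg_div, div_eq_div_iff (by positivity) hM.ne'] at h8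
      exact mul_right_cancel₀ hM.ne' (h8.trans (by ring))
    -- Here `α ≠ 1` enters: the comparison is `α - 1` times the desired identity.
    exact mul_left_cancel₀ (sub_ne_zero.mpr hα') (by linear_combination 1 / 2 * h9)
  refine ⟨s * ((∑ e, p.edgeMass e) / Fintype.card E), fun e x hx => ?_⟩
  rw [← key e x hx, p.mass_apply e hx, ← hse e, MetricDensity.stiffness,
    inv_mul_cancel_left₀ (p.length_pos e).ne']

/-- Such a pair rescales the forms of the unit graph by `s` and `m`, so the eigenvalues by `s / m`.
The normalising factor compensates exactly, since `s ^ (2α - 2) * s ^ (1 - 2α) * s = 1`, and the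
value does not depend on the pair or on `α`. -/
theorem normalisedEigenvalue_eq_of_isRegular (hG : G.Connected) {e : ℕ → G.H1} {ν : ℕ → ℝ}
    (h : IsSpectralSequence (stiffnessForm G fun _ => 1) (massForm G fun _ => 1) e ν)
    {p : MetricDensity E} (h1 : p.IsRegular) (h2 : p.HasConstantDensity) (k : ℕ) (α : ℝ) :
    G.normalisedEigenvalue k α p = (Fintype.card E : ℝ) ^ 2 * ν k := by
  obtain ⟨c, hc⟩ := h2
  obtain ⟨e₀⟩ := ‹Nonempty E›
  have : Nonempty E := ⟨e₀⟩
  obtain ⟨s, hs0, hse⟩ : ∃ s, 0 < s ∧ ∀ e, p.stiffness e = s :=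
    ⟨_, p.stiffness_pos e₀, fun e => congrArg (·⁻¹) (h1 e e₀)⟩
  have hmass : ∀ e, ∀ x ∈ Set.Icc (0 : ℝ) 1, p.mass e x = c / s := fun e x hx => by
    rw [p.mass_apply e hx, hc e x hx, ← hse e, MetricDensity.stiffness, div_inv_eq_mul, mul_comm]
  have hm0 : 0 < c / s := by
    rw [← hmass e₀ 0 ⟨le_rfl, zero_le_one⟩]
    exact p.mass_pos e₀ 0 ⟨le_rfl, zero_le_one⟩
  set m := c / s
  have hM : ∀ e, p.edgeMass e = m := fun e => by
    rw [MetricDensity.edgeMass, intervalIntegral.integral_congr (g := fun _ => m) fun x hx => ?_]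
    · simp
    · rw [Set.uIcc_of_le zero_le_one] at hx
      exact hmass e x hx
  have hA : ∀ u v, stiffnessForm G p.stiffness u v = s * stiffnessForm G (fun _ => 1) u v :=
    fun u v => by simp [stiffnessForm_apply, hse, Finset.mul_sum]
  have hB : ∀ u v, massForm G p.mass u v = m * massForm G (fun _ => 1) u v := fun u v => by
    rw [massForm_apply, massForm_apply, Finset.mul_sum]
    refine Finset.sum_congr rfl fun e _ => ?_
    rw [← intervalIntegral.integral_const_mul]
    refine intervalIntegral.integral_congr fun x hx => ?_
    rw [Set.uIcc_of_le zero_le_one] at hx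
    simp only [hmass e x hx, ContinuousMap.one_apply]
    ring
  have h' := h.smul hs0 hm0 hA hB
  rw [normalisedEigenvalue_eq, eigenvalue_eq hG h', normFactor]
  simp only [hse, hM, Finset.sum_const, Finset.card_univ, nsmul_eq_mul]
  have h3 : s ^ (2 * α - 2) * s ^ (1 - 2 * α) * s = 1 := by
    rw [← Real.rpow_add hs0, ← Real.rpow_add_one hs0.ne']
    ring_nf
    exact Real.rpow_zero s
  rw [div_mul_eq_mul_div, div_mul_eq_mul_div, div_eq_iff hm0.ne']
  linear_combination (Fintype.card E : ℝ) ^ 2 * ν k * m * h3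

theorem normalisedEigenvalue_zero (hG : G.Connected) (α : ℝ) (p : MetricDensity E) :
    G.normalisedEigenvalue 0 α p = 0 := by
  obtain ⟨e, ν, h⟩ := exists_isSpectralSequence hG p.stiffness_pos p.mass_pos
  rw [normalisedEigenvalue_eq, eigenvalue_eq hG h,
    eigenvalue_zero_eq hG p.stiffness_pos p.mass_pos h, zero_mul]

end Multigraph

theorem mainTheorem8 {V E : Type*} [Fintype V] [Fintype E] [Nonempty E]
    (G : Multigraph V E) (hG : G.Connected) (k : ℕ)
    (α : ℝ) (hα : α ≠ 1 / 2) (hα' : α ≠ 1) :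
    (1 ≤ k → ∀ p : MetricDensity E,
      IsMaxOn (G.normalisedEigenvalue k α) Set.univ p ∨
        IsMinOn (G.normalisedEigenvalue k α) Set.univ p →
      p.IsRegular ∧ p.HasConstantDensity) ∧
    ((∃ pM : MetricDensity E, IsMaxOn (G.normalisedEigenvalue k α) Set.univ pM) →
      (∃ pm : MetricDensity E, IsMinOn (G.normalisedEigenvalue k α) Set.univ pm) →
      ∃ c : ℝ, ∀ p : MetricDensity E, G.normalisedEigenvalue k α p = c) := by
  refine ⟨fun hk p hp => Multigraph.isRegular_and_hasConstantDensity hG hα hα' hk hp, ?_⟩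
  rintro ⟨pM, hM⟩ ⟨pm, hm⟩
  -- For `k = 0` rigidity is unavailable, but the functional vanishes identically.
  rcases Nat.eq_zero_or_pos k with rfl | hk
  · exact ⟨0, Multigraph.normalisedEigenvalue_zero hG α⟩
  · obtain ⟨e, ν, h⟩ := Multigraph.H1.exists_isSpectralSequence (G := G) hG (s := fun _ => 1)
      (w := fun _ => 1) (fun _ => one_pos) fun _ _ _ => one_pos
    obtain ⟨h1, h2⟩ :=
      Multigraph.isRegular_and_hasConstantDensity hG hα hα' hk (Or.inl hM)
    obtain ⟨h3, h4⟩ :=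
      Multigraph.isRegular_and_hasConstantDensity hG hα hα' hk (Or.inr hm)
    refine ⟨Fintype.card E ^ 2 * ν k, fun p => le_antisymm ?_ ?_⟩
    · rw [← Multigraph.normalisedEigenvalue_eq_of_isRegular hG h h1 h2 k α]
      exact hM (Set.mem_univ p)
    · rw [← Multigraph.normalisedEigenvalue_eq_of_isRegular hG h h3 h4 k α]
      exact hm (Set.mem_univ p)
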